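/- Let $P$ be an irreducible stochastic matrix over a finite non-empty set $\Omega$ with $d=|\Omega|$, and let $E(P^n)=\{(i,j): (P^n)_{ij}>0\}$. Let $\mathrm{Arv}(P)_n$ be the space of complex $\Omega\times\Omega$ matrices supported in $E(P^n)$, with the $\ell^\infty(\Omega)$-valued inner product $\langle A,B\rangle=\mathrm{Diag}(A^*B)$ and with $\ell^\infty(\Omega)$ acting on the left and right by diagonal matrices. Let $\mathcal F=\bigoplus_{n\ge 0}\mathrm{Arv}(P)_n$ be the Hilbert $C^*$-module direct sum, and let $Q_n$ be the projection of $\mathcal F$ onto $\mathrm{Arv}(P)_n$. For $A\in \mathrm{Arv}(P)_n$ let $S_A^{(n)}$ be the adjointable operator on $\mathcal F$ which maps $B\in\mathrm{Arv}(P)_m$ to the matrix in $\mathrm{Arv}(P)_{n+m}$ with entries $$\big(S^{(n)}_A B\big)_{ik}=\big((P^{n+m})_{ik}\big)^{-1/2}\sum_{j\in\Omega}\sqrt{(P^n)_{ij}}\,A_{ij}\,\sqrt{(P^m)_{jk}}\,B_{jk},\qquad (i,k)\in E(P^{n+m}).$$ Let $\mathcal T(P)$ be the $C^*$-algebra of adjointable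 operators on $\mathcal F$ generated by $\ell^\infty(\Omega)$ (acting on the left) and all $S_A^{(n)}$, $n\ge 0$, $A\in \mathrm{Arv}(P)_n$. Let $\mathcal J=\{T\in\mathcal T(P):\lim_n\|TQ_n\|=0\}$, which is a two-sided $*$-ideal of $\mathcal T(P)$, let $\mathcal O(P)=\mathcal T(P)/\mathcal J$, and let $q:\mathcal T(P)\to\mathcal O(P)$ be the quotient map. For $k\in\Omega$ let $\mathcal F_{P,k}=\mathcal F\otimes_{\ell^\infty(\Omega)}\mathbb C e_k$ (the Hilbert space of $k$-th columns of elements of $\mathcal F$), and let $\pi_k:\mathcal T(P)\to B(\mathcal F_{P,k})$ be $\pi_k(T)(\xi\otimes e_k)=T\xi\otimes e_k$. Then the following hold. 1. The map $T\mapsto(\pi_k(T))_{k\in\Omega}$ is injective on $\mathcal T(P)$ and maps $\mathcal J$ onto $\bigoplus_{k\in\Omega}\mathcal K(\mathcal F_{P,k})$, where $\mathcal K$ denotes the compact operators. 2. The $d$ representations $\pi_k$, $k\in\Omega$, are irreducible, infinite-dimensional, pairwise not unitarily equivalent, and do not annihilate $\mathcal J$. 3. $\mathcal O(P)$ is $*$-isomorphic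 to $C(\mathbb T,M_d(\mathbb C))$. For any $*$-isomorphism used to identify these algebras, and with $ev_\lambda:C(\mathbb T,M_d(\mathbb C))\to M_d(\mathbb C)$ the evaluation at $\lambda\in\mathbb T$, the representations $ev_\lambda\circ q$, $\lambda\in\mathbb T$, are irreducible, $d$-dimensional, pairwise not unitarily equivalent, and annihilate $\mathcal J$. 4. Every irreducible representation of $\mathcal T(P)$ on a Hilbert space that does not annihilate $\mathcal J$ is unitarily equivalent to $\pi_k$ for exactly one $k\in\Omega$, and every irreducible representation that annihilates $\mathcal J$ is unitarily equivalent to $ev_\lambda\circ q$ for exactly one $\lambda\in\mathbb T$. -/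

import Mathlib

open Filter Topology

noncomputable section

namespace StochasticToeplitz

variable {Ω : Type*} [Fintype Ω] [DecidableEq Ω]

/-- The pairs `(n, i)` with `(i, k) ∈ E(P ^ n)`. They index the orthonormal basis
`e_{ik}^{(n)}` of the `k`-th column of the Fock space. -/
abbrev Idx (P : Matrix.rowStochastic ℝ Ω) (k : Ω) : Type _ :=
  {p : ℕ × Ω // 0 < ((P : Matrix Ω Ω ℝ) ^ p.1) p.2 k}

/-- The Hilbert space `F_{P,k} = ⨁ₙ Arv(P)_{n,k}`, with orthonormal basis `e_{ik}^{(n)}`,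
`(i, k) ∈ E(P ^ n)`. -/
abbrev FockCol (P : Matrix.rowStochastic ℝ Ω) (k : Ω) : Type _ :=
  lp (fun _ : Idx P k => ℂ) 2

/-- The Fock module `F_{Arv(P)} = ⨁ₙ Arv(P)ₙ` over `ℓ^∞(Ω)`. An element is a sequence of matrices
`Aₙ ∈ Arv(P)ₙ` for which `∑ₙ Diag(Aₙ* Aₙ)` converges in `ℓ^∞(Ω)`; as `Ω` is finite this says that
every column is square summable, and we store the element by its columns. The norm
`‖x‖ = ‖⟨x, x⟩‖^(1/2)` is the maximum of the `ℓ²`-norms of the columns. -/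
abbrev Fock (P : Matrix.rowStochastic ℝ Ω) : Type _ := (k : Ω) → FockCol P k

/-- The `ℓ^∞(Ω)`-valued inner product `⟨x, y⟩ = ∑ₙ Diag(xₙ* yₙ)` of the Fock module. -/
def modInner {P : Matrix.rowStochastic ℝ Ω} (x y : Fock P) : Ω → ℂ :=
  fun k => inner ℂ (x k) (y k)

/-- The component in `Arv(P)ₙ` of an element of the Fock module, as a matrix. -/
def fiber {P : Matrix.rowStochastic ℝ Ω} (x : Fock P) (n : ℕ) : Matrix Ω Ω ℂ :=
  fun i k => if h : 0 < ((P : Matrix Ω Ω ℝ) ^ n) i k then x k ⟨(n, i), h⟩ else 0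

/-- The fiber `Arv(P)ₙ`: matrices supported in `E(P ^ n)`. -/
def Arv (P : Matrix.rowStochastic ℝ Ω) (n : ℕ) : Submodule ℂ (Matrix Ω Ω ℂ) where
  carrier := {A | ∀ i j, ¬ 0 < ((P : Matrix Ω Ω ℝ) ^ n) i j → A i j = 0}
  add_mem' hA hB i j h := by simp [hA i j h, hB i j h]
  zero_mem' i j h := rfl
  smul_mem' c A hA i j h := by simp [hA i j h]

/-- The entrywise square root of a matrix, with complex entries. -/
def sqrtMat (M : Matrix Ω Ω ℝ) : Matrix Ω Ω ℂ := fun i j => (Real.sqrt (M i j) : ℂ)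

/-- `M^♭`: the entrywise inverse, with value `0` at the zero entries (`0⁻¹ = 0`). -/
def flat (M : Matrix Ω Ω ℂ) : Matrix Ω Ω ℂ := fun i j => (M i j)⁻¹

/-- The subproduct map `U_{n,m}(A ⊗ B) = (√P^{n+m})^♭ * [(√Pⁿ * A) (√Pᵐ * B)]`, where `*` is the
Schur product. For `n = 0` or `m = 0` this is the left, respectively right, multiplication by a
diagonal matrix. -/
def subprod (P : Matrix.rowStochastic ℝ Ω) (n m : ℕ) (A B : Matrix Ω Ω ℂ) : Matrix Ω Ω ℂ :=
  Matrix.hadamard (flat (sqrtMat ((P : Matrix Ω Ω ℝ) ^ (n + m))))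
    (Matrix.hadamard (sqrtMat ((P : Matrix Ω Ω ℝ) ^ n)) A *
      Matrix.hadamard (sqrtMat ((P : Matrix Ω Ω ℝ) ^ m)) B)

/-! ### Adjointable operators -/

/-- `S` is an adjoint of `T` for the `ℓ^∞(Ω)`-valued inner product. -/
def IsAdj {P : Matrix.rowStochastic ℝ Ω} (T S : Fock P →L[ℂ] Fock P) : Prop :=
  ∀ x y, modInner (T x) y = modInner x (S y)

section adj

variable {P : Matrix.rowStochastic ℝ Ω}

theorem IsAdj.symm {T S : Fock P →L[ℂ] Fock P} (h : IsAdj T S) : IsAdj S T := by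
  intro x y
  funext k
  have := congrArg (starRingEnd ℂ) (congrFun (h y x) k)
  simp only [modInner, inner_conj_symm] at this ⊢
  exact this.symm

theorem modInner_ext {x y : Fock P} (h : ∀ z, modInner z x = modInner z y) : x = y := by
  funext k
  refine ext_inner_left ℂ fun v => ?_
  simpa [modInner] using congrFun (h (Pi.single k v)) k

theorem IsAdj.unique {T S S' : Fock P →L[ℂ] Fock P} (h : IsAdj T S) (h' : IsAdj T S') :
    S = S' := by
  ext1 y
  exact modInner_ext fun z => by rw [← h z y, ← h' z y]

theorem IsAdj.norm_le {T S : Fock P →L[ℂ] Fock P} (h : IsAdj T S) : ‖S‖ ≤ ‖T‖ := by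
  refine ContinuousLinearMap.opNorm_le_bound _ (norm_nonneg _) fun y => ?_
  by_cases h0 : ‖S y‖ = 0
  · rw [h0]; positivity
  have hpos : 0 < ‖S y‖ := lt_of_le_of_ne (norm_nonneg _) (Ne.symm h0)
  have key : ‖S y‖ ≤ Real.sqrt (‖T‖ * ‖S y‖ * ‖y‖) := by
    refine (pi_norm_le_iff_of_nonneg (Real.sqrt_nonneg _)).2 fun k => ?_
    refine Real.le_sqrt_of_sq_le ?_
    have h1 := congrFun (h (S y) y) k
    simp only [modInner] at h1
    have h2 : ‖S y k‖ ^ 2 = ‖inner ℂ (S y k) (S y k)‖ := by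
      rw [inner_self_eq_norm_sq_to_K]; simp
    rw [h2, ← h1]
    refine (norm_inner_le_norm _ _).trans ?_
    exact mul_le_mul ((norm_le_pi_norm _ k).trans (T.le_opNorm _)) (norm_le_pi_norm _ k)
      (norm_nonneg _) (by positivity)
  have h3 : ‖S y‖ ^ 2 ≤ ‖T‖ * ‖S y‖ * ‖y‖ := (Real.le_sqrt' hpos).1 key
  nlinarith

theorem IsAdj.one : IsAdj (1 : Fock P →L[ℂ] Fock P) 1 := fun _ _ => rfl

theorem IsAdj.add {T T' S S' : Fock P →L[ℂ] Fock P} (h : IsAdj T S) (h' : IsAdj T' S') :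
    IsAdj (T + T') (S + S') := by
  intro x y
  funext k
  have h1 := congrFun (h x y) k
  have h2 := congrFun (h' x y) k
  simp only [modInner, add_apply, Pi.add_apply, inner_add_left,
    inner_add_right] at h1 h2 ⊢
  rw [h1, h2]

theorem IsAdj.smul {T S : Fock P →L[ℂ] Fock P} (h : IsAdj T S) (c : ℂ) :
    IsAdj (c • T) (star c • S) := by
  intro x y
  funext k
  have h1 := congrFun (h x y) k
  simp only [modInner, smul_apply, Pi.smul_apply, inner_smul_left,
    inner_smul_right] at h1 ⊢
  rw [h1]
  rfl

theorem IsAdj.mul {T T' S S' : Fock P →L[ℂ] Fock P} (h : IsAdj T S) (h' : IsAdj T' S') :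
    IsAdj (T * T') (S' * S) := by
  intro x y
  exact (h (T' x) y).trans (h' x (S y))

end adj

/-- The adjointable operators of the Fock module, inside all bounded operators. -/
def adjointableSubalgebra (P : Matrix.rowStochastic ℝ Ω) :
    Subalgebra ℂ (Fock P →L[ℂ] Fock P) where
  carrier := {T | ∃ S, IsAdj T S}
  mul_mem' := fun ⟨_, h⟩ ⟨_, h'⟩ => ⟨_, h.mul h'⟩
  add_mem' := fun ⟨_, h⟩ ⟨_, h'⟩ => ⟨_, h.add h'⟩
  algebraMap_mem' c := ⟨_, by
    rw [Algebra.algebraMap_eq_smul_one]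
    exact IsAdj.one.smul c⟩

/-- The algebra `L(F_{Arv(P)})` of adjointable operators of the Fock module. -/
def Adjointable (P : Matrix.rowStochastic ℝ Ω) : Type _ := adjointableSubalgebra P

/-- The operations are those of operators and the norm is the operator norm. -/
instance (P : Matrix.rowStochastic ℝ Ω) : NormedRing (Adjointable P) :=
  inferInstanceAs (NormedRing (adjointableSubalgebra P))

instance (P : Matrix.rowStochastic ℝ Ω) : NormedAlgebra ℂ (Adjointable P) :=
  inferInstanceAs (NormedAlgebra ℂ (adjointableSubalgebra P))

section star

variable {P : Matrix.rowStochastic ℝ Ω}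

/-- The involution of `L(F_{Arv(P)})` is the passage to the (unique) adjoint. -/
instance : Star (Adjointable P) :=
  ⟨fun T => ⟨T.2.choose, T.1, T.2.choose_spec.symm⟩⟩

theorem isAdj_star (T : Adjointable P) : IsAdj T.1 (star T).1 := T.2.choose_spec

theorem star_eq_of_isAdj {T S : Adjointable P} (h : IsAdj T.1 S.1) : star T = S :=
  Subtype.ext ((isAdj_star T).unique h)

instance : StarRing (Adjointable P) where
  star_involutive T := star_eq_of_isAdj (isAdj_star T).symm
  star_mul T S := star_eq_of_isAdj ((isAdj_star T).mul (isAdj_star S))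
  star_add T S := star_eq_of_isAdj ((isAdj_star T).add (isAdj_star S))

instance : StarModule ℂ (Adjointable P) where
  star_smul c T := star_eq_of_isAdj ((isAdj_star T).smul c)

instance : NormedStarGroup (Adjointable P) where
  norm_star_le T := (isAdj_star T).norm_le

/-- Adjointable operators act column by column. -/
theorem adjointable_local (T : Adjointable P) {x y : Fock P} {k : Ω} (h : x k = y k) :
    T.1 x k = T.1 y k := by
  refine ext_inner_right ℂ fun v => ?_
  have hx := congrFun (isAdj_star T x (Pi.single k v)) k
  have hy := congrFun (isAdj_star T y (Pi.single k v)) k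
  simp only [modInner, Pi.single_eq_same] at hx hy
  rw [hx, hy, h]

end star

/-- The adjointable operator with prescribed coordinates `L x`, for a linear `L` that is bounded
on each column. -/
def ofCoord {P : Matrix.rowStochastic ℝ Ω} (L : Fock P →ₗ[ℂ] ((k : Ω) → Idx P k → ℂ)) (C : ℝ)
    (hC : 0 ≤ C)
    (hL : ∀ x k (s : Finset (Idx P k)), ∑ p ∈ s, ‖L x k p‖ ^ 2 ≤ (C * ‖x k‖) ^ 2) :
    Adjointable P :=
  have hmem : ∀ x k, Memℓp (L x k) 2 := fun x k =>
    memℓp_gen' (C := (C * ‖x k‖) ^ 2) (by simpa using hL x k)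
  have hnorm : ∀ x k, ‖(⟨L x k, hmem x k⟩ : FockCol P k)‖ ≤ C * ‖x k‖ := fun x k =>
    lp.norm_le_of_forall_sum_le (by simp) (by positivity) (by simpa using hL x k)
  let T : Fock P →L[ℂ] Fock P := LinearMap.mkContinuous
    { toFun := fun x k => ⟨L x k, hmem x k⟩
      map_add' := fun x y => by funext k; ext p; simp; rfl
      map_smul' := fun c x => by funext k; ext p; simp }
    C (fun x => (pi_norm_le_iff_of_nonneg (by positivity)).2 fun k =>
      (hnorm x k).trans (mul_le_mul_of_nonneg_left (norm_le_pi_norm x k) hC))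
  ⟨T, by
    let T' : (k : Ω) → FockCol P k →L[ℂ] FockCol P k := fun k =>
      (ContinuousLinearMap.proj k).comp (T.comp (ContinuousLinearMap.single ℂ (FockCol P) k))
    have hT' : ∀ x k, T x k = T' k (x k) := by
      intro x k
      rw [← sub_eq_zero]
      have h1 : T x k - T' k (x k) = T (x - Pi.single k (x k)) k := by
        simp only [map_sub]; rfl
      rw [h1, ← norm_le_zero_iff]
      refine (hnorm (x - Pi.single k (x k)) k).trans ?_
      simp
    refine ⟨ContinuousLinearMap.pi fun k =>
      (ContinuousLinearMap.adjoint (T' k)).comp (ContinuousLinearMap.proj k), fun x y => ?_⟩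
    funext k
    simp only [modInner, hT']
    exact (ContinuousLinearMap.adjoint_inner_right (T' k) (x k) (y k)).symm⟩

theorem ofCoord_apply {P : Matrix.rowStochastic ℝ Ω}
    (L : Fock P →ₗ[ℂ] ((k : Ω) → Idx P k → ℂ)) (C : ℝ) (hC : 0 ≤ C)
    (hL : ∀ x k (s : Finset (Idx P k)), ∑ p ∈ s, ‖L x k p‖ ^ 2 ≤ (C * ‖x k‖) ^ 2)
    (x : Fock P) (k : Ω) (p : Idx P k) : (ofCoord L C hC hL).1 x k p = L x k p := rfl

theorem norm_ofCoord_le {P : Matrix.rowStochastic ℝ Ω}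
    (L : Fock P →ₗ[ℂ] ((k : Ω) → Idx P k → ℂ)) (C : ℝ) (hC : 0 ≤ C)
    (hL : ∀ x k (s : Finset (Idx P k)), ∑ p ∈ s, ‖L x k p‖ ^ 2 ≤ (C * ‖x k‖) ^ 2) :
    ‖ofCoord L C hC hL‖ ≤ C := by
  refine ContinuousLinearMap.opNorm_le_bound (ofCoord L C hC hL).1 hC fun x => ?_
  refine (pi_norm_le_iff_of_nonneg (by positivity)).2 fun k => ?_
  have h : ‖(ofCoord L C hC hL).1 x k‖ ≤ C * ‖x k‖ :=
    lp.norm_le_of_forall_sum_le (by simp) (by positivity) (by simpa [ofCoord_apply] using hL x k)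
  exact h.trans (mul_le_mul_of_nonneg_left (norm_le_pi_norm x k) hC)

/-! ### The generators -/

section gens

variable {P : Matrix.rowStochastic ℝ Ω}

/-- The operator multiplying the coordinate `(n, i)` of every column by `f n i`. -/
def mulOp (f : ℕ → Ω → ℂ) (C : ℝ) (hC : 0 ≤ C) (hf : ∀ n i, ‖f n i‖ ≤ C) : Adjointable P :=
  ofCoord
    { toFun := fun x k p => f p.1.1 p.1.2 * x k p
      map_add' := fun x y => by funext k p; simp [mul_add]
      map_smul' := fun c x => by funext k p; simp [mul_left_comm] }
    C hC (fun x k s => by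
      have h := lp.sum_rpow_le_norm_rpow (p := 2) (by simp) (x k) s
      simp only [ENNReal.toReal_ofNat, Real.rpow_ofNat] at h
      rw [mul_pow]
      refine le_trans ?_ (mul_le_mul_of_nonneg_left h (sq_nonneg C))
      rw [Finset.mul_sum]
      refine Finset.sum_le_sum fun p _ => ?_
      simp only [LinearMap.coe_mk, AddHom.coe_mk, norm_mul, mul_pow]
      gcongr
      exact hf _ _)

/-- The left action of `ℓ^∞(Ω)` on the Fock module: left multiplication by diagonal matrices. -/
def leftAct (a : Ω → ℂ) : Adjointable P :=
  mulOp (fun _ i => a i) ‖a‖ (norm_nonneg _) (fun _ i => norm_le_pi_norm a i)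

/-- The projection `Qₙ` of the Fock module onto the fiber `Arv(P)ₙ`. -/
def fiberProj (P : Matrix.rowStochastic ℝ Ω) (n : ℕ) : Adjointable P :=
  mulOp (fun m _ => if m = n then 1 else 0) 1 zero_le_one (fun m _ => by split_ifs <;> simp)

theorem sum_fiber_le (x : Fock P) (k : Ω) (M : ℕ) :
    ∑ m ∈ Finset.range M, ∑ j, ‖fiber x m j k‖ ^ 2 ≤ ‖x k‖ ^ 2 := by
  classical
  have h := lp.sum_rpow_le_norm_rpow (p := 2) (by simp) (x k)
    ((Finset.range M ×ˢ (Finset.univ : Finset Ω)).subtype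
      (fun p => 0 < ((P : Matrix Ω Ω ℝ) ^ p.1) p.2 k))
  simp only [ENNReal.toReal_ofNat, Real.rpow_ofNat] at h
  refine le_trans (le_of_eq ?_) h
  rw [← Finset.sum_product']
  have h2 : ∀ p : Idx P k, ‖x k p‖ ^ 2 = ‖fiber x p.1.1 p.1.2 k‖ ^ 2 := by
    intro p
    rw [fiber, dif_pos p.2]
  simp_rw [h2]
  rw [Finset.sum_subtype_eq_sum_filter (f := fun p : ℕ × Ω => ‖fiber x p.1 p.2 k‖ ^ 2),
    Finset.sum_filter]
  refine Finset.sum_congr rfl fun p _ => ?_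
  split_ifs with hp
  · rfl
  · simp [fiber, hp]

theorem norm_subprod_sq_le (n m : ℕ) (A B : Matrix Ω Ω ℂ) (i k : Ω) :
    ‖subprod P n m A B i k‖ ^ 2 ≤ (∑ i, ∑ j, ‖A i j‖ ^ 2) * ∑ j, ‖B j k‖ ^ 2 := by
  have hnn : ∀ (n : ℕ) (i j : Ω), 0 ≤ ((P : Matrix Ω Ω ℝ) ^ n) i j := fun n i j =>
    Matrix.nonneg_of_mem_rowStochastic (pow_mem P.2 n)
  set r : ℝ := ((P : Matrix Ω Ω ℝ) ^ (n + m)) i k with hr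
  have hr' : r = ∑ j, ((P : Matrix Ω Ω ℝ) ^ n) i j * ((P : Matrix Ω Ω ℝ) ^ m) j k := by
    rw [hr, pow_add, Matrix.mul_apply]
  have h1 : ‖subprod P n m A B i k‖ ≤ (Real.sqrt r)⁻¹ *
      ∑ j, (Real.sqrt (((P : Matrix Ω Ω ℝ) ^ n) i j) * Real.sqrt (((P : Matrix Ω Ω ℝ) ^ m) j k)) *
        (‖A i j‖ * ‖B j k‖) := by
    simp only [subprod, Matrix.hadamard_apply, Matrix.mul_apply, flat, sqrtMat, norm_mul, norm_inv,
      Complex.norm_real, Real.norm_eq_abs, abs_of_nonneg (Real.sqrt_nonneg _)]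
    refine mul_le_mul_of_nonneg_left ((norm_sum_le _ _).trans (Finset.sum_le_sum fun j _ => ?_))
      (by positivity)
    simp only [norm_mul, Complex.norm_real, Real.norm_eq_abs, abs_of_nonneg (Real.sqrt_nonneg _)]
    apply le_of_eq
    ring
  have h2 := Finset.sum_mul_sq_le_sq_mul_sq Finset.univ
    (fun j => Real.sqrt (((P : Matrix Ω Ω ℝ) ^ n) i j) * Real.sqrt (((P : Matrix Ω Ω ℝ) ^ m) j k))
    (fun j => ‖A i j‖ * ‖B j k‖)
  simp only [mul_pow, Real.sq_sqrt (hnn _ _ _)] at h2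
  rw [← hr'] at h2
  have hr0 : 0 ≤ r := hnn _ _ _
  have h3 : ∑ j, ‖A i j‖ ^ 2 * ‖B j k‖ ^ 2 ≤ (∑ i, ∑ j, ‖A i j‖ ^ 2) * ∑ j, ‖B j k‖ ^ 2 := by
    rw [Finset.mul_sum]
    refine Finset.sum_le_sum fun j _ => mul_le_mul_of_nonneg_right ?_ (by positivity)
    refine (Finset.single_le_sum (f := fun j => ‖A i j‖ ^ 2) (fun _ _ => by positivity)
      (Finset.mem_univ j)).trans ?_
    exact Finset.single_le_sum (f := fun i => ∑ j, ‖A i j‖ ^ 2)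
      (fun _ _ => by positivity) (Finset.mem_univ i)
  refine (pow_le_pow_left₀ (norm_nonneg _) h1 2).trans (le_trans ?_ h3)
  rw [mul_pow, inv_pow, Real.sq_sqrt hr0]
  refine (mul_le_mul_of_nonneg_left h2 (by positivity)).trans ?_
  rw [← mul_assoc]
  refine mul_le_of_le_one_left (Finset.sum_nonneg fun _ _ => by positivity) ?_
  exact inv_mul_le_one

theorem fiber_add (x y : Fock P) (n : ℕ) : fiber (x + y) n = fiber x n + fiber y n := by
  ext i k
  simp only [fiber, Matrix.add_apply]
  split_ifs <;> simp

theorem fiber_smul (c : ℂ) (x : Fock P) (n : ℕ) : fiber (c • x) n = c • fiber x n := by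
  ext i k
  simp only [fiber, Matrix.smul_apply]
  split_ifs <;> simp

/-- The shift `S_A^{(n)}`, determined by `S_A^{(n)}(B) = U_{n,m}(A ⊗ B)` for `B ∈ Arv(P)ₘ`: the
component of `S_A^{(n)} x` in `Arv(P)_N` is `U_{n,N-n}(A ⊗ x_{N-n})` if `n ≤ N`, and `0` else. -/
def shift (n : ℕ) (A : Matrix Ω Ω ℂ) : Adjointable P :=
  ofCoord
    { toFun := fun x k p =>
        if n ≤ p.1.1 then subprod P n (p.1.1 - n) A (fiber x (p.1.1 - n)) p.1.2 k else 0
      map_add' := fun x y => by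
        funext k p
        simp only [fiber_add, Pi.add_apply]
        split_ifs
        · simp [subprod, Matrix.hadamard_add, mul_add]
        · simp
      map_smul' := fun c x => by
        funext k p
        simp only [fiber_smul, Pi.smul_apply, RingHom.id_apply]
        split_ifs
        · simp [subprod, Matrix.hadamard_smul, mul_left_comm]
        · simp }
    (Real.sqrt ((Fintype.card Ω) * ∑ i, ∑ j, ‖A i j‖ ^ 2)) (Real.sqrt_nonneg _)
    (fun x k s => by
      classical
      set a : ℝ := ∑ i, ∑ j, ‖A i j‖ ^ 2 with ha
      have ha0 : 0 ≤ a := by positivity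
      rw [mul_pow, Real.sq_sqrt (by positivity)]
      let G : ℕ × Ω → ℝ := fun q =>
        if n ≤ q.1 then a * ∑ j, ‖fiber x (q.1 - n) j k‖ ^ 2 else 0
      have hG0 : ∀ q, 0 ≤ G q := fun q => by
        simp only [G]; split_ifs <;> positivity
      obtain ⟨M, hM⟩ : ∃ M, ∀ p ∈ s, p.1.1 < M :=
        ⟨s.sup (fun p => p.1.1) + 1, fun p hp =>
          Nat.lt_succ_of_le (Finset.le_sup (f := fun p : Idx P k => p.1.1) hp)⟩
      calc _ ≤ ∑ p ∈ s, G p.1 := by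
            refine Finset.sum_le_sum fun p _ => ?_
            simp only [LinearMap.coe_mk, AddHom.coe_mk, G]
            split_ifs
            · exact norm_subprod_sq_le _ _ _ _ _ _
            · simp
        _ = ∑ q ∈ s.map (Function.Embedding.subtype _), G q := by
            rw [Finset.sum_map]; rfl
        _ ≤ ∑ q ∈ Finset.range (n + M) ×ˢ (Finset.univ : Finset Ω), G q := by
            refine Finset.sum_le_sum_of_subset_of_nonneg ?_ (fun _ _ _ => hG0 _)
            intro q hq
            obtain ⟨p, hp, rfl⟩ := Finset.mem_map.1 hq
            have := hM p hp
            simp only [Finset.mem_product, Finset.mem_range, Finset.mem_univ, and_true]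
            exact lt_of_lt_of_le this (Nat.le_add_left _ _)
        _ = Fintype.card Ω * a * ∑ m ∈ Finset.range M, ∑ j, ‖fiber x m j k‖ ^ 2 := by
            rw [Finset.sum_product, Finset.sum_range_add]
            have h0 : ∑ N ∈ Finset.range n, ∑ i : Ω, G (N, i) = 0 := by
              refine Finset.sum_eq_zero fun N hN => Finset.sum_eq_zero fun i _ => ?_
              have := Finset.mem_range.1 hN
              simp only [G]
              rw [if_neg (by omega)]
            rw [h0, zero_add, Finset.mul_sum]
            refine Finset.sum_congr rfl fun m _ => ?_
            simp [G, mul_assoc]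
        _ ≤ _ := mul_le_mul_of_nonneg_left (sum_fiber_le x k M) (by positivity))

end gens

/-- The Toeplitz algebra `T(P)`: the C*-subalgebra of `L(F_{Arv(P)})` generated by `ℓ^∞(Ω)` and
all shifts `S_A^{(n)}`, `A ∈ Arv(P)ₙ`. -/
def toeplitz (P : Matrix.rowStochastic ℝ Ω) : StarSubalgebra ℂ (Adjointable P) :=
  (StarAlgebra.adjoin ℂ (Set.range (leftAct (P := P)) ∪
    {S | ∃ n, ∃ A ∈ Arv P n, S = shift n A})).topologicalClosure

/-! ### The Cuntz-Pimsner ideal and the Cuntz-Pimsner algebra -/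

section ideal

variable {P : Matrix.rowStochastic ℝ Ω}

theorem mulOp_apply (f : ℕ → Ω → ℂ) (C : ℝ) (hC : 0 ≤ C) (hf : ∀ n i, ‖f n i‖ ≤ C)
    (x : Fock P) (k : Ω) (p : Idx P k) :
    (mulOp f C hC hf).1 x k p = f p.1.1 p.1.2 * x k p := rfl

theorem star_mulOp (f : ℕ → Ω → ℂ) (C : ℝ) (hC : 0 ≤ C) (hf : ∀ n i, ‖f n i‖ ≤ C)
    (hreal : ∀ n i, star (f n i) = f n i) :
    star (mulOp (P := P) f C hC hf) = mulOp f C hC hf := by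
  refine star_eq_of_isAdj fun x y => ?_
  funext k
  simp only [modInner, lp.inner_eq_tsum, mulOp_apply]
  refine tsum_congr fun p => ?_
  have := hreal p.1.1 p.1.2
  have h2 : (starRingEnd ℂ) (f p.1.1 p.1.2) = f p.1.1 p.1.2 := this
  simp only [RCLike.inner_apply, map_mul, h2]
  ring

theorem norm_mulOp_le (f : ℕ → Ω → ℂ) (hf : ∀ n i, ‖f n i‖ ≤ 1) :
    ‖mulOp (P := P) f 1 zero_le_one hf‖ ≤ 1 :=
  norm_ofCoord_le _ _ _ _

/-- The band projection onto the fibers `m` with `|m - n| ≤ w`. -/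
def bandProj (P : Matrix.rowStochastic ℝ Ω) (w n : ℕ) : Adjointable P :=
  mulOp (fun m _ => if m ≤ n + w ∧ n ≤ m + w then 1 else 0) 1 zero_le_one
    (fun m _ => by split_ifs <;> simp)

theorem bandProj_eq_sum (w n : ℕ) :
    bandProj P w n = ∑ m ∈ Finset.Icc (n - w) (n + w), fiberProj P m := by
  apply Subtype.ext
  ext x k p
  have h : ∀ s : Finset ℕ, (∑ m ∈ s, fiberProj P m).1 x k p =
      ∑ m ∈ s, (fiberProj P m).1 x k p := by
    intro s
    induction s using Finset.induction_on with
    | empty => rfl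
    | insert a s ha ih =>
      rw [Finset.sum_insert ha, Finset.sum_insert ha, ← ih]
      rfl
  rw [h]
  simp only [bandProj, fiberProj, mulOp_apply, ite_mul, one_mul, zero_mul, Finset.sum_ite_eq,
    Finset.mem_Icc]
  exact if_congr (by omega) rfl rfl

/-- `T` moves fibers by at most `w`. -/
def Banded (T : Adjointable P) (w : ℕ) : Prop :=
  ∀ (x : Fock P) (k : Ω) (p : Idx P k),
    (∀ q : Idx P k, q.1.1 ≤ p.1.1 + w → p.1.1 ≤ q.1.1 + w → x k q = 0) → T.1 x k p = 0

theorem Banded.mono {T : Adjointable P} {w w' : ℕ} (h : Banded T w) (hw : w ≤ w') :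
    Banded T w' := fun x k p hx =>
  h x k p fun q h1 h2 => hx q (by omega) (by omega)

theorem Banded.add {T S : Adjointable P} {w : ℕ} (hT : Banded T w) (hS : Banded S w) :
    Banded (T + S) w := fun x k p hx => by
  have h1 := hT x k p hx
  have h2 := hS x k p hx
  change T.1 x k p + S.1 x k p = 0
  rw [h1, h2, add_zero]

theorem Banded.mul {T S : Adjointable P} {w w' : ℕ} (hT : Banded T w) (hS : Banded S w') :
    Banded (T * S) (w + w') := fun x k p hx => by
  refine hT (S.1 x) k p fun q h1 h2 => hS x k q fun q' h3 h4 => hx q' (by omega) (by omega)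

theorem Banded.adj {T : Adjointable P} {w : ℕ} (hT : Banded T w) : Banded (star T) w := by
  classical
  intro x k p hx
  let y : Fock P := Pi.single k (lp.single (E := fun _ : Idx P k => ℂ) 2 p (1 : ℂ))
  have h := congrFun ((isAdj_star T).symm x y) k
  simp only [modInner, y, Pi.single_eq_same] at h
  have h1 : inner ℂ ((star T).1 x k) (lp.single (E := fun _ : Idx P k => ℂ) 2 p (1 : ℂ)) =
      (starRingEnd ℂ) ((star T).1 x k p) := by
    rw [lp.inner_single_right]
    simp
  have h2 : inner ℂ (x k) (T.1 (Pi.single k (lp.single (E := fun _ : Idx P k => ℂ) 2 p (1 : ℂ))) k) = 0 := by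
    rw [lp.inner_eq_tsum]
    refine (tsum_congr fun q => ?_).trans tsum_zero
    by_cases hq : q.1.1 ≤ p.1.1 + w ∧ p.1.1 ≤ q.1.1 + w
    · rw [hx q hq.1 hq.2, inner_zero_left]
    · rw [hT _ k q fun q' h3 h4 => ?_, inner_zero_right]
      rw [Pi.single_eq_same]
      have : q' ≠ p := by
        rintro rfl
        exact hq ⟨h4, h3⟩
      simp [this]
  rw [h1, h2] at h
  simpa using h

theorem banded_mulOp (f : ℕ → Ω → ℂ) (C : ℝ) (hC : 0 ≤ C) (hf : ∀ n i, ‖f n i‖ ≤ C) :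
    Banded (mulOp (P := P) f C hC hf) 0 := fun x k p hx => by
  rw [mulOp_apply, hx p (by omega) (by omega), mul_zero]

theorem banded_shift (n : ℕ) (A : Matrix Ω Ω ℂ) : Banded (shift (P := P) n A) n := by
  intro x k p hx
  change (if n ≤ p.1.1 then subprod P n (p.1.1 - n) A (fiber x (p.1.1 - n)) p.1.2 k else 0) = 0
  split_ifs with h
  · have h0 : ∀ j, fiber x (p.1.1 - n) j k = 0 := by
      intro j
      simp only [fiber]
      split_ifs
      · exact hx _ (by simp; omega) (by simp; omega)
      · rfl
    simp [subprod, Matrix.mul_apply, h0]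
  · rfl

theorem Banded.fiberProj_mul {T : Adjointable P} {w : ℕ} (hT : Banded T w) (n : ℕ) :
    fiberProj P n * T = fiberProj P n * T * bandProj P w n := by
  apply Subtype.ext
  ext x k p
  change (fiberProj P n).1 (T.1 x) k p = (fiberProj P n).1 (T.1 ((bandProj P w n).1 x)) k p
  simp only [fiberProj, mulOp_apply]
  split_ifs with hp
  · rw [one_mul, one_mul, ← sub_eq_zero]
    have h := hT (x - (bandProj P w n).1 x) k p fun q h1 h2 => by
      change x k q - (bandProj P w n).1 x k q = 0
      rw [bandProj, mulOp_apply, if_pos ⟨hp ▸ h1, hp ▸ h2⟩, one_mul, sub_self]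
    rw [map_sub] at h
    exact h
  · simp

theorem exists_banded_of_mem_adjoin {T : Adjointable P}
    (hT : T ∈ StarAlgebra.adjoin ℂ (Set.range (leftAct (P := P)) ∪
      {S | ∃ n, ∃ A ∈ Arv P n, S = shift n A})) : ∃ w, Banded T w := by
  induction hT using StarAlgebra.adjoin_induction with
  | mem T hT =>
    rcases hT with ⟨a, rfl⟩ | ⟨n, A, _, rfl⟩
    · exact ⟨0, banded_mulOp _ _ _ _⟩
    · exact ⟨n, banded_shift n A⟩
  | algebraMap c =>
    refine ⟨0, fun x k p hx => ?_⟩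
    change (c • x) k p = 0
    simp [hx p (by omega) (by omega)]
  | add T S _ _ hT hS =>
    obtain ⟨w, hw⟩ := hT
    obtain ⟨w', hw'⟩ := hS
    exact ⟨max w w', (hw.mono (le_max_left _ _)).add (hw'.mono (le_max_right _ _))⟩
  | mul T S _ _ hT hS =>
    obtain ⟨w, hw⟩ := hT
    obtain ⟨w', hw'⟩ := hS
    exact ⟨_, hw.mul hw'⟩
  | star T _ hT =>
    obtain ⟨w, hw⟩ := hT
    exact ⟨w, hw.adj⟩

theorem norm_fiberProj_le (n : ℕ) : ‖fiberProj P n‖ ≤ 1 := norm_mulOp_le _ _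

theorem star_fiberProj (n : ℕ) : star (fiberProj P n) = fiberProj P n :=
  star_mulOp _ _ _ _ fun m _ => by split_ifs <;> simp

theorem tendsto_fiberProj_mul {T : Adjointable P} (hT : T ∈ toeplitz P)
    (hJ : Tendsto (fun n => ‖T * fiberProj P n‖) atTop (𝓝 0)) :
    Tendsto (fun n => ‖fiberProj P n * T‖) atTop (𝓝 0) := by
  rw [Metric.tendsto_atTop]
  intro ε hε
  have hcl : T ∈ closure ((StarAlgebra.adjoin ℂ (Set.range (leftAct (P := P)) ∪
      {S | ∃ n, ∃ A ∈ Arv P n, S = shift n A}) : StarSubalgebra ℂ (Adjointable P)) :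
        Set (Adjointable P)) := hT
  obtain ⟨X, hX, hTX⟩ := Metric.mem_closure_iff.1 hcl (ε / 4) (by positivity)
  obtain ⟨w, hw⟩ := exists_banded_of_mem_adjoin hX
  have hXT : ‖X - T‖ < ε / 4 := by rwa [← dist_eq_norm, dist_comm]
  rw [Metric.tendsto_atTop] at hJ
  obtain ⟨N, hN⟩ := hJ (ε / (4 * (2 * w + 1))) (by positivity)
  refine ⟨N + w, fun n hn => ?_⟩
  have h1 : fiberProj P n * T = fiberProj P n * (T - X) +
      fiberProj P n * (X - T) * bandProj P w n + fiberProj P n * (T * bandProj P w n) := by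
    rw [mul_sub, mul_sub, sub_mul, ← hw.fiberProj_mul n, mul_assoc]
    abel
  have hb : ‖bandProj P w n‖ ≤ 1 := norm_mulOp_le _ _
  have hq : ‖fiberProj P n‖ ≤ 1 := norm_fiberProj_le n
  have h2 : ‖T * bandProj P w n‖ ≤ ε / 4 := by
    rw [bandProj_eq_sum, Finset.mul_sum]
    refine (norm_sum_le _ _).trans ?_
    have h3 : ∀ m ∈ Finset.Icc (n - w) (n + w),
        ‖T * fiberProj P m‖ ≤ ε / (4 * (2 * w + 1)) := by
      intro m hm
      have h4 := hN m (by have := Finset.mem_Icc.1 hm; omega)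
      rw [dist_zero_right, norm_norm] at h4
      exact h4.le
    refine (Finset.sum_le_card_nsmul _ _ _ h3).trans ?_
    have hcard : (Finset.Icc (n - w) (n + w)).card = 2 * w + 1 := by
      rw [Nat.card_Icc]; omega
    rw [hcard, nsmul_eq_mul]
    push_cast
    apply le_of_eq
    field_simp
  rw [dist_zero_right, norm_norm, h1]
  have e1 : ‖fiberProj P n * (T - X)‖ ≤ ε / 4 := by
    refine (norm_mul_le _ _).trans ?_
    rw [norm_sub_rev] at hXT
    nlinarith [norm_nonneg (T - X)]
  have e2 : ‖fiberProj P n * (X - T) * bandProj P w n‖ ≤ ε / 4 := by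
    refine (norm_mul_le _ _).trans ?_
    have : ‖fiberProj P n * (X - T)‖ ≤ ε / 4 := by
      refine (norm_mul_le _ _).trans ?_
      nlinarith [norm_nonneg (X - T)]
    nlinarith [norm_nonneg (fiberProj P n * (X - T))]
  have e3 : ‖fiberProj P n * (T * bandProj P w n)‖ ≤ ε / 4 := by
    refine (norm_mul_le _ _).trans ?_
    nlinarith [norm_nonneg (T * bandProj P w n)]
  have := norm_add₃_le (a := fiberProj P n * (T - X))
    (b := fiberProj P n * (X - T) * bandProj P w n) (c := fiberProj P n * (T * bandProj P w n))
  linarith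

end ideal

/-- The Cuntz-Pimsner ideal `J(T(P)) = {T ∈ T(P) | lim ‖T Qₙ‖ = 0}`. -/
def cpIdeal (P : Matrix.rowStochastic ℝ Ω) : Ideal (toeplitz P) where
  carrier := {T | Tendsto (fun n => ‖(T : Adjointable P) * fiberProj P n‖) atTop (𝓝 0)}
  add_mem' {T S} hT hS := by
    have h := Tendsto.add hT hS
    rw [add_zero] at h
    refine squeeze_zero (fun _ => norm_nonneg _) (fun n => ?_) h
    rw [AddMemClass.coe_add, add_mul]
    exact norm_add_le _ _
  zero_mem' := by simp
  smul_mem' S T hT := by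
    have h := Tendsto.const_mul ‖(S : Adjointable P)‖ hT
    rw [mul_zero] at h
    refine squeeze_zero (fun _ => norm_nonneg _) (fun n => ?_) h
    change ‖(S : Adjointable P) * (T : Adjointable P) * fiberProj P n‖ ≤ _
    rw [mul_assoc]
    exact norm_mul_le _ _

theorem star_mem_cpIdeal {P : Matrix.rowStochastic ℝ Ω} {T : toeplitz P} (hT : T ∈ cpIdeal P) :
    star T ∈ cpIdeal P := by
  have h := tendsto_fiberProj_mul T.2 hT
  refine h.congr fun n => ?_
  rw [← norm_star, star_mul, star_fiberProj]
  rfl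

instance (P : Matrix.rowStochastic ℝ Ω) : (cpIdeal P).IsTwoSided where
  mul_mem_of_left {T} S hT := by
    have h := star_mem_cpIdeal ((cpIdeal P).mul_mem_left (star S) (star_mem_cpIdeal hT))
    simpa using h

/-- The Cuntz-Pimsner algebra `O(P) = T(P) / J(T(P))`. -/
abbrev cuntzPimsner (P : Matrix.rowStochastic ℝ Ω) : Type _ := toeplitz P ⧸ cpIdeal P

/-- The involution induced on the quotient `O(P)`. -/
instance (P : Matrix.rowStochastic ℝ Ω) : Star (cuntzPimsner P) where
  star := Quotient.map' star fun S T h => by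
    rw [Submodule.quotientRel_def] at h ⊢
    rw [← star_sub]
    exact star_mem_cpIdeal h

instance (P : Matrix.rowStochastic ℝ Ω) : StarRing (cuntzPimsner P) where
  star_involutive := by
    rintro ⟨T⟩
    exact congrArg (Ideal.Quotient.mk (cpIdeal P)) (star_star T)
  star_mul := by
    rintro ⟨T⟩ ⟨S⟩
    exact congrArg (Ideal.Quotient.mk (cpIdeal P)) (star_mul T S)
  star_add := by
    rintro ⟨T⟩ ⟨S⟩
    exact congrArg (Ideal.Quotient.mk (cpIdeal P)) (star_add T S)

/-- The quotient map `q : T(P) → O(P)`. -/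
def quotMap (P : Matrix.rowStochastic ℝ Ω) : toeplitz P →⋆ₐ[ℂ] cuntzPimsner P :=
  { Ideal.Quotient.mkₐ ℂ (cpIdeal P) with
    map_star' := fun _ => rfl }

/-! ### Representations -/

/-- The representation `π_k` of `L(F_{Arv(P)})` on `F_{P,k} = F_{Arv(P)} ⊗ ℂ e_k`, given by
`π_k(T)(ξ ⊗ e_k) = T ξ ⊗ e_k`. The vector `ξ ⊗ e_k` is the `k`-th column of `ξ`. -/
def colRep (P : Matrix.rowStochastic ℝ Ω) (k : Ω) :
    Adjointable P →⋆ₐ[ℂ] (FockCol P k →L[ℂ] FockCol P k) where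
  toFun T := (ContinuousLinearMap.proj k).comp
    (T.1.comp (ContinuousLinearMap.single ℂ (FockCol P) k))
  map_one' := by ext1 v; exact Pi.single_eq_same (M := FockCol P) k v
  map_mul' T S := by
    ext1 v
    refine adjointable_local T ?_
    exact (Pi.single_eq_same (M := FockCol P) k _).symm
  map_zero' := by ext1 v; rfl
  map_add' T S := by ext1 v; rfl
  commutes' c := by
    ext1 v
    change c • (Pi.single k v : Fock P) k = c • v
    rw [Pi.single_eq_same]
  map_star' T := by
    rw [ContinuousLinearMap.star_eq_adjoint, ContinuousLinearMap.eq_adjoint_iff]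
    intro v w
    have h := congrFun ((isAdj_star T).symm (Pi.single k v) (Pi.single k w)) k
    simpa [modInner] using h

/-- The restriction of `π_k` to the Toeplitz algebra. -/
def piRep (P : Matrix.rowStochastic ℝ Ω) (k : Ω) :
    toeplitz P →⋆ₐ[ℂ] (FockCol P k →L[ℂ] FockCol P k) :=
  (colRep P k).comp (toeplitz P).subtype

/-- The evaluation `ev_z : C(𝕋, M_d) → M_d`, `[f_{ij}] ↦ [f_{ij}(z)]`. -/
def matEval (z : Circle) : C(Circle, Matrix Ω Ω ℂ) →⋆ₐ[ℂ] Matrix Ω Ω ℂ where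
  toFun f := f z
  map_one' := rfl
  map_mul' _ _ := rfl
  map_zero' := rfl
  map_add' _ _ := rfl
  commutes' _ := rfl
  map_star' _ := rfl

/-- The representation of `T(P)` on `ℂ^Ω` obtained from `q : T(P) → O(P)`, an identification
`Φ : O(P) ≅ C(𝕋, M_d)` and the evaluation at `z ∈ 𝕋`. -/
def evRep {P : Matrix.rowStochastic ℝ Ω} (Φ : cuntzPimsner P ≃⋆ₐ[ℂ] C(Circle, Matrix Ω Ω ℂ))
    (z : Circle) : toeplitz P →⋆ₐ[ℂ] (EuclideanSpace ℂ Ω →L[ℂ] EuclideanSpace ℂ Ω) :=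
  ((StarAlgHomClass.toStarAlgHom (Matrix.toEuclideanCLM (n := Ω) (𝕜 := ℂ))).comp
    (matEval z)).comp ((StarAlgHomClass.toStarAlgHom Φ).comp (quotMap P))

section reps

variable {A : Type*} [Ring A] [StarRing A] [Algebra ℂ A]
  {H : Type*} [NormedAddCommGroup H] [InnerProductSpace ℂ H] [CompleteSpace H]
  {K : Type*} [NormedAddCommGroup K] [InnerProductSpace ℂ K] [CompleteSpace K]

/-- A unital *-representation on a Hilbert space is irreducible if the space is non-zero and its
only closed invariant subspaces are `0` and the whole space. -/
def IsIrrep (ρ : A →⋆ₐ[ℂ] (H →L[ℂ] H)) : Prop :=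
  Nontrivial H ∧ ∀ V : Submodule ℂ H, IsClosed (V : Set H) →
    (∀ a, ∀ v ∈ V, ρ a v ∈ V) → V = ⊥ ∨ V = ⊤

/-- Unitary equivalence of representations. -/
def UnitaryEquiv (ρ : A →⋆ₐ[ℂ] (H →L[ℂ] H)) (σ : A →⋆ₐ[ℂ] (K →L[ℂ] K)) : Prop :=
  ∃ U : H ≃ₗᵢ[ℂ] K, ∀ a v, U (ρ a v) = σ a (U v)

end reps

end StochasticToeplitz

end

open StochasticToeplitz

open Filter Topology

noncomputable section

namespace StochasticToeplitz

variable {Ω : Type*} [Fintype Ω] [DecidableEq Ω]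

/-! ### Powers of irreducible stochastic matrices -/

section markov

variable {P : Matrix.rowStochastic ℝ Ω}

/-! On each column the Toeplitz algebra consists of compact perturbations of classical Toeplitz
operators with matrix symbols, compressed from the bilateral shift. The theorem is the analysis of
the resulting extension of `C(𝕋, M_d)` by the direct sum of the compact operators of the `d`
columns.

Let `r` be the period of `P` and `c` a labelling of its cyclic classes. In a fixed row of the `k`-th
column, the basis vectors sit at the degrees allowed by periodicity, with all large allowed degrees
present. Dividing the degree by `r`, shifted by the labels, identifies the row with a set of
integers that is bounded below and contains all large integers (`CyclicClasses.pos`). The generator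
`S_{E_ij}^{(n)}` becomes a weighted shift by a fixed integer `s` from row `j` to row `i`. Its weight
is the square root of `(P^n)_ij (P^m)_jk / (P^{n+m})_ik`. Convergence of the powers of `P` along the
cyclic classes makes this tend to the square root of `(P^n)_ij` (`CyclicClasses.ratio_tendsto`), so
up to a compact operator the generator is a Toeplitz operator with symbol a multiple of `E_ij z^s`
(`CyclicClasses.hasSymbol_sh`). The symbol is the same for all columns.

Operators with a symbol form a C*-algebra: products of Toeplitz operators are multiplicative modulo
compacts because Hankel operators with continuous symbol are compact, and the symbol is controlled
by the norm of the operator (`CyclicClasses.norm_symbol_le`). Hence every element of the Toeplitz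
algebra has a symbol. Conversely, the Toeplitz algebra contains all operators with compact columns:
the defect of the degree-one shifts is the vacuum projection `Q_0` (`sum_sh_mul_star`), which is cut
down to one column by a diagonal matrix and then moved to all matrix units. With these, it also
contains all Toeplitz operators. An element of `J` has symbol zero, since the matrix coefficients
far out recover the symbol (`CyclicClasses.symbol_eq_zero`). So `J` is exactly the ideal of
operators with compact columns and the quotient is the algebra of symbols.

For the representations, the main tool is that two irreducible representations which do not kill a
projection `p`, and which agree and are scalar on the corner `p A p`, are equivalent
(`IsIrrep.unitaryEquiv_of_corner`). A representation that does not kill `J` is non-zero on the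
vacuum projection of some column `k`, whose corner is scalar, so it is `π_k`. One that kills `J`
factors through `C(𝕋, M_d)`; there the central functions act by evaluation at one point, and a
diagonal matrix unit supplies the corner. -/

theorem pow_entry_nonneg (n : ℕ) (i j : Ω) : 0 ≤ ((P : Matrix Ω Ω ℝ) ^ n) i j :=
  Matrix.nonneg_of_mem_rowStochastic (pow_mem P.2 n)

theorem pow_row_sum (n : ℕ) (i : Ω) : ∑ j, ((P : Matrix Ω Ω ℝ) ^ n) i j = 1 :=
  Matrix.sum_row_of_mem_rowStochastic (pow_mem P.2 n) i

theorem pow_add_entry (n m : ℕ) (i k : Ω) : ((P : Matrix Ω Ω ℝ) ^ (n + m)) i k =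
    ∑ j, ((P : Matrix Ω Ω ℝ) ^ n) i j * ((P : Matrix Ω Ω ℝ) ^ m) j k := by
  rw [pow_add, Matrix.mul_apply]

theorem pow_add_entry_pos {n m : ℕ} {i j k : Ω} (h : 0 < ((P : Matrix Ω Ω ℝ) ^ n) i j)
    (h' : 0 < ((P : Matrix Ω Ω ℝ) ^ m) j k) : 0 < ((P : Matrix Ω Ω ℝ) ^ (n + m)) i k := by
  rw [pow_add_entry]
  exact (mul_pos h h').trans_le (Finset.single_le_sum
    (f := fun j => ((P : Matrix Ω Ω ℝ) ^ n) i j * ((P : Matrix Ω Ω ℝ) ^ m) j k)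
    (fun l _ => mul_nonneg (pow_entry_nonneg _ _ _) (pow_entry_nonneg _ _ _)) (Finset.mem_univ j))

theorem pow_zero_entry_pos_iff {i k : Ω} : 0 < ((P : Matrix Ω Ω ℝ) ^ 0) i k ↔ i = k := by
  rw [pow_zero, Matrix.one_apply]
  split_ifs with h <;> simp [h]

/-- The period `r` of a stochastic matrix, a labelling `c` of its cyclic classes, and a bound `N`
from which on the entries of the powers that are allowed by periodicity are positive. -/
structure CyclicClasses (P : Matrix.rowStochastic ℝ Ω) where
  /-- the period -/
  r : ℕ
  /-- the labelling of the cyclic classes -/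
  c : Ω → ℕ
  /-- the bound for the powers -/
  N : ℕ
  r_pos : 0 < r
  dvd_of_pos : ∀ {n : ℕ} {i j : Ω}, 0 < ((P : Matrix Ω Ω ℝ) ^ n) i j → (r : ℤ) ∣ n + c i - c j
  pos_of_dvd : ∀ {n : ℕ} {i j : Ω}, N ≤ n → (r : ℤ) ∣ n + c i - c j →
    0 < ((P : Matrix Ω Ω ℝ) ^ n) i j

theorem exists_pow_pos (hP : (P : Matrix Ω Ω ℝ).IsIrreducible) (i j : Ω) :
    ∃ n > 0, 0 < ((P : Matrix Ω Ω ℝ) ^ n) i j :=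
  (Matrix.isIrreducible_iff_exists_pow_pos hP.nonneg).1 hP i j

/-- The return times to a base point `o` form a numerical semigroup, and `r` is their gcd. The label
of `i` is the length of a chosen path from `o` to `i`; closing paths up through `o` compares lengths
modulo `r`. Every sufficiently large multiple of `r` is a return time, which gives positivity. -/
theorem nonempty_cyclicClasses [Nonempty Ω] (hP : (P : Matrix Ω Ω ℝ).IsIrreducible) :
    Nonempty (CyclicClasses P) := by
  obtain ⟨o⟩ := ‹Nonempty Ω›
  let D : AddSubmonoid ℕ :=
    { carrier := {n | 0 < ((P : Matrix Ω Ω ℝ) ^ n) o o}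
      add_mem' := fun h h' => pow_add_entry_pos h h'
      zero_mem' := pow_zero_entry_pos_iff.2 rfl }
  have hD : ∀ {n}, n ∈ D ↔ 0 < ((P : Matrix Ω Ω ℝ) ^ n) o o := Iff.rfl
  choose a _ ha using fun i => exists_pow_pos hP o i
  choose b hb' hb using fun i => exists_pow_pos hP i o
  obtain ⟨N, hN⟩ := Nat.exists_mem_closure_of_ge (D : Set ℕ)
  rw [AddSubmonoid.closure_eq] at hN
  set r := Nat.setGcd (D : Set ℕ) with hr
  have hdvd : ∀ {n}, n ∈ D → r ∣ n := fun h => Nat.setGcd_dvd_of_mem h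
  have hab : ∀ i, (r : ℤ) ∣ a i + b i := fun i => by
    exact_mod_cast hdvd (hD.2 (pow_add_entry_pos (ha i) (hb i)))
  refine ⟨⟨r, a, N + (∑ i, a i) + ∑ i, b i, ?_, ?_, ?_⟩⟩
  · refine Nat.pos_of_ne_zero fun h0 => ?_
    have h1 := Nat.setGcd_eq_zero_iff.1 (hr ▸ h0)
    have h2 : b o ∈ (D : Set ℕ) := hb o
    have h3 := h1 h2
    have := hb' o
    simp at h3
    omega
  · intro n i j h
    -- The loops `o → i → j → o` and `o → j → o` share their last leg, so their lengths differ by `n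
    -- + a i - a j`.
    have h1 : (r : ℤ) ∣ ((a i + n + b j : ℕ) : ℤ) := by
      exact_mod_cast hdvd (hD.2 (pow_add_entry_pos (pow_add_entry_pos (ha i) h) (hb j)))
    have h2 := dvd_sub h1 (hab j)
    have h3 : (n : ℤ) + a i - a j = ((a i + n + b j : ℕ) : ℤ) - (a j + b j) := by
      push_cast
      ring
    rwa [h3]
  · intro n i j hn h
    have hai : a j ≤ ∑ i, a i := Finset.single_le_sum (fun _ _ => Nat.zero_le _) (Finset.mem_univ j)
    have hbi : b i ≤ ∑ i, b i := Finset.single_le_sum (fun _ _ => Nat.zero_le _) (Finset.mem_univ i)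
    -- Go from `i` to `o`, loop there for the remaining time `m`, then go to `j`. The two sums in
    -- the bound leave `m ≥ N`.
    obtain ⟨m, rfl⟩ : ∃ m, n = b i + m + a j := ⟨n - b i - a j, by omega⟩
    have h1 : r ∣ m := by
      have h2 := dvd_sub h (hab i)
      have h3 : ((b i + m + a j : ℕ) : ℤ) + a i - a j - (a i + b i) = m := by
        push_cast
        ring
      rw [h3] at h2
      exact_mod_cast h2
    exact pow_add_entry_pos (pow_add_entry_pos (hb i) (hD.1 (hN m (by omega) h1))) (ha j)

/-- Averages of a function with values in `[a, b]` on the support of the weights. -/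
theorem average_mem_Icc {ι : Type*} [Fintype ι] {w f : ι → ℝ} {a b : ℝ} (hw : ∀ j, 0 ≤ w j)
    (hsum : ∑ j, w j = 1)
    (hf : ∀ j, 0 < w j → f j ∈ Set.Icc a b) : ∑ j, w j * f j ∈ Set.Icc a b := by
  have h : ∀ j, w j * a ≤ w j * f j ∧ w j * f j ≤ w j * b := fun j => by
    rcases (hw j).eq_or_lt with h | h
    · simp [← h]
    · exact ⟨mul_le_mul_of_nonneg_left (hf j h).1 (hw j),
        mul_le_mul_of_nonneg_left (hf j h).2 (hw j)⟩
  constructor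
  · calc a = ∑ j, w j * a := by rw [← Finset.sum_mul, hsum, one_mul]
      _ ≤ _ := Finset.sum_le_sum fun j _ => (h j).1
  · calc _ ≤ ∑ j, w j * b := Finset.sum_le_sum fun j _ => (h j).2
      _ = b := by rw [← Finset.sum_mul, hsum, one_mul]

/-! ### Contraction of the columns of the powers -/

namespace CyclicClasses

variable (D : CyclicClasses P)

/-- All the entries of the `k`-th column of `P ^ n` that are allowed by periodicity lie in
`[a, b]`. -/
def ColumnBound (k : Ω) (n : ℕ) (a b : ℝ) : Prop :=
  ∀ j, (D.r : ℤ) ∣ n + D.c j - D.c k → ((P : Matrix Ω Ω ℝ) ^ n) j k ∈ Set.Icc a b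

variable {D}

theorem dvd_trans_pow {k i j : Ω} {m n : ℕ} (h : (D.r : ℤ) ∣ ((m + n : ℕ) : ℤ) + D.c i - D.c k)
    (hij : 0 < ((P : Matrix Ω Ω ℝ) ^ m) i j) : (D.r : ℤ) ∣ n + D.c j - D.c k := by
  have h2 := dvd_sub h (D.dvd_of_pos hij)
  have h3 : (n : ℤ) + D.c j - D.c k =
      ((m + n : ℕ) : ℤ) + D.c i - D.c k - (m + D.c i - D.c j) := by
    push_cast
    ring
  rwa [h3]

/-- By `P^{m+n} = P^m P^n`, the new entries are averages of old ones with the rows of `P^m` as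
weights, and these weights only charge entries allowed by periodicity. So column bounds persist for
higher powers. -/
theorem ColumnBound.add {k : Ω} {n : ℕ} {a b : ℝ} (h : D.ColumnBound k n a b) (m : ℕ) :
    D.ColumnBound k (m + n) a b := by
  intro i hi
  rw [pow_add_entry]
  exact average_mem_Icc (pow_entry_nonneg m i) (pow_row_sum m i)
    fun j hj => h j (dvd_trans_pow hi hj)

theorem ColumnBound.of_le {k : Ω} {n m : ℕ} {a b : ℝ} (h : D.ColumnBound k n a b) (hnm : n ≤ m) :
    D.ColumnBound k m a b := by
  obtain ⟨l, rfl⟩ := Nat.exists_eq_add_of_le' hnm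
  exact h.add l

/-- The entries of the `k`-th column contract to a common positive value. -/
theorem ColumnBound.contract (D : CyclicClasses P) (k : Ω) : ∃ δ : ℝ, 0 < δ ∧ δ < 1 ∧
    ∀ n a b, 0 < a → a ≤ b → D.ColumnBound k n a b →
      ∃ m a' b', a ≤ a' ∧ a' ≤ b' ∧ b' - a' = (1 - δ) * (b - a) ∧ D.ColumnBound k m a' b' := by
  have hr := D.r_pos
  -- A multiple of the period that is at least `N`: `P ^ M` is positive between any two states of
  -- the same cyclic class, with a uniform lower bound `δ`.
  set M := D.r * (D.N + 1) with hM
  have hMN : D.N ≤ M := by nlinarith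
  obtain ⟨δ, hδ0, hδ1, hδ⟩ : ∃ δ : ℝ, 0 < δ ∧ δ < 1 ∧ ∀ i j, (D.r : ℤ) ∣ D.c i - D.c j →
      δ ≤ ((P : Matrix Ω Ω ℝ) ^ M) i j := by
    have hfin : ∃ δ > 0, ∀ p : Ω × Ω, (D.r : ℤ) ∣ D.c p.1 - D.c p.2 →
        δ ≤ ((P : Matrix Ω Ω ℝ) ^ M) p.1 p.2 := by
      have : ∀ p : Ω × Ω, ∀ᶠ δ : ℝ in 𝓝[>] 0, (D.r : ℤ) ∣ D.c p.1 - D.c p.2 →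
          δ ≤ ((P : Matrix Ω Ω ℝ) ^ M) p.1 p.2 := by
        intro p
        by_cases hp : (D.r : ℤ) ∣ D.c p.1 - D.c p.2
        · have h1 : 0 < ((P : Matrix Ω Ω ℝ) ^ M) p.1 p.2 := D.pos_of_dvd hMN (by
            rw [add_sub_assoc]
            exact dvd_add (by rw [hM]; push_cast; exact dvd_mul_right _ _) hp)
          filter_upwards [mem_nhdsWithin_of_mem_nhds (Iic_mem_nhds h1)] with δ hδ _ using hδ
        · exact Eventually.of_forall fun _ h => absurd h hp
      have h2 := (eventually_all.2 this).and self_mem_nhdsWithin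
      obtain ⟨δ, h3, h4⟩ := h2.exists
      exact ⟨δ, h4, h3⟩
    obtain ⟨δ, h0, h⟩ := hfin
    refine ⟨min δ (1 / 2), by positivity, (min_le_right _ _).trans_lt (by norm_num), fun i j hij =>
      (min_le_left _ _).trans (h (i, j) hij)⟩
  refine ⟨δ, hδ0, hδ1, fun n a b ha hab h => ?_⟩
  by_cases hne : ∃ j, (D.r : ℤ) ∣ n + D.c j - D.c k
  · obtain ⟨j₀, hj₀⟩ := hne
    set f : Ω → ℝ := fun j => ((P : Matrix Ω Ω ℝ) ^ n) j k with hf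
    have hv := h j₀ hj₀
    -- Every row of `P ^ M` that matters puts mass at least `δ` on the same state `j₀`. Hence every
    -- new entry lies within `δ * f j₀` plus `1 - δ` times the old interval (Doeblin's argument).
    refine ⟨M + n, δ * f j₀ + (1 - δ) * a, δ * f j₀ + (1 - δ) * b, ?_, ?_, by ring, ?_⟩
    · nlinarith [hv.1]
    · nlinarith
    · intro i hi
      rw [pow_add_entry]
      have hij₀ : δ ≤ ((P : Matrix Ω Ω ℝ) ^ M) i j₀ := by
        refine hδ i j₀ ?_
        have h5 : (D.r : ℤ) ∣ M := by rw [hM]; push_cast; exact dvd_mul_right _ _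
        have h6 := dvd_sub (dvd_sub hi h5) hj₀
        have h7 : (D.c i : ℤ) - D.c j₀ =
            ((M + n : ℕ) : ℤ) + D.c i - D.c k - M - (n + D.c j₀ - D.c k) := by
          push_cast
          ring
        rwa [h7]
      set w : Ω → ℝ := fun j => ((P : Matrix Ω Ω ℝ) ^ M) i j with hw
      have key : ∀ t : ℝ, ∑ j, w j * (f j - t) = ∑ j, w j * f j - t := fun t => by
        simp_rw [mul_sub, Finset.sum_sub_distrib, ← Finset.sum_mul]
        rw [hw, pow_row_sum, one_mul]
      have hw0 : ∀ j, 0 ≤ w j := fun j => pow_entry_nonneg M i j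
      have hfj : ∀ j, w j ≠ 0 → f j ∈ Set.Icc a b := fun j hj =>
        h j (dvd_trans_pow hi (lt_of_le_of_ne (hw0 j) (Ne.symm hj)))
      constructor
      · have h7 : w j₀ * (f j₀ - a) ≤ ∑ j, w j * (f j - a) :=
          Finset.single_le_sum (f := fun j => w j * (f j - a)) (fun j _ => by
            by_cases hj : w j = 0
            · simp [hj]
            · exact mul_nonneg (hw0 j) (sub_nonneg.2 (hfj j hj).1)) (Finset.mem_univ j₀)
        rw [key] at h7
        have h8 : δ * (f j₀ - a) ≤ w j₀ * (f j₀ - a) :=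
          mul_le_mul_of_nonneg_right hij₀ (sub_nonneg.2 hv.1)
        change _ ≤ ∑ j, w j * f j
        linarith
      · have h7 : w j₀ * (b - f j₀) ≤ ∑ j, w j * (b - f j) :=
          Finset.single_le_sum (f := fun j => w j * (b - f j)) (fun j _ => by
            by_cases hj : w j = 0
            · simp [hj]
            · exact mul_nonneg (hw0 j) (sub_nonneg.2 (hfj j hj).2)) (Finset.mem_univ j₀)
        have h9 : ∑ j, w j * (b - f j) = b - ∑ j, w j * f j := by
          have := key b
          rw [← neg_inj, ← Finset.sum_neg_distrib, neg_sub, ← this]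
          exact Finset.sum_congr rfl fun j _ => by ring
        rw [h9] at h7
        have h8 : δ * (b - f j₀) ≤ w j₀ * (b - f j₀) :=
          mul_le_mul_of_nonneg_right hij₀ (sub_nonneg.2 hv.2)
        change ∑ j, w j * f j ≤ _
        linarith
  · push Not at hne
    -- No entry is allowed by periodicity, so any interval of the required length serves.
    exact ⟨n, a, a + (1 - δ) * (b - a), le_rfl, by nlinarith, by ring,
      fun j hj => absurd hj (hne j)⟩

/-- Iterating the contraction shrinks the interval geometrically. The lower ends never decrease, so
the positive bound `a₀` found at the power `N` serves for all `ε`; this is what turns small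
differences into ratios close to `1`. -/
theorem exists_columnBound (D : CyclicClasses P) (k : Ω) :
    ∃ a₀ : ℝ, 0 < a₀ ∧ ∀ ε > 0, ∃ n a b, a₀ ≤ a ∧ a ≤ b ∧ b - a < ε ∧ D.ColumnBound k n a b := by
  obtain ⟨a₀, ha₀, hle, hbd⟩ : ∃ a₀ : ℝ, 0 < a₀ ∧ a₀ ≤ 1 ∧ D.ColumnBound k D.N a₀ 1 := by
    have : ∀ j : Ω, ∀ᶠ δ : ℝ in 𝓝[>] 0, (D.r : ℤ) ∣ D.N + D.c j - D.c k →
        δ ≤ ((P : Matrix Ω Ω ℝ) ^ D.N) j k := by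
      intro j
      by_cases hp : (D.r : ℤ) ∣ D.N + D.c j - D.c k
      · filter_upwards [mem_nhdsWithin_of_mem_nhds (Iic_mem_nhds (D.pos_of_dvd le_rfl hp))]
          with δ hδ _ using hδ
      · exact Eventually.of_forall fun _ h => absurd h hp
    obtain ⟨δ, h3, h4, h5⟩ := ((eventually_all.2 this).and
      ((eventually_mem_nhdsWithin (a := (0 : ℝ)) (s := Set.Ioi 0)).and
        (mem_nhdsWithin_of_mem_nhds (Iic_mem_nhds (zero_lt_one (α := ℝ)))))).exists
    refine ⟨δ, h4, h5, fun j hj => ⟨h3 j hj, ?_⟩⟩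
    rw [← pow_row_sum (P := P) D.N j]
    exact Finset.single_le_sum (f := fun k => ((P : Matrix Ω Ω ℝ) ^ D.N) j k)
      (fun l _ => pow_entry_nonneg _ _ _) (Finset.mem_univ k)
  refine ⟨a₀, ha₀, fun ε hε => ?_⟩
  obtain ⟨δ, hδ0, hδ1, hδ⟩ := ColumnBound.contract D k
  have hiter : ∀ l : ℕ, ∃ n a b, a₀ ≤ a ∧ a ≤ b ∧ b - a = (1 - δ) ^ l * (1 - a₀) ∧
      D.ColumnBound k n a b := by
    intro l
    induction l with
    | zero => exact ⟨D.N, a₀, 1, le_rfl, hle, by ring, hbd⟩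
    | succ l ih =>
      obtain ⟨n, a, b, h1, h2, h3, h4⟩ := ih
      obtain ⟨m, a', b', h5, h6, h7, h8⟩ := hδ n a b (by linarith) h2 h4
      exact ⟨m, a', b', h1.trans h5, h6, by rw [h7, h3]; ring, h8⟩
  have hlim : Tendsto (fun l : ℕ => (1 - δ) ^ l * (1 - a₀)) atTop (𝓝 0) := by
    simpa using (tendsto_pow_atTop_nhds_zero_of_lt_one (r := 1 - δ) (by linarith)
      (by linarith)).mul_const (1 - a₀)
  obtain ⟨l, hl⟩ := (hlim.eventually (gt_mem_nhds hε)).exists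
  obtain ⟨n, a, b, h1, h2, h3, h4⟩ := hiter l
  exact ⟨n, a, b, h1, h2, h3 ▸ hl, h4⟩

/-- The ratios `(P ^ m)_{jk} / (P ^ (n + m))_{ik}` of positive entries with `(i, j) ∈ E(P ^ n)`
tend to `1`. -/
theorem ratio_tendsto (D : CyclicClasses P) {n : ℕ} {i j : Ω}
    (hij : 0 < ((P : Matrix Ω Ω ℝ) ^ n) i j) (k : Ω) {ε : ℝ} (hε : 0 < ε) :
    ∃ m₀, ∀ m ≥ m₀, 0 < ((P : Matrix Ω Ω ℝ) ^ m) j k →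
      |((P : Matrix Ω Ω ℝ) ^ m) j k / ((P : Matrix Ω Ω ℝ) ^ (n + m)) i k - 1| < ε := by
  obtain ⟨a₀, ha₀, h⟩ := D.exists_columnBound k
  -- The tolerance is `ε * a₀` because the denominator of the ratio is at least `a₀`.
  obtain ⟨m₀, a, b, h1, h2, h3, h4⟩ := h (ε * a₀) (by positivity)
  refine ⟨m₀, fun m hm hjk => ?_⟩
  have hx := (h4.of_le hm) j (D.dvd_of_pos hjk)
  have hy := (h4.of_le (hm.trans (Nat.le_add_left m n))) i
    (D.dvd_of_pos (pow_add_entry_pos hij hjk))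
  set x := ((P : Matrix Ω Ω ℝ) ^ m) j k
  set y := ((P : Matrix Ω Ω ℝ) ^ (n + m)) i k
  have hy0 : 0 < y := by linarith [hy.1]
  rw [div_sub_one hy0.ne', abs_div, abs_of_pos hy0, div_lt_iff₀ hy0]
  refine lt_of_le_of_lt (abs_sub_le_iff.2 ⟨?_, ?_⟩ : |x - y| ≤ b - a) ?_
  · linarith [hx.2, hy.1]
  · linarith [hx.1, hy.2]
  · refine h3.trans_le (mul_le_mul_of_nonneg_left ?_ hε.le)
    linarith [hy.1]

end CyclicClasses

end markov

/-! ### Operators on `ℓ²` -/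

section ltwo

open InnerProductSpace ContinuousLinearMap

/-- The Hilbert space `ℓ²(I)`. -/
abbrev L2 (I : Type*) : Type _ := lp (fun _ : I => ℂ) 2

variable {I J : Type*} {E : Type*} [NormedAddCommGroup E] [InnerProductSpace ℂ E] [CompleteSpace E]

theorem norm_le_of_sum_le {x : L2 J} {C : ℝ} (hC : 0 ≤ C)
    (h : ∀ s : Finset J, ∑ q ∈ s, ‖x q‖ ^ 2 ≤ C ^ 2) : ‖x‖ ≤ C :=
  lp.norm_le_of_forall_sum_le (by simp) hC (by simpa using h)

theorem sum_sq_le (x : L2 J) (s : Finset J) : ∑ q ∈ s, ‖x q‖ ^ 2 ≤ ‖x‖ ^ 2 := by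
  simpa using lp.sum_rpow_le_norm_rpow (p := 2) (by simp) x s

theorem norm_le_of_forall_norm_le {x y : L2 J} {ε : ℝ} (hε : 0 ≤ ε)
    (h : ∀ q, ‖x q‖ ≤ ε * ‖y q‖) : ‖x‖ ≤ ε * ‖y‖ := by
  refine norm_le_of_sum_le (by positivity) fun s => ?_
  calc ∑ q ∈ s, ‖x q‖ ^ 2 ≤ ∑ q ∈ s, ε ^ 2 * ‖y q‖ ^ 2 :=
        Finset.sum_le_sum fun q _ => by
          rw [← mul_pow]
          exact pow_le_pow_left₀ (norm_nonneg _) (h q) 2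
    _ = ε ^ 2 * ∑ q ∈ s, ‖y q‖ ^ 2 := by rw [Finset.mul_sum]
    _ ≤ (ε * ‖y‖) ^ 2 := by
        rw [mul_pow]
        exact mul_le_mul_of_nonneg_left (sum_sq_le y s) (sq_nonneg _)

/-- The weighted composition operator `(x_p)_p ↦ (b_q x_{ψ q})_q` on `ℓ²`. -/
def wcomp (ψ : J → I) (b : J → ℂ) (hb : ∀ q, ‖b q‖ ≤ 1)
    (hψ : ∀ q q', b q ≠ 0 → b q' ≠ 0 → ψ q = ψ q' → q = q') : L2 I →L[ℂ] L2 J :=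
  have hsum : ∀ (x : L2 I) (s : Finset J), ∑ q ∈ s, ‖b q * x (ψ q)‖ ^ 2 ≤ ‖x‖ ^ 2 := by
    classical
    intro x s
    calc ∑ q ∈ s, ‖b q * x (ψ q)‖ ^ 2 = ∑ q ∈ s with b q ≠ 0, ‖b q * x (ψ q)‖ ^ 2 := by
          rw [Finset.sum_filter]
          refine Finset.sum_congr rfl fun q _ => ?_
          split_ifs with h
          · rfl
          · simp [not_not.1 h]
      _ ≤ ∑ q ∈ s with b q ≠ 0, ‖x (ψ q)‖ ^ 2 := by
          refine Finset.sum_le_sum fun q _ => ?_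
          rw [norm_mul]
          exact pow_le_pow_left₀ (by positivity) (mul_le_of_le_one_left (norm_nonneg _) (hb q)) 2
      _ = ∑ p ∈ (s.filter fun q => b q ≠ 0).image ψ, ‖x p‖ ^ 2 := by
          rw [Finset.sum_image]
          intro q hq q' hq' h
          exact hψ q q' (Finset.mem_filter.1 hq).2 (Finset.mem_filter.1 hq').2 h
      _ ≤ ‖x‖ ^ 2 := sum_sq_le x _
  LinearMap.mkContinuous
    { toFun := fun x => ⟨fun q => b q * x (ψ q), memℓp_gen' (C := ‖x‖ ^ 2) (by simpa using hsum x)⟩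
      map_add' := fun x y => by ext q; exact mul_add _ _ _
      map_smul' := fun c x => by ext q; simp [mul_left_comm] }
    1 fun x => by
      rw [one_mul]
      exact norm_le_of_sum_le (norm_nonneg _) (hsum x)

theorem wcomp_apply (ψ : J → I) (b : J → ℂ) (hb : ∀ q, ‖b q‖ ≤ 1)
    (hψ : ∀ q q', b q ≠ 0 → b q' ≠ 0 → ψ q = ψ q' → q = q') (x : L2 I) (q : J) :
    wcomp ψ b hb hψ x q = b q * x (ψ q) := rfl

theorem isCompactOperator_rankOne (x : L2 J) (y : E) : IsCompactOperator (rankOne ℂ x y) := by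
  have h : IsCompactOperator (toSpanSingleton ℂ x) := isCompactOperator_of_locallyCompactSpace_rng _
  have h2 : ⇑(rankOne ℂ x y) = toSpanSingleton ℂ x ∘ innerSL ℂ y := by
    ext1 z
    simp [rankOne_apply]
  rw [h2]
  exact h.comp_clm (innerSL ℂ y)

variable [DecidableEq I] [DecidableEq J]

/-- The standard basis vectors of `ℓ²`. -/
abbrev bv (p : I) : L2 I := lp.single 2 p (1 : ℂ)

theorem bv_apply (p q : I) : bv p q = if q = p then (1 : ℂ) else 0 := by
  rw [lp.single_apply, Pi.single_apply]

theorem inner_bv (p : I) (x : L2 I) : inner ℂ (bv p) x = x p := by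
  rw [lp.inner_single_left]
  simp

theorem norm_bv (p : I) : ‖bv p‖ = 1 := by
  rw [lp.norm_single (by simp)]
  simp

theorem norm_coord_le (x : L2 I) (q : I) : ‖x q‖ ≤ ‖x‖ := by
  have h := norm_inner_le_norm (𝕜 := ℂ) (bv q) x
  rwa [inner_bv, norm_bv, one_mul] at h

theorem dense_span_bv : Dense (Submodule.span ℂ (Set.range (bv (I := I))) : Set (L2 I)) := by
  intro x
  refine mem_closure_of_tendsto (lp.hasSum_single (by simp) x) (Eventually.of_forall fun s => ?_)
  refine Submodule.sum_mem _ fun p _ => ?_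
  have h : lp.single 2 p (x p) = x p • bv p := by
    rw [← lp.single_smul, smul_eq_mul, mul_one]
  rw [h]
  exact Submodule.smul_mem _ _ (Submodule.subset_span ⟨p, rfl⟩)

theorem clm_ext_bv {A B : L2 I →L[ℂ] E} (h : ∀ p, A (bv p) = B (bv p)) : A = B := by
  refine ContinuousLinearMap.ext_on dense_span_bv ?_
  rintro _ ⟨p, rfl⟩
  exact h p

theorem adjoint_coord (A : L2 I →L[ℂ] E) (y : E) (p : I) :
    adjoint A y p = inner ℂ (A (bv p)) y := by
  rw [← inner_bv, adjoint_inner_right]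

/-- The restriction of the coordinates to a finite set. -/
def trunc (s : Finset I) : L2 I →L[ℂ] L2 I := ∑ p ∈ s, rankOne ℂ (bv p) (bv p)

theorem trunc_eq_sum (s : Finset I) (x : L2 I) : trunc s x = ∑ p ∈ s, lp.single 2 p (x p) := by
  rw [trunc, sum_apply]
  refine Finset.sum_congr rfl fun p _ => ?_
  rw [rankOne_apply, inner_bv, ← lp.single_smul, smul_eq_mul, mul_one]

theorem trunc_apply (s : Finset I) (x : L2 I) (q : I) :
    trunc s x q = if q ∈ s then x q else 0 := by
  rw [trunc_eq_sum, lp.coeFn_sum, Finset.sum_apply]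
  simp only [lp.single_apply, Pi.single_apply]
  simp

theorem norm_sub_trunc_le (s : Finset I) (x : L2 I) : ‖x - trunc s x‖ ≤ ‖x‖ := by
  have h := norm_le_of_forall_norm_le (x := x - trunc s x) (y := x) zero_le_one fun q => by
    rw [lp.coeFn_sub, Pi.sub_apply, trunc_apply]
    split_ifs <;> simp
  rwa [one_mul] at h

theorem tendsto_trunc (x : L2 I) : Tendsto (fun s => trunc s x) atTop (𝓝 x) := by
  simp_rw [trunc_eq_sum]
  exact lp.hasSum_single (by simp) x

theorem trunc_comp (s : Finset J) (A : E →L[ℂ] L2 J) :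
    trunc s ∘L A = ∑ p ∈ s, rankOne ℂ (bv p) (adjoint A (bv p)) := by
  ext1 x
  simp only [trunc, comp_apply, sum_apply, rankOne_apply, adjoint_inner_left]

theorem isCompactOperator_sum {ι : Type*} (s : Finset ι) (f : ι → E →L[ℂ] L2 J)
    (h : ∀ i ∈ s, IsCompactOperator (f i)) : IsCompactOperator (∑ i ∈ s, f i : E →L[ℂ] L2 J) := by
  classical
  induction s using Finset.induction_on with
  | empty => exact isCompactOperator_zero
  | insert a s ha ih =>
    rw [Finset.sum_insert ha]
    exact (h a (by simp)).add (ih fun i hi => h i (by simp [hi]))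

theorem isCompactOperator_trunc_comp (s : Finset J) (A : E →L[ℂ] L2 J) :
    IsCompactOperator (trunc s ∘L A) := by
  rw [trunc_comp]
  exact isCompactOperator_sum _ _ fun p _ =>
    isCompactOperator_rankOne (bv p) (adjoint A (bv p))

/-- A compact operator is uniformly approximated by its truncations. -/
theorem exists_norm_sub_trunc_comp_le {K : E →L[ℂ] L2 J} (hK : IsCompactOperator K) {ε : ℝ}
    (hε : 0 < ε) : ∃ s : Finset J, ‖K - trunc s ∘L K‖ ≤ ε := by
  obtain ⟨C, hC, hsub⟩ := hK.image_closedBall_subset_compact (f := (K : E →ₗ[ℂ] L2 J)) 1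
  obtain ⟨t, -, ht, hcov⟩ := Metric.finite_approx_of_totallyBounded hC.totallyBounded (ε / 2)
    (by positivity)
  -- Truncations converge only pointwise, but the convergence is uniform on a finite `ε / 2`-net of
  -- the image of the unit ball. The complementary truncations are contractions, so the net controls
  -- the whole image.
  have hev : ∀ᶠ s : Finset J in atTop, ∀ y ∈ t, ‖y - trunc s y‖ < ε / 2 := by
    rw [ht.eventually_all]
    intro y _
    have h := (tendsto_trunc y).const_sub y
    rw [sub_self] at h
    have h2 := h.norm
    rw [norm_zero] at h2
    exact h2.eventually (gt_mem_nhds (by positivity))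
  obtain ⟨s, hs⟩ := hev.exists
  refine ⟨s, opNorm_le_of_unit_norm hε.le fun x hx => ?_⟩
  have hmem : K x ∈ C := hsub ⟨x, by simp [hx], rfl⟩
  obtain ⟨y, hy, hxy⟩ := Set.mem_iUnion₂.1 (hcov hmem)
  rw [Metric.mem_ball, dist_eq_norm] at hxy
  have h1 : (K - trunc s ∘L K) x = (K x - y - trunc s (K x - y)) + (y - trunc s y) := by
    simp only [sub_apply, comp_apply, map_sub]
    abel
  rw [h1]
  have h2 := norm_sub_trunc_le s (K x - y)
  have h3 := hs y hy
  have h4 := norm_add_le (K x - y - trunc s (K x - y)) (y - trunc s y)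
  linarith

theorem norm_coord_le_of_compact {K : E →L[ℂ] L2 J} (hK : IsCompactOperator K) {ε : ℝ}
    (hε : 0 < ε) : ∃ s : Finset J, ∀ q ∉ s, ∀ x, ‖K x q‖ ≤ ε * ‖x‖ := by
  obtain ⟨s, hs⟩ := exists_norm_sub_trunc_comp_le hK hε
  refine ⟨s, fun q hq x => ?_⟩
  have h1 : K x q = (K - trunc s ∘L K) x q := by
    simp [trunc_apply, hq]
  rw [h1]
  exact (norm_coord_le _ _).trans (le_of_opNorm_le _ hs x)

/-- An operator whose coordinates are dominated by those of a bounded operator, with factors that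
tend to zero, is compact. -/
theorem isCompactOperator_of_coord_le {A B : E →L[ℂ] L2 J}
    (h : ∀ ε > 0, ∃ s : Finset J, ∀ q ∉ s, ∀ x, ‖A x q‖ ≤ ε * ‖B x q‖) : IsCompactOperator A := by
  have hcl := isClosed_setOfPred_isCompactOperator (σ₁₂ := RingHom.id ℂ) (M₁ := E) (M₂ := L2 J)
  refine hcl.closure_subset_iff.2 subset_rfl (Metric.mem_closure_iff.2 fun ε hε => ?_)
  obtain ⟨s, hs⟩ := h (ε / (2 * (‖B‖ + 1))) (by positivity)
  refine ⟨trunc s ∘L A, isCompactOperator_trunc_comp s A, ?_⟩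
  rw [dist_eq_norm]
  refine lt_of_le_of_lt (opNorm_le_bound _ (M := ε / (2 * (‖B‖ + 1)) * ‖B‖) (by positivity)
    fun x => ?_) ?_
  · rw [mul_assoc]
    refine le_trans (norm_le_of_forall_norm_le (y := B x) (by positivity) fun q => ?_)
      (mul_le_mul_of_nonneg_left (B.le_opNorm x) (by positivity))
    simp only [sub_apply, comp_apply, lp.coeFn_sub, Pi.sub_apply, trunc_apply]
    split_ifs with hq
    · simp only [sub_self, norm_zero]
      positivity
    · rw [sub_zero]
      exact hs q hq x
  · rw [div_mul_eq_mul_div, div_lt_iff₀ (by positivity)]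
    nlinarith [norm_nonneg B]

theorem isCompactOperator_of_coord_eq_zero {A : E →L[ℂ] L2 J} (s : Finset J)
    (h : ∀ q ∉ s, ∀ x, A x q = 0) : IsCompactOperator A :=
  isCompactOperator_of_coord_le (B := A) fun ε hε => ⟨s, fun q hq x => by
    rw [h q hq x, norm_zero, mul_zero]⟩

/-- The compact operators on `ℓ²` are limits of combinations of matrix units. -/
theorem mem_closure_span_matrixUnits {K : L2 I →L[ℂ] L2 J} (hK : IsCompactOperator K) :
    K ∈ (Submodule.span ℂ (Set.range fun p : J × I =>
      rankOne ℂ (bv p.1) (bv p.2))).topologicalClosure := by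
  set S := (Submodule.span ℂ (Set.range fun p : J × I =>
      rankOne ℂ (bv p.1) (bv p.2))).topologicalClosure with hS
  have hcl : IsClosed (S : Set (L2 I →L[ℂ] L2 J)) := Submodule.isClosed_topologicalClosure _
  have hunit : ∀ p q, rankOne ℂ (bv p) (bv q) ∈ S := fun p q =>
    Submodule.le_topologicalClosure _ (Submodule.subset_span ⟨(p, q), rfl⟩)
  have hrank : ∀ p (y : L2 I), rankOne ℂ (bv p) y ∈ S := by
    intro p y
    have h := ((rankOne ℂ (E := L2 J) (F := L2 I) (bv p)).continuous.tendsto y).comp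
      (tendsto_trunc y)
    refine hcl.mem_of_tendsto h (Eventually.of_forall fun s => ?_)
    simp only [Function.comp, trunc, sum_apply, rankOne_apply, map_sum, map_smulₛₗ]
    exact Submodule.sum_mem _ fun q _ => Submodule.smul_mem _ _ (hunit p q)
  refine hcl.closure_subset_iff.2 subset_rfl (Metric.mem_closure_iff.2 fun ε hε => ?_)
  obtain ⟨s, hs⟩ := exists_norm_sub_trunc_comp_le hK (half_pos hε)
  refine ⟨trunc s ∘L K, ?_, ?_⟩
  · rw [trunc_comp]
    exact Submodule.sum_mem _ fun p _ => hrank p _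
  · rw [dist_eq_norm]
    linarith

/-- Taking adjoints is continuous and sends matrix units to matrix units, and compact operators are
limits of combinations of these. -/
theorem isCompactOperator_adjoint {K : L2 I →L[ℂ] L2 J} (hK : IsCompactOperator K) :
    IsCompactOperator (adjoint K) := by
  have hcl := isClosed_setOfPred_isCompactOperator (σ₁₂ := RingHom.id ℂ) (M₁ := L2 J) (M₂ := L2 I)
  have hpre : IsClosed {K : L2 I →L[ℂ] L2 J | IsCompactOperator (adjoint K)} :=
    hcl.preimage (adjoint (𝕜 := ℂ) (E := L2 I) (F := L2 J)).continuous
  refine hpre.closure_subset_iff.2 (fun A hA => ?_) (mem_closure_span_matrixUnits hK)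
  change IsCompactOperator (adjoint A)
  induction hA using Submodule.span_induction with
  | mem A hA =>
    obtain ⟨p, rfl⟩ := hA
    simp only [adjoint_rankOne]
    exact isCompactOperator_rankOne _ _
  | zero => rw [map_zero]; exact isCompactOperator_zero
  | add A B _ _ hA hB => rw [map_add]; exact hA.add hB
  | smul c A _ hA => rw [map_smulₛₗ]; exact hA.smul (S := ℂ) _

/-- The norm of a coordinatewise limit of bounded operators. -/
theorem norm_le_of_tendsto_coord {B : ℕ → L2 I →L[ℂ] L2 J} {M : L2 I →L[ℂ] L2 J} {C : ℝ}
    (hC : 0 ≤ C) (hB : ∀ n, ‖B n‖ ≤ C)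
    (h : ∀ p q, Tendsto (fun n => B n (bv p) q) atTop (𝓝 (M (bv p) q))) : ‖M‖ ≤ C := by
  have hspan : ∀ x ∈ Submodule.span ℂ (Set.range (bv (I := I))), ∀ q,
      Tendsto (fun n => B n x q) atTop (𝓝 (M x q)) := by
    intro x hx q
    induction hx using Submodule.span_induction with
    | mem x hx => obtain ⟨p, rfl⟩ := hx; exact h p q
    | zero => simp
    | add x y _ _ hx hy => simpa using hx.add hy
    | smul c x _ hx => simpa using hx.const_mul c
  refine opNorm_le_bound _ hC fun x => ?_
  have hcl : IsClosed {x : L2 I | ‖M x‖ ≤ C * ‖x‖} :=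
    isClosed_le (by fun_prop) (by fun_prop)
  refine hcl.closure_subset_iff.2 (fun x hx => ?_) (dense_span_bv x)
  refine norm_le_of_sum_le (by positivity) fun s => ?_
  -- Fatou's lemma for `ℓ²` norms: each finite partial sum passes to the limit.
  refine le_of_tendsto (tendsto_finsetSum s fun q _ => ((hspan x hx q).norm.pow 2))
    (Eventually.of_forall fun n => (sum_sq_le _ s).trans ?_)
  exact pow_le_pow_left₀ (norm_nonneg _) (le_of_opNorm_le _ (hB n) x) 2

end ltwo

/-! ### Adjointable operators as families of operators on the columns -/

section columns

open InnerProductSpace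

variable {P : Matrix.rowStochastic ℝ Ω}

theorem apply_eq_colRep (T : Adjointable P) (x : Fock P) (k : Ω) :
    T.1 x k = colRep P k T (x k) :=
  adjointable_local T (Pi.single_eq_same (M := FockCol P) k (x k)).symm

theorem adjointable_ext {T S : Adjointable P} (h : ∀ k, colRep P k T = colRep P k S) : T = S := by
  refine Subtype.ext (ContinuousLinearMap.ext fun x => funext fun k => ?_)
  rw [apply_eq_colRep T, apply_eq_colRep S, h]

theorem norm_colRep_le (T : Adjointable P) (k : Ω) : ‖colRep P k T‖ ≤ ‖T‖ := by
  refine ContinuousLinearMap.opNorm_le_bound _ (norm_nonneg _) fun v => ?_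
  refine (norm_le_pi_norm (T.1 (Pi.single k v)) k).trans ?_
  refine (T.1.le_opNorm _).trans (le_of_eq ?_)
  rw [Pi.norm_single]
  rfl

theorem norm_le_of_colRep_le {T : Adjointable P} {C : ℝ} (hC : 0 ≤ C)
    (h : ∀ k, ‖colRep P k T‖ ≤ C) : ‖T‖ ≤ C := by
  refine ContinuousLinearMap.opNorm_le_bound T.1 hC fun x => ?_
  refine (pi_norm_le_iff_of_nonneg (by positivity)).2 fun k => ?_
  rw [apply_eq_colRep]
  exact (ContinuousLinearMap.le_of_opNorm_le _ (h k) _).trans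
    (mul_le_mul_of_nonneg_left (norm_le_pi_norm x k) hC)

/-- The adjointable operator with given columns. -/
def ofCols (K : (k : Ω) → FockCol P k →L[ℂ] FockCol P k) : Adjointable P :=
  ⟨ContinuousLinearMap.pi fun k => (K k).comp (ContinuousLinearMap.proj k),
    ContinuousLinearMap.pi fun k =>
      (ContinuousLinearMap.adjoint (K k)).comp (ContinuousLinearMap.proj k), fun x y => funext
        fun k => (ContinuousLinearMap.adjoint_inner_right (K k) (x k) (y k)).symm⟩

@[simp]
theorem colRep_ofCols (K : (k : Ω) → FockCol P k →L[ℂ] FockCol P k) (k : Ω) :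
    colRep P k (ofCols K) = K k := by
  ext1 v
  change K k ((Pi.single k v : Fock P) k) = K k v
  rw [Pi.single_eq_same]

/-- Adjointability amounts to acting column by column, that is, `x k = 0` forces `T x k = 0`. For
each `x` and `k` this is a closed condition on `T`. -/
theorem isClosed_adjointableSubalgebra :
    IsClosed (adjointableSubalgebra P : Set (Fock P →L[ℂ] Fock P)) := by
  have h : (adjointableSubalgebra P : Set (Fock P →L[ℂ] Fock P)) =
      ⋂ (x : Fock P) (k : Ω) (_ : x k = 0), {T | T x k = 0} := by
    ext T
    simp only [Set.mem_iInter, Set.mem_ofPred_eq]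
    constructor
    · intro hT x k hx
      have h1 := adjointable_local (P := P) ⟨T, hT⟩ (x := x) (y := 0) (k := k) hx
      exact h1.trans (congrFun (map_zero T) k)
    · intro hT
      let K : (k : Ω) → FockCol P k →L[ℂ] FockCol P k := fun k =>
        (ContinuousLinearMap.proj k).comp (T.comp (ContinuousLinearMap.single ℂ (FockCol P) k))
      have h2 : T = (ofCols K).1 := by
        refine ContinuousLinearMap.ext fun x => funext fun k => ?_
        change T x k = T (Pi.single k (x k)) k
        rw [← sub_eq_zero, ← Pi.sub_apply, ← map_sub]
        refine hT _ _ ?_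
        rw [Pi.sub_apply, Pi.single_eq_same, sub_self]
      rw [h2]
      exact (ofCols K).2
  rw [h]
  refine isClosed_iInter fun x => isClosed_iInter fun k => isClosed_iInter fun _ => ?_
  exact isClosed_eq ((continuous_apply k).comp (ContinuousLinearMap.apply ℂ (Fock P) x).continuous)
    continuous_const

instance : CompleteSpace (Adjointable P) :=
  isClosed_adjointableSubalgebra.completeSpace_coe

/-- The norm is controlled by the norms on the columns, where the C*-identity is that of operators
on a Hilbert space. The C*-structure makes representations of the closed subalgebra `toeplitz P`
contractive. -/
instance : CStarRing (Adjointable P) where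
  norm_mul_self_le T := by
    have h : ‖T‖ ≤ Real.sqrt ‖star T * T‖ := by
      refine norm_le_of_colRep_le (Real.sqrt_nonneg _) fun k => Real.le_sqrt_of_sq_le ?_
      have h1 := CStarRing.norm_star_mul_self (x := colRep P k T)
      rw [← map_star, ← map_mul] at h1
      rw [sq, ← h1]
      exact norm_colRep_le _ k
    calc ‖T‖ * ‖T‖ ≤ Real.sqrt ‖star T * T‖ * Real.sqrt ‖star T * T‖ := by gcongr
      _ = ‖star T * T‖ := Real.mul_self_sqrt (norm_nonneg _)

instance : CStarAlgebra (Adjointable P) where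

instance : IsClosed (toeplitz P : Set (Adjointable P)) :=
  StarSubalgebra.isClosed_topologicalClosure _

theorem colRep_mulOp (f : ℕ → Ω → ℂ) (C : ℝ) (hC : 0 ≤ C) (hf : ∀ n i, ‖f n i‖ ≤ C) (k : Ω)
    (x : FockCol P k) (p : Idx P k) :
    colRep P k (mulOp f C hC hf) x p = f p.1.1 p.1.2 * x p := by
  change f p.1.1 p.1.2 * (Pi.single k x : Fock P) k p = _
  rw [Pi.single_eq_same]

theorem colRep_fiberProj (n : ℕ) (k : Ω) (x : FockCol P k) (p : Idx P k) :
    colRep P k (fiberProj P n) x p = if p.1.1 = n then x p else 0 := by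
  rw [fiberProj, colRep_mulOp, ite_mul, one_mul, zero_mul]

/-- The inclusion of the operators on one column into the adjointable operators. -/
def colIncl (P : Matrix.rowStochastic ℝ Ω) (k : Ω) :
    (FockCol P k →L[ℂ] FockCol P k) →L[ℂ] Adjointable P :=
  LinearMap.mkContinuous
    { toFun := fun K => ofCols (Pi.single k K)
      map_add' := fun K L => adjointable_ext fun l => by
        rw [map_add]
        simp only [colRep_ofCols, Pi.single_add, Pi.add_apply]
      map_smul' := fun c K => adjointable_ext fun l => by
        rw [map_smul]
        simp only [colRep_ofCols, Pi.single_smul, Pi.smul_apply, RingHom.id_apply] }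
    1 fun K => by
      refine norm_le_of_colRep_le (by positivity) fun l => ?_
      change ‖colRep P l (ofCols (Pi.single k K))‖ ≤ _
      rw [colRep_ofCols, one_mul]
      rcases eq_or_ne l k with rfl | h
      · rw [Pi.single_eq_same]
      · rw [Pi.single_eq_of_ne h, norm_zero]
        exact norm_nonneg _

@[simp]
theorem colRep_colIncl_same (k : Ω) (K : FockCol P k →L[ℂ] FockCol P k) :
    colRep P k (colIncl P k K) = K :=
  (colRep_ofCols _ _).trans (Pi.single_eq_same _ _)

theorem colRep_colIncl_ne {k l : Ω} (h : l ≠ k) (K : FockCol P k →L[ℂ] FockCol P k) :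
    colRep P l (colIncl P k K) = 0 :=
  (colRep_ofCols _ _).trans (Pi.single_eq_of_ne h _)

theorem sum_colIncl (T : Adjointable P) : ∑ k, colIncl P k (colRep P k T) = T := by
  refine adjointable_ext fun l => ?_
  rw [map_sum, Finset.sum_eq_single l (fun k _ hk => colRep_colIncl_ne hk.symm _) (by simp),
    colRep_colIncl_same]

/-- Adjointable operators are block diagonal, so a factor only acts through its own block on the
`k`-th column. -/
theorem mul_colIncl_mul (T S : Adjointable P) (k : Ω) (K : FockCol P k →L[ℂ] FockCol P k) :
    T * colIncl P k K * S = colIncl P k (colRep P k T * K * colRep P k S) := by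
  refine adjointable_ext fun l => ?_
  rcases eq_or_ne l k with rfl | h
  · simp
  · simp [colRep_colIncl_ne h]

/-- The index of the vacuum vector of the `k`-th column. -/
def vac (P : Matrix.rowStochastic ℝ Ω) (k : Ω) : Idx P k := ⟨(0, k), pow_zero_entry_pos_iff.2 rfl⟩

/-- The matrix units of the `k`-th column. -/
def matUnit (k : Ω) (p q : Idx P k) : Adjointable P := colIncl P k (rankOne ℂ (bv p) (bv q))

/-- The generator `S_{E_ij}^{(n)}`. -/
def sh (P : Matrix.rowStochastic ℝ Ω) (n : ℕ) (i j : Ω) : Adjointable P :=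
  shift n (Matrix.single i j 1)

/-- The coordinate of a column at `(m, j)`, with value zero if `(m, j)` is not an index. -/
def coord {k : Ω} (x : FockCol P k) (m : ℕ) (j : Ω) : ℂ :=
  if h : 0 < ((P : Matrix Ω Ω ℝ) ^ m) j k then x ⟨(m, j), h⟩ else 0

/-- The weights of `S_{E_ij}^{(n)}`. -/
def weight (P : Matrix.rowStochastic ℝ Ω) (n m : ℕ) (i j k : Ω) : ℝ :=
  (Real.sqrt (((P : Matrix Ω Ω ℝ) ^ (n + m)) i k))⁻¹ *
    (Real.sqrt (((P : Matrix Ω Ω ℝ) ^ n) i j) * Real.sqrt (((P : Matrix Ω Ω ℝ) ^ m) j k))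

theorem weight_sq (n m : ℕ) (i j k : Ω) : weight P n m i j k ^ 2 =
    (((P : Matrix Ω Ω ℝ) ^ (n + m)) i k)⁻¹ *
      (((P : Matrix Ω Ω ℝ) ^ n) i j * ((P : Matrix Ω Ω ℝ) ^ m) j k) := by
  rw [weight, mul_pow, mul_pow, inv_pow, Real.sq_sqrt (pow_entry_nonneg _ _ _),
    Real.sq_sqrt (pow_entry_nonneg _ _ _), Real.sq_sqrt (pow_entry_nonneg _ _ _)]

theorem colRep_sh_apply {n m : ℕ} {i k : Ω} (j : Ω) (x : FockCol P k)
    (hp : 0 < ((P : Matrix Ω Ω ℝ) ^ (n + m)) i k) :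
    colRep P k (sh P n i j) x ⟨(n + m, i), hp⟩ = weight P n m i j k * coord x m j := by
  change (if n ≤ n + m then subprod P n (n + m - n) (Matrix.single i j 1)
    (fiber (Pi.single k x) (n + m - n)) i k else 0) = _
  rw [if_pos (Nat.le_add_right n m), Nat.add_sub_cancel_left]
  have hx : fiber (Pi.single k x) m j k = coord x m j := by
    simp only [fiber, coord, Pi.single_eq_same]
  simp only [subprod, Matrix.hadamard_apply, Matrix.mul_apply, flat, sqrtMat, weight]
  rw [Finset.sum_eq_single j]
  · rw [hx, Matrix.single_apply_same]
    push_cast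
    ring
  · intro l _ hl
    rw [Matrix.single_apply_of_col_ne _ _ hl.symm]
    simp
  · simp

theorem colRep_sh_apply_eq_zero {n : ℕ} {i j k : Ω} (x : FockCol P k) {p : Idx P k}
    (hp : ¬ (n ≤ p.1.1 ∧ p.1.2 = i)) : colRep P k (sh P n i j) x p = 0 := by
  change (if n ≤ p.1.1 then subprod P n (p.1.1 - n) (Matrix.single i j 1)
    (fiber (Pi.single k x) (p.1.1 - n)) p.1.2 k else 0) = _
  split_ifs with h
  · have h2 : i ≠ p.1.2 := fun h2 => hp ⟨h, h2.symm⟩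
    simp only [subprod, Matrix.hadamard_apply, Matrix.mul_apply]
    rw [Finset.sum_eq_zero, mul_zero]
    intro l _
    rw [Matrix.single_apply_of_row_ne h2]
    simp
  · rfl

/-- The weighted shift `sh P n i j` can be non-zero only at indices of the second kind, where its
value is read off at `m`. -/
theorem idx_cases {k : Ω} (n : ℕ) (i : Ω) (p : Idx P k) : ¬ (n ≤ p.1.1 ∧ p.1.2 = i) ∨
    ∃ m, ∃ h : 0 < ((P : Matrix Ω Ω ℝ) ^ (n + m)) i k, p = ⟨(n + m, i), h⟩ := by
  by_cases h : n ≤ p.1.1 ∧ p.1.2 = i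
  · obtain ⟨⟨a, l⟩, hp⟩ := p
    obtain ⟨h1, rfl⟩ := h
    obtain ⟨m, rfl⟩ := Nat.exists_eq_add_of_le h1
    exact Or.inr ⟨m, hp, rfl⟩
  · exact Or.inl h

theorem coord_of_pos {k j : Ω} {m : ℕ} (x : FockCol P k) (h : 0 < ((P : Matrix Ω Ω ℝ) ^ m) j k) :
    coord x m j = x ⟨(m, j), h⟩ := dif_pos h

theorem coord_bv {k j : Ω} {m : ℕ} (q : Idx P k) :
    coord (bv q) m j = if (m, j) = q.1 then 1 else 0 := by
  rw [coord]
  split_ifs with h h2 h2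
  · rw [bv_apply, if_pos (Subtype.ext h2)]
  · rw [bv_apply, if_neg (fun h3 => h2 (congrArg Subtype.val h3))]
  · exact absurd (by have := q.2; rw [← h2] at this; exact this) h
  · rfl

theorem sh_eq_zero {n : ℕ} {i j : Ω} (h : ¬ 0 < ((P : Matrix Ω Ω ℝ) ^ n) i j) : sh P n i j = 0 := by
  refine adjointable_ext fun k => ?_
  rw [map_zero]
  ext x p
  rcases idx_cases n i p with hp | ⟨m, hp, rfl⟩
  · rw [colRep_sh_apply_eq_zero x hp]
    rfl
  · have h0 : ((P : Matrix Ω Ω ℝ) ^ n) i j = 0 :=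
      le_antisymm (not_lt.1 h) (pow_entry_nonneg n i j)
    rw [colRep_sh_apply, weight, h0]
    simp

theorem leftAct_mem_toeplitz (a : Ω → ℂ) : leftAct a ∈ toeplitz P :=
  StarSubalgebra.le_topologicalClosure _ (StarAlgebra.subset_adjoin _ _ (Or.inl ⟨a, rfl⟩))

theorem shift_mem_toeplitz {n : ℕ} {A : Matrix Ω Ω ℂ} (hA : A ∈ Arv P n) :
    shift n A ∈ toeplitz P :=
  StarSubalgebra.le_topologicalClosure _
    (StarAlgebra.subset_adjoin _ _ (Or.inr ⟨n, A, hA, rfl⟩))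

theorem sh_mem_toeplitz (n : ℕ) (i j : Ω) : sh P n i j ∈ toeplitz P := by
  by_cases h : 0 < ((P : Matrix Ω Ω ℝ) ^ n) i j
  · refine shift_mem_toeplitz fun i' j' h' => ?_
    rw [Matrix.single_apply, if_neg]
    rintro ⟨rfl, rfl⟩
    exact h' h
  · rw [sh_eq_zero h]
    exact zero_mem _

/-- `S_{E_ij}^{(n)}` acts on the basis by weighted shifts. -/
theorem colRep_sh_bv {n m : ℕ} {i j k : Ω} (hq : 0 < ((P : Matrix Ω Ω ℝ) ^ m) j k)
    (hp : 0 < ((P : Matrix Ω Ω ℝ) ^ (n + m)) i k) :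
    colRep P k (sh P n i j) (bv ⟨(m, j), hq⟩) =
      (weight P n m i j k : ℂ) • bv (⟨(n + m, i), hp⟩ : Idx P k) := by
  ext p
  rw [lp.coeFn_smul, Pi.smul_apply, bv_apply]
  rcases idx_cases n i p with h | ⟨m', h, rfl⟩
  · rw [colRep_sh_apply_eq_zero _ h, if_neg, smul_zero]
    rintro rfl
    exact h ⟨Nat.le_add_right _ _, rfl⟩
  · rw [colRep_sh_apply, coord_bv]
    rcases eq_or_ne m' m with rfl | hm
    · simp
    · rw [if_neg (by simpa using hm), if_neg (by simpa using hm)]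
      simp

theorem colRep_sh_mul_star_apply {n m : ℕ} {i k : Ω} (j : Ω) (x : FockCol P k)
    (hp : 0 < ((P : Matrix Ω Ω ℝ) ^ (n + m)) i k) :
    colRep P k (sh P n i j * star (sh P n i j)) x ⟨(n + m, i), hp⟩ =
      ((weight P n m i j k ^ 2 : ℝ) : ℂ) * x ⟨(n + m, i), hp⟩ := by
  rw [map_mul, mul_apply_eq_comp, colRep_sh_apply]
  by_cases hq : 0 < ((P : Matrix Ω Ω ℝ) ^ m) j k
  · rw [coord_of_pos _ hq, map_star, ContinuousLinearMap.star_eq_adjoint, adjoint_coord,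
      colRep_sh_bv hq hp, inner_smul_left, inner_bv, Complex.conj_ofReal]
    push_cast
    ring
  · have h0 : ((P : Matrix Ω Ω ℝ) ^ m) j k = 0 :=
      le_antisymm (not_lt.1 hq) (pow_entry_nonneg m j k)
    rw [weight, h0]
    simp

/-- Each `sh P 1 i j * star (sh P 1 i j)` is diagonal with the squared weights as entries. By the
Chapman-Kolmogorov identity these add up to `1` over `j` at every index of positive degree, and
nothing reaches degree `0`. -/
theorem sum_sh_mul_star (P : Matrix.rowStochastic ℝ Ω) :
    1 - ∑ i, ∑ j, sh P 1 i j * star (sh P 1 i j) = fiberProj P 0 := by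
  refine adjointable_ext fun k => ?_
  ext x p
  rw [map_sub, map_one, map_sum, colRep_fiberProj]
  simp only [map_sum, sub_apply, one_apply_eq_self,
    sum_apply, lp.coeFn_sub, Pi.sub_apply, lp.coeFn_sum, Finset.sum_apply]
  have hne : ∀ i j, ¬ (1 ≤ p.1.1 ∧ p.1.2 = i) →
      colRep P k (sh P 1 i j * star (sh P 1 i j)) x p = 0 := fun i j h => by
    rw [map_mul, mul_apply_eq_comp, colRep_sh_apply_eq_zero _ h]
  rcases idx_cases 1 p.1.2 p with h | ⟨m, h, hp⟩
  · have h0 : ¬ 1 ≤ p.1.1 := fun h1 => h ⟨h1, rfl⟩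
    rw [if_pos (by omega), Finset.sum_eq_zero, sub_zero]
    exact fun i _ => Finset.sum_eq_zero fun j _ => hne i j fun h1 => h0 h1.1
  · rw [if_neg (by rw [hp]; simp), Finset.sum_eq_single p.1.2 (fun i _ hi =>
      Finset.sum_eq_zero fun j _ => hne i j fun h1 => hi h1.2.symm) (by simp)]
    generalize p.1.2 = i at h hp
    subst hp
    simp_rw [colRep_sh_mul_star_apply, ← Finset.sum_mul, ← Complex.ofReal_sum, weight_sq,
      ← Finset.mul_sum, ← pow_add_entry]
    rw [inv_mul_cancel₀ h.ne']
    simp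

theorem fiberProj_zero_mem_toeplitz : fiberProj P 0 ∈ toeplitz P := by
  rw [← sum_sh_mul_star]
  exact sub_mem (one_mem _) (sum_mem fun i _ => sum_mem fun j _ =>
    mul_mem (sh_mem_toeplitz _ _ _) (star_mem (sh_mem_toeplitz _ _ _)))

/-- As `P ^ 0` is the identity matrix, the fiber of degree `0` has a single basis vector in each
column, namely row `k` in column `k`. Left multiplication by the diagonal unit at `k` therefore
selects a column. -/
theorem matUnit_vac (k : Ω) :
    matUnit k (vac P k) (vac P k) = fiberProj P 0 * leftAct (Pi.single k 1) := by
  refine adjointable_ext fun l => ?_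
  ext x p
  rw [map_mul, mul_apply_eq_comp, colRep_fiberProj, leftAct, colRep_mulOp, matUnit]
  rcases eq_or_ne l k with rfl | h
  · rw [colRep_colIncl_same, rankOne_apply, inner_bv, lp.coeFn_smul, Pi.smul_apply, bv_apply]
    by_cases hp : p = vac P l
    · subst hp
      simp [vac]
    · rw [if_neg hp, smul_zero]
      split_ifs with h0
      · refine absurd (Subtype.ext (Prod.ext h0 ?_)) hp
        have := p.2
        rw [h0] at this
        exact pow_zero_entry_pos_iff.1 this
      · rfl
  · rw [colRep_colIncl_ne h]
    split_ifs with h0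
    · have := p.2
      rw [h0] at this
      rw [pow_zero_entry_pos_iff.1 this, Pi.single_eq_of_ne h, zero_mul]
      rfl
    · rfl

theorem colRep_sh_vac {k : Ω} (p : Idx P k) :
    colRep P k (sh P p.1.1 p.1.2 k) (bv (vac P k)) = bv p := by
  obtain ⟨⟨n, i⟩, hp⟩ := p
  have h := colRep_sh_bv (P := P) (n := n) (m := 0) (i := i) (j := k) (k := k) (vac P k).2 hp
  -- A shift applied to the vacuum has weight one, since the square roots of `(P ^ n) i k` cancel.
  have hw : weight P n 0 i k k = 1 := by
    rw [weight, add_zero, pow_zero, Matrix.one_apply_eq, Real.sqrt_one, mul_one]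
    exact inv_mul_cancel₀ (Real.sqrt_pos.2 hp).ne'
  rw [hw, Complex.ofReal_one, one_smul] at h
  exact h

/-- Shifts carry the vacuum vector to any basis vector of its column, so conjugating the vacuum
projection by two of them gives every matrix unit. -/
theorem matUnit_mem_toeplitz {k : Ω} (p q : Idx P k) : matUnit k p q ∈ toeplitz P := by
  have h : matUnit k p q = sh P p.1.1 p.1.2 k * matUnit k (vac P k) (vac P k) *
      star (sh P q.1.1 q.1.2 k) := by
    rw [matUnit, matUnit, mul_colIncl_mul]
    congr 1
    ext1 x
    simp only [mul_apply_eq_comp, rankOne_apply, map_smul, colRep_sh_vac, map_star,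
      ContinuousLinearMap.star_eq_adjoint, ContinuousLinearMap.adjoint_inner_right]
  rw [h, matUnit_vac]
  exact mul_mem (mul_mem (sh_mem_toeplitz _ _ _) (mul_mem fiberProj_zero_mem_toeplitz
    (leftAct_mem_toeplitz _))) (star_mem (sh_mem_toeplitz _ _ _))

/-- The operators with compact columns are limits of combinations of matrix units. -/
theorem mem_closure_span_matUnit {T : Adjointable P}
    (hT : ∀ k, IsCompactOperator (colRep P k T)) :
    T ∈ (Submodule.span ℂ {X : Adjointable P | ∃ k p q, X = matUnit k p q}).topologicalClosure := by
  rw [← sum_colIncl T]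
  refine Submodule.sum_mem _ fun k _ => ?_
  have h := mem_closure_span_matrixUnits (hT k)
  refine closure_mono ?_ (image_closure_subset_closure_image (colIncl P k).continuous
    (Set.mem_image_of_mem _ h))
  rintro _ ⟨K, hK, rfl⟩
  change colIncl P k K ∈ Submodule.span ℂ _
  induction hK using Submodule.span_induction with
  | mem K hK =>
    obtain ⟨p, rfl⟩ := hK
    exact Submodule.subset_span ⟨k, p.1, p.2, rfl⟩
  | zero => rw [map_zero]; exact zero_mem _
  | add K L _ _ hK hL => rw [map_add]; exact add_mem hK hL
  | smul c K _ hK => rw [map_smul]; exact Submodule.smul_mem _ _ hK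

theorem mem_toeplitz_of_isCompactOperator {T : Adjointable P}
    (hT : ∀ k, IsCompactOperator (colRep P k T)) : T ∈ toeplitz P := by
  have h : (Submodule.span ℂ {X : Adjointable P | ∃ k p q, X = matUnit k p q}) ≤
      Subalgebra.toSubmodule (toeplitz P).toSubalgebra := by
    rw [Submodule.span_le]
    rintro _ ⟨k, p, q, rfl⟩
    exact matUnit_mem_toeplitz p q
  exact Submodule.topologicalClosure_minimal _ h
    (inferInstanceAs (IsClosed (toeplitz P : Set (Adjointable P)))) (mem_closure_span_matUnit hT)

theorem exists_mul_fiberProj_eq_zero {X : Adjointable P}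
    (hX : X ∈ Submodule.span ℂ {X : Adjointable P | ∃ k p q, X = matUnit k p q}) :
    ∃ N, ∀ n ≥ N, X * fiberProj P n = 0 := by
  induction hX using Submodule.span_induction with
  | mem X hX =>
    obtain ⟨k, p, q, rfl⟩ := hX
    refine ⟨q.1.1 + 1, fun n hn => ?_⟩
    rw [matUnit, ← one_mul (colIncl P k _), mul_colIncl_mul, ← map_zero (colIncl P k)]
    congr 1
    ext1 x
    simp only [map_one, one_mul, mul_apply_eq_comp, rankOne_apply, inner_bv,
      colRep_fiberProj, zero_apply]
    rw [if_neg (by omega), zero_smul]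
  | zero => exact ⟨0, fun n _ => zero_mul _⟩
  | add X Y _ _ hX hY =>
    obtain ⟨N, hN⟩ := hX
    obtain ⟨M, hM⟩ := hY
    refine ⟨max N M, fun n hn => ?_⟩
    rw [add_mul, hN n (le_of_max_le_left hn), hM n (le_of_max_le_right hn), add_zero]
  | smul c X _ hX =>
    obtain ⟨N, hN⟩ := hX
    exact ⟨N, fun n hn => by rw [smul_mul_assoc, hN n hn, smul_zero]⟩

/-- A finite combination of matrix units annihilates all fibers of high degree, and such
combinations are dense among the operators with compact columns. -/
theorem tendsto_mul_fiberProj_of_isCompactOperator {T : Adjointable P}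
    (hT : ∀ k, IsCompactOperator (colRep P k T)) :
    Tendsto (fun n => ‖T * fiberProj P n‖) atTop (𝓝 0) := by
  rw [Metric.tendsto_atTop]
  intro ε hε
  obtain ⟨X, hX, hTX⟩ := Metric.mem_closure_iff.1 (mem_closure_span_matUnit hT) ε hε
  obtain ⟨N, hN⟩ := exists_mul_fiberProj_eq_zero hX
  refine ⟨N, fun n hn => ?_⟩
  rw [dist_zero_right, norm_norm, ← sub_zero (T * _), ← hN n hn, ← sub_mul]
  rw [dist_eq_norm] at hTX
  refine lt_of_le_of_lt ((norm_mul_le _ _).trans ?_) hTX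
  exact mul_le_of_le_one_right (norm_nonneg _) (norm_fiberProj_le n)

end columns

/-! ### The bilateral shift -/

section bilateral

/-- The bilateral translation `(x_t)_t ↦ (x_{t - s})_t` of `ℓ²(ℤ)`. -/
def translation (s : ℤ) : L2 ℤ →L[ℂ] L2 ℤ :=
  wcomp (fun t => t - s) (fun _ => 1) (by simp) (fun q q' _ _ h => by omega)

theorem translation_apply (s : ℤ) (x : L2 ℤ) (t : ℤ) : translation s x t = x (t - s) := by
  rw [translation, wcomp_apply, one_mul]

theorem translation_bv (s t : ℤ) : translation s (bv t) = bv (t + s) := by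
  ext q
  rw [translation_apply, bv_apply, bv_apply]
  exact if_congr (by omega) rfl rfl

theorem translation_add (s t : ℤ) : translation (s + t) = translation s * translation t := by
  ext x q
  rw [mul_apply_eq_comp, translation_apply, translation_apply, translation_apply,
    sub_add_eq_sub_sub]

theorem translation_zero : translation 0 = 1 := by
  ext x q
  rw [translation_apply, sub_zero, one_apply_eq_self]

theorem star_translation (s : ℤ) : star (translation s) = translation (-s) := by
  ext x q
  rw [ContinuousLinearMap.star_eq_adjoint, adjoint_coord, translation_bv, inner_bv,
    translation_apply, sub_neg_eq_add]

theorem translation_mem_unitary (s : ℤ) : translation s ∈ unitary (L2 ℤ →L[ℂ] L2 ℤ) := by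
  rw [Unitary.mem_iff, star_translation, ← translation_add, ← translation_add, neg_add_cancel,
    add_neg_cancel, translation_zero]
  exact ⟨rfl, rfl⟩

/-- The diagonal unitary `(x_t)_t ↦ (w^t x_t)_t` of `ℓ²(ℤ)`. -/
def modulation (w : Circle) : L2 ℤ →L[ℂ] L2 ℤ :=
  wcomp id (fun t => ((w ^ t : Circle) : ℂ)) (fun _ => (Circle.norm_coe _).le)
    (fun _ _ _ _ h => h)

theorem modulation_apply (w : Circle) (x : L2 ℤ) (t : ℤ) :
    modulation w x t = ((w ^ t : Circle) : ℂ) * x t := rfl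

theorem modulation_mul_modulation_inv (w : Circle) : modulation w * modulation w⁻¹ = 1 := by
  ext x t
  rw [mul_apply_eq_comp, modulation_apply, modulation_apply, one_apply_eq_self, ← mul_assoc,
    ← Circle.coe_mul, ← mul_zpow]
  simp

/-- The modulations as units. -/
def modulationUnit (w : Circle) : (L2 ℤ →L[ℂ] L2 ℤ)ˣ where
  val := modulation w
  inv := modulation w⁻¹
  val_inv := modulation_mul_modulation_inv w
  inv_val := by simpa using modulation_mul_modulation_inv w⁻¹

theorem modulation_conj (w : Circle) :
    modulation w * translation 1 * modulation w⁻¹ = (w : ℂ) • translation 1 := by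
  ext x t
  simp only [mul_apply_eq_comp, modulation_apply, translation_apply,
    smul_apply, lp.coeFn_smul, Pi.smul_apply, smul_eq_mul]
  rw [← mul_assoc, ← Circle.coe_mul]
  congr 2
  rw [inv_zpow, ← zpow_neg, ← zpow_add]
  simp
  rfl

instance : Nontrivial (L2 ℤ →L[ℂ] L2 ℤ) := by
  refine ⟨⟨1, 0, fun h => ?_⟩⟩
  have h2 := congrArg (fun A : L2 ℤ →L[ℂ] L2 ℤ => A (bv 0) 0) h
  simp at h2

/-- The spectrum is non-empty and contained in the circle. Conjugation by the modulations multiplies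
the shift by any unimodular scalar, so the spectrum is invariant under rotation and is the whole
circle. -/
theorem coe_mem_spectrum_translation (z : Circle) : (z : ℂ) ∈ spectrum ℂ (translation 1) := by
  obtain ⟨a, ha⟩ := spectrum.nonempty (translation 1)
  have ha1 := spectrum.subset_circle_of_unitary (translation_mem_unitary 1) ha
  let a' : Circle := ⟨a, ha1⟩
  have h1 := spectrum.units_conjugate (R := ℂ) (a := translation 1)
    (u := modulationUnit (z * a'⁻¹))
  change spectrum ℂ (modulation (z * a'⁻¹) * translation 1 * modulation (z * a'⁻¹)⁻¹) = _ at h1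
  rw [modulation_conj] at h1
  rw [← h1]
  have h2 := spectrum.unit_smul_eq_smul (translation 1) (Circle.toUnits (z * a'⁻¹))
  change spectrum ℂ (((z * a'⁻¹ : Circle) : ℂ) • translation 1) = _ at h2
  rw [h2]
  refine ⟨a, ha, ?_⟩
  change ((z * a'⁻¹ : Circle) : ℂ) * (a' : ℂ) = z
  rw [← Circle.coe_mul, inv_mul_cancel_right]

instance : IsStarNormal (translation 1) :=
  ⟨by rw [star_translation, Commute, SemiconjBy, ← translation_add, ← translation_add]; simp⟩

/-- The inclusion of the spectrum of the bilateral shift into the circle. -/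
def spectrumToCircle : C(spectrum ℂ (translation 1), Circle) where
  toFun a := ⟨a, spectrum.subset_circle_of_unitary (translation_mem_unitary 1) a.2⟩
  continuous_toFun := Continuous.subtype_mk continuous_subtype_val _

/-- The representation of `C(𝕋)` on `ℓ²(ℤ)` by Laurent operators. -/
def laurent : C(Circle, ℂ) →⋆ₐ[ℂ] (L2 ℤ →L[ℂ] L2 ℤ) :=
  (cfcHom (R := ℂ) (p := IsStarNormal) (inferInstance : IsStarNormal (translation 1))).comp
    (ContinuousMap.compStarAlgHom' ℂ ℂ spectrumToCircle)

/-- The functional calculus is injective on functions on the spectrum, and the spectrum of the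
bilateral shift is the full circle. -/
theorem laurent_injective : Function.Injective laurent := by
  intro f g h
  have h2 := (cfcHom_isClosedEmbedding (R := ℂ)
    (inferInstance : IsStarNormal (translation 1))).injective h
  ext z
  exact congrArg (fun f => f ⟨(z : ℂ), coe_mem_spectrum_translation z⟩) h2

theorem norm_laurent (f : C(Circle, ℂ)) : ‖laurent f‖ = ‖f‖ :=
  NonUnitalStarAlgHom.norm_map laurent laurent_injective f

/-- The monomial `z ↦ z ^ s` on the circle. -/
def monom (s : ℤ) : C(Circle, ℂ) where
  toFun z := ((z ^ s : Circle) : ℂ)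
  continuous_toFun := continuous_subtype_val.comp (continuous_zpow s)

theorem monom_apply (s : ℤ) (z : Circle) : monom s z = ((z ^ s : Circle) : ℂ) := rfl

theorem monom_add (s t : ℤ) : monom (s + t) = monom s * monom t := by
  ext z
  simp [monom_apply, zpow_add]

theorem monom_zero : monom 0 = 1 := by
  ext z
  simp [monom_apply]

theorem star_monom (s : ℤ) : star (monom s) = monom (-s) := by
  ext z
  simp only [ContinuousMap.star_apply, monom_apply, zpow_neg]
  exact (Circle.coe_inv_eq_conj _).symm

theorem laurent_monom_one : laurent (monom 1) = translation 1 := by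
  have h := cfcHom_id (R := ℂ) (inferInstance : IsStarNormal (translation 1))
  conv_rhs => rw [← h]
  change cfcHom _ _ = _
  congr 1
  ext a
  change ((spectrumToCircle a ^ (1 : ℤ) : Circle) : ℂ) = a
  rw [zpow_one]
  rfl

theorem laurent_monom (s : ℤ) : laurent (monom s) = translation s := by
  induction s using Int.induction_on with
  | zero => rw [monom_zero, map_one, translation_zero]
  | succ n ih => rw [monom_add, map_mul, ih, laurent_monom_one, ← translation_add]
  | pred n ih =>
    rw [sub_eq_add_neg, monom_add, map_mul, ih, ← star_monom, map_star, laurent_monom_one,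
      star_translation, ← translation_add]

/-- The trigonometric polynomials. -/
def trigPoly : StarSubalgebra ℂ C(Circle, ℂ) where
  carrier := Submodule.span ℂ (Set.range monom)
  add_mem' := add_mem
  algebraMap_mem' c := by
    rw [Algebra.algebraMap_eq_smul_one, ← monom_zero]
    exact Submodule.smul_mem _ _ (Submodule.subset_span ⟨0, rfl⟩)
  mul_mem' {f g} hf hg := by
    refine Submodule.span_induction₂ (p := fun f g _ _ => f * g ∈ Submodule.span ℂ (Set.range monom))
      ?_ ?_ ?_ ?_ ?_ ?_ ?_ hf hg
    · rintro _ _ ⟨s, rfl⟩ ⟨t, rfl⟩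
      exact Submodule.subset_span ⟨s + t, monom_add s t⟩
    · intros; simp
    · intros; simp
    · intro x y z _ _ _ h1 h2; rw [add_mul]; exact add_mem h1 h2
    · intro x y z _ _ _ h1 h2; rw [mul_add]; exact add_mem h1 h2
    · intro c x y _ _ h; rw [smul_mul_assoc]; exact Submodule.smul_mem _ _ h
    · intro c x y _ _ h; rw [mul_smul_comm]; exact Submodule.smul_mem _ _ h
  star_mem' {f} hf := by
    induction hf using Submodule.span_induction with
    | mem f hf =>
      obtain ⟨s, rfl⟩ := hf
      exact Submodule.subset_span ⟨-s, (star_monom s).symm⟩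
    | zero => rw [star_zero]; exact zero_mem _
    | add f g _ _ hf hg => rw [star_add]; exact add_mem hf hg
    | smul c f _ hf => rw [star_smul]; exact Submodule.smul_mem _ _ hf

/-- A closed subspace of `C(𝕋)` that contains the monomials is everything. -/
theorem eq_top_of_monom_mem {S : Submodule ℂ C(Circle, ℂ)} (hS : IsClosed (S : Set C(Circle, ℂ)))
    (h : ∀ s, monom s ∈ S) : S = ⊤ := by
  have hsep : trigPoly.SeparatesPoints := by
    intro z w hzw
    refine ⟨_, ⟨monom 1, Submodule.subset_span ⟨1, rfl⟩, rfl⟩, ?_⟩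
    simp only [monom_apply, zpow_one]
    exact fun h => hzw (Circle.ext h)
  have hd := ContinuousMap.starSubalgebra_topologicalClosure_eq_top_of_separatesPoints trigPoly hsep
  refine eq_top_iff.2 fun f _ => ?_
  have hf : f ∈ trigPoly.topologicalClosure := hd ▸ StarSubalgebra.mem_top
  refine hS.closure_subset_iff.2 ?_ hf
  intro g hg
  exact (Submodule.span_le.2 (Set.range_subset_iff.2 h) : Submodule.span ℂ (Set.range monom) ≤ S) hg

end bilateral

/-! ### Toeplitz operators on the columns -/

section toep

open InnerProductSpace ContinuousLinearMap

variable {P : Matrix.rowStochastic ℝ Ω}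

theorem norm_wcomp_le {I J : Type*} (ψ : J → I) (b : J → ℂ) (hb : ∀ q, ‖b q‖ ≤ 1)
    (hψ : ∀ q q', b q ≠ 0 → b q' ≠ 0 → ψ q = ψ q' → q = q') : ‖wcomp ψ b hb hψ‖ ≤ 1 := by
  rw [wcomp]
  exact LinearMap.mkContinuous_norm_le _ zero_le_one _

namespace CyclicClasses

variable (D : CyclicClasses P) {k : Ω}

/-- The position of the basis vector `e_{ik}^{(n)}` among the basis vectors in the same row. -/
def pos (p : Idx P k) : ℤ := ((p.1.1 : ℤ) + D.c p.1.2 - D.c k) / D.r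

theorem r_mul_pos (p : Idx P k) : D.r * D.pos p = (p.1.1 : ℤ) + D.c p.1.2 - D.c k :=
  Int.mul_ediv_cancel' (D.dvd_of_pos p.2)

theorem pos_eq_iff {p : Idx P k} {t : ℤ} :
    D.pos p = t ↔ (p.1.1 : ℤ) + D.c p.1.2 - D.c k = D.r * t := by
  rw [← D.r_mul_pos p]
  exact (mul_right_inj' (by exact_mod_cast D.r_pos.ne')).symm

theorem pos_injOn {p q : Idx P k} (h : p.1.2 = q.1.2) (h' : D.pos p = D.pos q) : p = q := by
  have h1 := D.r_mul_pos p
  rw [h', D.r_mul_pos q, h] at h1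
  exact Subtype.ext (Prod.ext (by omega) h)

/-- Every row of a column fills all sufficiently large positions: from the power `N` on, periodicity
is the only obstruction to positivity. Together with `neg_le_pos` this places each row between two
half-lines of integers. -/
theorem exists_pos_eq (D : CyclicClasses P) (k : Ω) :
    ∃ T₀ : ℤ, ∀ t ≥ T₀, ∀ i, ∃ p : Idx P k, p.1.2 = i ∧ D.pos p = t := by
  refine ⟨D.N + ∑ i, (D.c i : ℤ), fun t ht i => ?_⟩
  have hi : (D.c i : ℤ) ≤ ∑ i, (D.c i : ℤ) :=
    Finset.single_le_sum (f := fun i => (D.c i : ℤ)) (fun _ _ => by positivity) (Finset.mem_univ i)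
  have hr : (1 : ℤ) ≤ D.r := by exact_mod_cast D.r_pos
  have h1 : t ≤ D.r * t := by nlinarith
  obtain ⟨n, hn⟩ : ∃ n : ℕ, (n : ℤ) = D.r * t + D.c k - D.c i :=
    ⟨(D.r * t + D.c k - D.c i).toNat, Int.toNat_of_nonneg (by omega)⟩
  have h2 : 0 < ((P : Matrix Ω Ω ℝ) ^ n) i k :=
    D.pos_of_dvd (by omega) ⟨t, by rw [hn]; ring⟩
  refine ⟨⟨(n, i), h2⟩, rfl, D.pos_eq_iff.2 ?_⟩
  change (n : ℤ) + D.c i - D.c k = _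
  omega

theorem neg_le_pos (p : Idx P k) : -(D.c k : ℤ) ≤ D.pos p := by
  have h := D.r_mul_pos p
  have hr : (1 : ℤ) ≤ D.r := by exact_mod_cast D.r_pos
  by_contra hlt
  push Not at hlt
  nlinarith

variable (k)

/-- The partial isometry of `ℓ²(ℤ)` onto the `i`-th row of the `k`-th column. -/
def emb (i : Ω) : L2 ℤ →L[ℂ] FockCol P k :=
  wcomp D.pos (fun p => if p.1.2 = i then 1 else 0) (fun p => by split_ifs <;> simp)
    (fun p q hp hq h => D.pos_injOn (by
      rw [ne_eq, ite_eq_right_iff, Classical.not_imp] at hp hq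
      exact hp.1.trans hq.1.symm) h)

/-- The adjoint of the partial isometry of `ℓ²(ℤ)` onto the `i`-th row of the `k`-th column. -/
def coemb (i : Ω) : FockCol P k →L[ℂ] L2 ℤ := adjoint (D.emb k i)

variable {k}

theorem emb_apply (i : Ω) (y : L2 ℤ) (p : Idx P k) :
    D.emb k i y p = if p.1.2 = i then y (D.pos p) else 0 := by
  rw [emb, wcomp_apply, ite_mul, one_mul, zero_mul]

theorem emb_bv_pos (p : Idx P k) : D.emb k p.1.2 (bv (D.pos p)) = bv p := by
  ext q
  rw [emb_apply, bv_apply, bv_apply]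
  by_cases h : q = p
  · subst h; simp
  · rw [if_neg h]
    split_ifs with h1 h2
    · exact absurd (D.pos_injOn h1 h2) h
    · rfl
    · rfl

theorem emb_bv_ne {i : Ω} {t : ℤ} (h : ∀ p : Idx P k, p.1.2 = i → D.pos p ≠ t) :
    D.emb k i (bv t) = 0 := by
  ext q
  rw [emb_apply, bv_apply]
  split_ifs with h1 h2
  · exact absurd h2 (h q h1)
  · rfl
  · rfl

theorem coemb_apply_pos (x : FockCol P k) (p : Idx P k) : D.coemb k p.1.2 x (D.pos p) = x p := by
  rw [coemb, adjoint_coord, emb_bv_pos, inner_bv]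

theorem coemb_apply_ne {i : Ω} {t : ℤ} (h : ∀ p : Idx P k, p.1.2 = i → D.pos p ≠ t)
    (x : FockCol P k) : D.coemb k i x t = 0 := by
  rw [coemb, adjoint_coord, D.emb_bv_ne h, inner_zero_left]

/-- The hypothesis says that `t` would be the position of `(m, j)`. If `(m, j)` is not an index, no
index of row `j` has position `t`, and both sides take their default value zero. -/
theorem coemb_eq_coord (x : FockCol P k) {j : Ω} {m : ℕ} {t : ℤ}
    (h : (m : ℤ) + D.c j - D.c k = D.r * t) : D.coemb k j x t = coord x m j := by
  by_cases hm : 0 < ((P : Matrix Ω Ω ℝ) ^ m) j k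
  · rw [coord_of_pos x hm, ← D.coemb_apply_pos x ⟨(m, j), hm⟩, D.pos_eq_iff.2 h]
  · rw [coord, dif_neg hm]
    refine D.coemb_apply_ne (fun p hp hpt => hm ?_) x
    have h1 := D.pos_eq_iff.1 hpt
    rw [← h, hp] at h1
    have h2 : p.1.1 = m := by omega
    have h3 := p.2
    rwa [hp, h2] at h3

theorem coemb_emb_of_ne {i j : Ω} (h : i ≠ j) (y : L2 ℤ) : D.coemb k i (D.emb k j y) = 0 := by
  ext t
  by_cases ht : ∃ p : Idx P k, p.1.2 = i ∧ D.pos p = t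
  · obtain ⟨p, rfl, rfl⟩ := ht
    rw [coemb_apply_pos, emb_apply, if_neg h]
    rfl
  · push Not at ht
    rw [D.coemb_apply_ne ht]
    rfl

theorem coemb_emb_apply_of_exists {i : Ω} {t : ℤ} (ht : ∃ p : Idx P k, p.1.2 = i ∧ D.pos p = t)
    (y : L2 ℤ) : D.coemb k i (D.emb k i y) t = y t := by
  obtain ⟨p, rfl, rfl⟩ := ht
  rw [coemb_apply_pos, emb_apply, if_pos rfl]

variable (k)

/-- The `i`-th row of the Toeplitz operator with symbol `F`, before compression. -/
def toepRow (F : Matrix Ω Ω C(Circle, ℂ)) (i : Ω) : FockCol P k →L[ℂ] L2 ℤ :=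
  ∑ j, laurent (F i j) ∘L D.coemb k j

theorem toepRow_apply (F : Matrix Ω Ω C(Circle, ℂ)) (i : Ω) (x : FockCol P k) :
    D.toepRow k F i x = ∑ j, laurent (F i j) (D.coemb k j x) := by
  rw [toepRow, sum_apply]
  rfl

/-- The Toeplitz operator on the `k`-th column with a matrix valued symbol. -/
def toep : Matrix Ω Ω C(Circle, ℂ) →ₗ[ℂ] FockCol P k →L[ℂ] FockCol P k where
  toFun F := ∑ i, D.emb k i ∘L D.toepRow k F i
  map_add' F G := by
    ext1 x
    simp only [sum_apply, comp_apply, toepRow_apply, Matrix.add_apply, map_add, add_apply,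
      Finset.sum_add_distrib]
  map_smul' c F := by
    ext1 x
    simp only [sum_apply, comp_apply, toepRow_apply, Matrix.smul_apply, map_smul, smul_apply,
      Finset.smul_sum, map_sum, RingHom.id_apply]

variable {k}

theorem toep_apply (F : Matrix Ω Ω C(Circle, ℂ)) (x : FockCol P k) :
    D.toep k F x = ∑ i, D.emb k i (D.toepRow k F i x) := by
  change (∑ i, D.emb k i ∘L D.toepRow k F i) x = _
  rw [sum_apply]
  rfl

theorem toep_apply_coord (F : Matrix Ω Ω C(Circle, ℂ)) (x : FockCol P k) (p : Idx P k) :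
    D.toep k F x p = D.toepRow k F p.1.2 x (D.pos p) := by
  rw [toep_apply, lp.coeFn_sum, Finset.sum_apply]
  simp only [emb_apply]
  rw [Finset.sum_ite_eq, if_pos (Finset.mem_univ _)]

theorem toep_single (i j : Ω) (g : C(Circle, ℂ)) :
    D.toep k (Matrix.single i j g) = D.emb k i ∘L laurent g ∘L D.coemb k j := by
  ext1 x
  rw [toep_apply, Finset.sum_eq_single i, toepRow_apply, Finset.sum_eq_single j]
  · rw [Matrix.single_apply_same]; rfl
  · intro l _ hl
    rw [Matrix.single_apply_of_col_ne _ _ hl.symm, map_zero, zero_apply]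
  · simp
  · intro l _ hl
    rw [toepRow_apply, Finset.sum_eq_zero, map_zero]
    intro m _
    rw [Matrix.single_apply_of_row_ne hl.symm, map_zero, zero_apply]
  · simp

theorem toep_diagonal (a : Ω → ℂ) (x : FockCol P k) (p : Idx P k) :
    D.toep k (Matrix.diagonal fun i => algebraMap ℂ C(Circle, ℂ) (a i)) x p = a p.1.2 * x p := by
  rw [toep_apply_coord, toepRow_apply, Finset.sum_eq_single p.1.2]
  · rw [Matrix.diagonal_apply_eq, AlgHomClass.commutes, Algebra.algebraMap_eq_smul_one, smul_apply,
      one_apply_eq_self, lp.coeFn_smul, Pi.smul_apply, coemb_apply_pos, smul_eq_mul]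
  · intro l _ hl
    rw [Matrix.diagonal_apply_ne _ hl.symm, map_zero, zero_apply]
  · simp

theorem toep_one : D.toep k 1 = 1 := by
  ext x p
  have h := D.toep_diagonal (fun _ => 1) x p
  simp only [map_one, one_mul, Matrix.diagonal_one] at h
  exact h

theorem star_toep (F : Matrix Ω Ω C(Circle, ℂ)) : star (D.toep k F) = D.toep k (star F) := by
  rw [star_eq_adjoint, eq_comm, eq_adjoint_iff]
  intro x y
  simp only [toep_apply, toepRow_apply, map_sum, sum_inner, inner_sum]
  rw [Finset.sum_comm]
  refine Finset.sum_congr rfl fun i _ => Finset.sum_congr rfl fun j _ => ?_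
  rw [Matrix.star_apply, map_star, star_eq_adjoint, coemb, coemb,
    ← adjoint_inner_right (D.emb k j), adjoint_inner_left, adjoint_inner_left]

/-- `coemb ∘ emb` projects onto the positions occupied by row `j`, so the operator is a Hankel
operator up to sign. For a monomial only finitely many coordinates survive. The general symbol
follows by density of the trigonometric polynomials and closedness of the compact operators. -/
theorem isCompactOperator_hankel (j m : Ω) (g : C(Circle, ℂ)) :
    IsCompactOperator (D.coemb k j ∘L D.emb k j ∘L laurent g ∘L D.coemb k m -
      laurent g ∘L D.coemb k m) := by
  let L : C(Circle, ℂ) →ₗ[ℂ] FockCol P k →L[ℂ] L2 ℤ :=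
    { toFun := fun g => D.coemb k j ∘L D.emb k j ∘L laurent g ∘L D.coemb k m -
        laurent g ∘L D.coemb k m
      map_add' := fun f g => by
        ext1 x
        simp only [sub_apply, comp_apply, map_add, add_apply]
        abel
      map_smul' := fun c g => by
        ext1 x
        simp only [sub_apply, comp_apply, map_smul, smul_apply, smul_sub, RingHom.id_apply] }
  have hlc : Continuous laurent := (AddMonoidHomClass.isometry_of_norm laurent norm_laurent).continuous
  have hL : Continuous L := by
    change Continuous fun g => D.coemb k j ∘L D.emb k j ∘L laurent g ∘L D.coemb k m -
        laurent g ∘L D.coemb k m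
    exact (continuous_const.clm_comp (continuous_const.clm_comp (hlc.clm_comp continuous_const))).sub
      (hlc.clm_comp continuous_const)
  let S : Submodule ℂ C(Circle, ℂ) :=
    (compactOperator (RingHom.id ℂ) (FockCol P k) (L2 ℤ)).comap L
  have hS : S = ⊤ := by
    refine eq_top_of_monom_mem ?_ fun s => ?_
    · exact (isClosed_setOfPred_isCompactOperator (σ₁₂ := RingHom.id ℂ) (M₁ := FockCol P k)
        (M₂ := L2 ℤ)).preimage hL
    · obtain ⟨T₀, hT₀⟩ := D.exists_pos_eq k
      refine isCompactOperator_of_coord_eq_zero (A := L (monom s))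
        -- From `T₀` on, row `j` is full and the projection does nothing. Below `-c k + s`, the
        -- shifted vector is zero because no position is less than `-c k`.
        (Finset.Ico (-(D.c k : ℤ) + s) T₀) fun t ht x => ?_
      rw [Finset.mem_Ico, not_and_or, not_le, not_lt] at ht
      change D.coemb k j (D.emb k j (laurent (monom s) (D.coemb k m x))) t -
        laurent (monom s) (D.coemb k m x) t = 0
      by_cases hex : ∃ p : Idx P k, p.1.2 = j ∧ D.pos p = t
      · rw [D.coemb_emb_apply_of_exists hex, sub_self]
      · have ht' : t < -(D.c k : ℤ) + s := ht.resolve_right fun h => hex (hT₀ t h j)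
        push Not at hex
        rw [D.coemb_apply_ne hex, laurent_monom, translation_apply, D.coemb_apply_ne, sub_zero]
        intro p _ hp
        have := D.neg_le_pos p
        omega
  have hg : g ∈ S := hS ▸ Submodule.mem_top
  exact hg

/-- Laurent operators multiply exactly, so the defect comes only from the projections onto rows
inserted between the two factors. It is a finite sum of Hankel operators composed with bounded ones.
-/
theorem isCompactOperator_toep_mul (F G : Matrix Ω Ω C(Circle, ℂ)) :
    IsCompactOperator (D.toep k F * D.toep k G - D.toep k (F * G) :
      FockCol P k →L[ℂ] FockCol P k) := by
  have h : D.toep k F * D.toep k G - D.toep k (F * G) = ∑ i, ∑ j, ∑ m,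
      (D.emb k i ∘L laurent (F i j)) ∘L (D.coemb k j ∘L D.emb k j ∘L laurent (G j m) ∘L D.coemb k m -
        laurent (G j m) ∘L D.coemb k m) := by
    ext1 x
    have h1 : ∀ j, D.coemb k j (D.toep k G x) =
        D.coemb k j (D.emb k j (D.toepRow k G j x)) := fun j => by
      rw [toep_apply, map_sum, Finset.sum_eq_single j (fun l _ hl =>
        D.coemb_emb_of_ne hl.symm _) (by simp)]
    have h2 : ∀ i, D.toepRow k (F * G) i x = ∑ j, laurent (F i j) (D.toepRow k G j x) := fun i => by
      simp only [toepRow_apply, Matrix.mul_apply, map_sum, map_mul, sum_apply, mul_apply_eq_comp]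
      rw [Finset.sum_comm]
    simp only [sub_apply, mul_apply_eq_comp, sum_apply, comp_apply]
    rw [D.toep_apply F, D.toep_apply (F * G), ← Finset.sum_sub_distrib]
    refine Finset.sum_congr rfl fun i _ => ?_
    rw [h2, toepRow_apply, map_sum, map_sum, ← Finset.sum_sub_distrib]
    refine Finset.sum_congr rfl fun j _ => ?_
    rw [h1]
    simp only [toepRow_apply, map_sum, map_sub, Finset.sum_sub_distrib]
  rw [h]
  refine isCompactOperator_sum _ _ fun i _ => isCompactOperator_sum _ _ fun j _ =>
    isCompactOperator_sum _ _ fun m _ => ?_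
  exact (D.isCompactOperator_hankel j m (G j m)).clm_comp (D.emb k i ∘L laurent (F i j))

/-- Laurent operators commute with translations, so their matrices are constant along diagonals. -/
theorem laurent_bv_add (g : C(Circle, ℂ)) (a b n : ℤ) :
    laurent g (bv (a + n)) (b + n) = laurent g (bv a) b := by
  have h : laurent g (translation n (bv a)) = translation n (laurent g (bv a)) := by
    have h1 : laurent g * laurent (monom n) = laurent (monom n) * laurent g := by
      rw [← map_mul, mul_comm, map_mul]
    rw [laurent_monom] at h1
    exact congrArg (fun A : L2 ℤ →L[ℂ] L2 ℤ => A (bv a)) h1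
  rw [← translation_bv, h, translation_apply, add_sub_cancel_right]

/-- The matrix coefficients of a compact perturbation of a Toeplitz operator are asymptotically
those of the Laurent operator. -/
theorem exists_coeff_near {A : FockCol P k →L[ℂ] FockCol P k} {F : Matrix Ω Ω C(Circle, ℂ)}
    (hA : IsCompactOperator (A - D.toep k F)) (i j : Ω) (a b : ℤ) {ε : ℝ} (hε : 0 < ε) :
    ∃ n₀ : ℕ, ∀ n ≥ n₀, ∃ p q : Idx P k, p.1.2 = j ∧ q.1.2 = i ∧ D.pos p = a + n ∧
      D.pos q = b + n ∧ ‖A (bv p) q - laurent (F i j) (bv a) b‖ ≤ ε := by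
  obtain ⟨T₀, hT₀⟩ := D.exists_pos_eq k
  obtain ⟨s, hs⟩ := norm_coord_le_of_compact hA hε
  obtain ⟨M, hM⟩ : ∃ M : ℤ, ∀ q ∈ s, D.pos q ≤ M := by
    obtain ⟨M, hM⟩ := (s.image D.pos).bddAbove
    exact ⟨M, fun q hq => hM (Finset.mem_coe.2 (Finset.mem_image_of_mem _ hq))⟩
  -- Far enough out that both positions occur in their rows and that the output position lies beyond
  -- the finite set outside which the compact error is small.
  refine ⟨(T₀ - a).toNat + (T₀ - b).toNat + (M + 1 - b).toNat, fun n hn => ?_⟩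
  obtain ⟨p, hp1, hp2⟩ := hT₀ (a + n) (by omega) j
  obtain ⟨q, hq1, hq2⟩ := hT₀ (b + n) (by omega) i
  refine ⟨p, q, hp1, hq1, hp2, hq2, ?_⟩
  have hqs : q ∉ s := fun h => by
    have := hM q h
    omega
  have h1 := hs q hqs (bv p)
  rw [norm_bv, mul_one, sub_apply, lp.coeFn_sub, Pi.sub_apply, toep_apply_coord, toepRow_apply,
    Finset.sum_eq_single p.1.2] at h1
  · have h2 : D.coemb k p.1.2 (bv p) = bv (D.pos p) := by
      ext t
      by_cases ht : ∃ p' : Idx P k, p'.1.2 = p.1.2 ∧ D.pos p' = t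
      · obtain ⟨p', h3, rfl⟩ := ht
        rw [← h3, coemb_apply_pos, bv_apply, bv_apply]
        exact if_congr ⟨fun h => by rw [h], fun h => D.pos_injOn h3 h⟩ rfl rfl
      · push Not at ht
        rw [D.coemb_apply_ne ht, bv_apply, if_neg fun h => ht p rfl h.symm]
    rwa [h2, hp1, hq1, hp2, hq2, laurent_bv_add] at h1
  · intro l _ hl
    rw [← D.emb_bv_pos p, D.coemb_emb_of_ne hl, map_zero]
  · simp

/-- Translating a compression of `A` towards `+∞` and back leaves its norm at most `‖A‖`, while its
matrix coefficients converge to those of the Laurent operator of `F i j`. Laurent operators have the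
norm of their symbol. -/
theorem norm_symbol_le {A : FockCol P k →L[ℂ] FockCol P k} {F : Matrix Ω Ω C(Circle, ℂ)}
    (hA : IsCompactOperator (A - D.toep k F)) (i j : Ω) : ‖F i j‖ ≤ ‖A‖ := by
  have hle : ∀ {y : ℝ} {u v : ℝ}, u ≤ 1 → 0 ≤ v → y ≤ u * v → y ≤ v := fun hu hv h =>
    h.trans (mul_le_of_le_one_left hv hu)
  have htr : ∀ s x, ‖translation s x‖ ≤ ‖x‖ := fun s x =>
    hle (norm_wcomp_le _ _ _ _) (norm_nonneg x) ((translation s).le_opNorm x)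
  have hemb : ∀ i x, ‖D.emb k i x‖ ≤ ‖x‖ := fun i x =>
    hle (norm_wcomp_le _ _ _ _) (norm_nonneg x) ((D.emb k i).le_opNorm x)
  have hcoemb : ∀ i x, ‖D.coemb k i x‖ ≤ ‖x‖ := fun i x =>
    hle ((adjoint.norm_map (D.emb k i)).trans_le (norm_wcomp_le _ _ _ _)) (norm_nonneg x)
      ((D.coemb k i).le_opNorm x)
  rw [← norm_laurent]
  refine norm_le_of_tendsto_coord (B := fun n : ℕ =>
    translation (-n) ∘L D.coemb k i ∘L A ∘L D.emb k j ∘L translation n) (norm_nonneg A)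
    (fun n => opNorm_le_bound _ (norm_nonneg A) fun x => ?_) fun a b => ?_
  · refine (htr _ _).trans ((hcoemb _ _).trans ((A.le_opNorm _).trans ?_))
    exact mul_le_mul_of_nonneg_left ((hemb _ _).trans (htr _ _)) (norm_nonneg A)
  · rw [Metric.tendsto_atTop]
    intro ε hε
    obtain ⟨n₀, hn₀⟩ := D.exists_coeff_near hA i j a b (half_pos hε)
    refine ⟨n₀, fun n hn => ?_⟩
    obtain ⟨p, q, rfl, rfl, hp, hq, h⟩ := hn₀ n hn
    have h1 : translation (-n) (D.coemb k q.1.2 (A (D.emb k p.1.2 (translation n (bv a))))) b =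
        A (bv p) q := by
      rw [translation_apply, translation_bv, ← hp, emb_bv_pos, sub_neg_eq_add, ← hq,
        coemb_apply_pos]
    rw [dist_eq_norm]
    simp only [comp_apply, h1]
    exact h.trans_lt (half_lt_self hε)

/-- Basis vectors of high degree are sent to small vectors by `T`, but their matrix coefficients
approach those of the Laurent operators of the symbol. -/
theorem symbol_eq_zero {T : Adjointable P}
    (hT : Tendsto (fun n => ‖T * fiberProj P n‖) atTop (𝓝 0)) {F : Matrix Ω Ω C(Circle, ℂ)}
    (hF : IsCompactOperator (colRep P k T - D.toep k F)) : F = 0 := by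
  ext1 i j
  rw [Matrix.zero_apply]
  refine laurent_injective ?_
  rw [map_zero]
  refine clm_ext_bv fun a => ?_
  ext b
  rw [zero_apply]
  change _ = (0 : ℂ)
  rw [← norm_le_zero_iff]
  refine le_of_forall_pos_le_add fun ε hε => ?_
  rw [zero_add]
  obtain ⟨n₀, hn₀⟩ := D.exists_coeff_near hF i j a b (half_pos hε)
  obtain ⟨N, hN⟩ := Metric.tendsto_atTop.1 hT (ε / 2) (half_pos hε)
  -- The extra summands offset a negative `a` and the label of row `j`, so that the degree of `p` is
  -- at least `N`.
  obtain ⟨p, q, hpj, -, hp, -, h⟩ := hn₀ (n₀ + N + (D.c j + a.natAbs)) (by omega)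
  have h1 := D.r_mul_pos p
  have hr : (1 : ℤ) ≤ D.r := by exact_mod_cast D.r_pos
  have h2 : D.pos p ≤ D.r * D.pos p := le_mul_of_one_le_left (by omega) hr
  have h3 := hN p.1.1 (by rw [hpj] at h1; omega)
  rw [dist_zero_right, norm_norm] at h3
  have h4 : colRep P k T (bv p) = colRep P k (T * fiberProj P p.1.1) (bv p) := by
    rw [map_mul, mul_apply_eq_comp]
    congr 1
    ext q
    rw [colRep_fiberProj, bv_apply]
    split_ifs with h5 h6 h6
    · rfl
    · rw [h5] at h6
      exact absurd rfl h6
    · rfl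
    · rfl
  have h5 : ‖colRep P k T (bv p) q‖ ≤ ε / 2 := by
    refine (norm_coord_le _ _).trans ?_
    rw [h4]
    refine (le_opNorm _ _).trans ?_
    rw [norm_bv, mul_one]
    exact (norm_colRep_le _ _).trans h3.le
  have h6 := norm_sub_le (colRep P k T (bv p) q) (colRep P k T (bv p) q - laurent (F i j) (bv a) b)
  rw [sub_sub_cancel] at h6
  linarith

end CyclicClasses

end toep

/-! ### The Toeplitz algebra as an extension of `C(𝕋, M_d)` by compact operators -/

section extension

open InnerProductSpace ContinuousLinearMap

variable {P : Matrix.rowStochastic ℝ Ω}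

theorem mem_cpIdeal_of_isCompactOperator {T : toeplitz P}
    (hT : ∀ k, IsCompactOperator (colRep P k (T : Adjointable P))) : T ∈ cpIdeal P :=
  tendsto_mul_fiberProj_of_isCompactOperator hT

/-! ### Symbols modulo compact operators and the quotient -/

namespace CyclicClasses

variable (D : CyclicClasses P)

/-- `T` is a compact perturbation of the Toeplitz operator with symbol `F` on every column. -/
def HasSymbol (T : Adjointable P) (F : Matrix Ω Ω C(Circle, ℂ)) : Prop :=
  ∀ k, IsCompactOperator (colRep P k T - D.toep k F)

variable {D}

theorem HasSymbol.add {T S : Adjointable P} {F G : Matrix Ω Ω C(Circle, ℂ)}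
    (hT : D.HasSymbol T F) (hS : D.HasSymbol S G) : D.HasSymbol (T + S) (F + G) := fun k => by
  have h : colRep P k (T + S) - D.toep k (F + G) =
      (colRep P k T - D.toep k F) + (colRep P k S - D.toep k G) := by
    rw [map_add, map_add]
    abel
  rw [h]
  exact (hT k).add (hS k)

theorem HasSymbol.smul {T : Adjointable P} {F : Matrix Ω Ω C(Circle, ℂ)}
    (hT : D.HasSymbol T F) (c : ℂ) : D.HasSymbol (c • T) (c • F) := fun k => by
  rw [map_smul, map_smul, ← smul_sub]
  exact (hT k).smul (S := ℂ) c

theorem HasSymbol.sub {T S : Adjointable P} {F G : Matrix Ω Ω C(Circle, ℂ)}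
    (hT : D.HasSymbol T F) (hS : D.HasSymbol S G) : D.HasSymbol (T - S) (F - G) := by
  have h := hT.add (hS.smul (-1))
  rwa [neg_one_smul, neg_one_smul, ← sub_eq_add_neg, ← sub_eq_add_neg] at h

theorem HasSymbol.mul {T S : Adjointable P} {F G : Matrix Ω Ω C(Circle, ℂ)}
    (hT : D.HasSymbol T F) (hS : D.HasSymbol S G) : D.HasSymbol (T * S) (F * G) := fun k => by
  have h : colRep P k (T * S) - D.toep k (F * G) =
      (colRep P k T - D.toep k F) ∘L colRep P k S + D.toep k F ∘L (colRep P k S - D.toep k G) +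
        (D.toep k F * D.toep k G - D.toep k (F * G)) := by
    rw [map_mul]
    change _ = (colRep P k T - D.toep k F) * colRep P k S +
      D.toep k F * (colRep P k S - D.toep k G) + _
    rw [sub_mul, mul_sub]
    abel
  rw [h]
  exact (((hT k).comp_clm (colRep P k S)).add ((hS k).clm_comp (D.toep k F))).add
    (D.isCompactOperator_toep_mul F G)

theorem HasSymbol.star {T : Adjointable P} {F : Matrix Ω Ω C(Circle, ℂ)}
    (hT : D.HasSymbol T F) : D.HasSymbol (star T) (star F) := fun k => by
  have h : colRep P k (Star.star T) - D.toep k (Star.star F) = adjoint (colRep P k T - D.toep k F) := by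
    rw [map_star, ← D.star_toep, ← star_sub, star_eq_adjoint]
  rw [h]
  exact isCompactOperator_adjoint (hT k)

theorem HasSymbol.norm_le [Nonempty Ω] {T : Adjointable P} {F : Matrix Ω Ω C(Circle, ℂ)}
    (hT : D.HasSymbol T F) (i j : Ω) : ‖F i j‖ ≤ ‖T‖ := by
  obtain ⟨k⟩ := ‹Nonempty Ω›
  exact (D.norm_symbol_le (hT k) i j).trans (norm_colRep_le T k)

variable (D)

theorem hasSymbol_leftAct (a : Ω → ℂ) : D.HasSymbol (leftAct a)
    (Matrix.diagonal fun i => algebraMap ℂ C(Circle, ℂ) (a i)) := fun k => by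
  have h : colRep P k (leftAct a) =
      D.toep k (Matrix.diagonal fun i => algebraMap ℂ C(Circle, ℂ) (a i)) := by
    ext x p
    rw [D.toep_diagonal, leftAct, colRep_mulOp]
  rw [h, sub_self]
  exact isCompactOperator_zero

theorem hasSymbol_one : D.HasSymbol 1 1 := fun k => by
  rw [map_one, D.toep_one, sub_self]
  exact isCompactOperator_zero

theorem toep_single_monom_apply {k i j : Ω} {n : ℕ} {s : ℤ}
    (hs : (n : ℤ) + D.c i - D.c j = D.r * s) (x : FockCol P k) {m : ℕ}
    (hp : 0 < ((P : Matrix Ω Ω ℝ) ^ (n + m)) i k) :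
    D.toep k (Matrix.single i j (monom s)) x ⟨(n + m, i), hp⟩ = coord x m j := by
  rw [toep_single, comp_apply, comp_apply, emb_apply, if_pos rfl, laurent_monom, translation_apply]
  refine D.coemb_eq_coord x ?_
  have h := D.r_mul_pos (⟨(n + m, i), hp⟩ : Idx P k)
  rw [mul_sub, h, ← hs]
  push_cast
  ring

theorem toep_single_monom_apply_eq_zero {k i j : Ω} {n : ℕ} {s : ℤ}
    (hs : (n : ℤ) + D.c i - D.c j = D.r * s) (x : FockCol P k) {p : Idx P k}
    (hp : ¬ (n ≤ p.1.1 ∧ p.1.2 = i)) :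
    D.toep k (Matrix.single i j (monom s)) x p = 0 := by
  rw [toep_single, comp_apply, comp_apply, emb_apply]
  split_ifs with hi
  · rw [laurent_monom, translation_apply]
    refine D.coemb_apply_ne (fun q hq hqt => hp ⟨?_, hi⟩) x
    have h1 := D.r_mul_pos q
    have h2 := D.r_mul_pos p
    rw [hqt, mul_sub, h2, ← hs, hi, hq] at h1
    omega
  · rfl

/-- The generator and the Toeplitz operator shift the same basis vectors by `s` and differ only in
their weights. The weights converge by `ratio_tendsto`, so the difference has coordinates dominated
by vanishing multiples of those of the Toeplitz operator. -/
theorem hasSymbol_sh {n : ℕ} {i j : Ω} (hij : 0 < ((P : Matrix Ω Ω ℝ) ^ n) i j) {s : ℤ}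
    (hs : (n : ℤ) + D.c i - D.c j = D.r * s) :
    D.HasSymbol (sh P n i j) ((Real.sqrt (((P : Matrix Ω Ω ℝ) ^ n) i j) : ℂ) •
      Matrix.single i j (monom s)) := fun k => by
  rw [map_smul]
  set w := Real.sqrt (((P : Matrix Ω Ω ℝ) ^ n) i j) with hw
  have hw0 : 0 ≤ w := Real.sqrt_nonneg _
  refine isCompactOperator_of_coord_le (B := D.toep k (Matrix.single i j (monom s))) fun ε hε => ?_
  obtain ⟨m₀, hm₀⟩ := D.ratio_tendsto hij k (ε := ε / (w + 1)) (by positivity)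
  -- Only the finitely many indices of degree less than `n + m₀` can violate the estimate.
  refine ⟨((Finset.range (n + m₀) ×ˢ (Finset.univ : Finset Ω)).subtype
      (fun p => 0 < ((P : Matrix Ω Ω ℝ) ^ p.1) p.2 k)), fun p hp x => ?_⟩
  rw [Finset.mem_subtype, Finset.mem_product, Finset.mem_range] at hp
  rw [sub_apply, smul_apply, lp.coeFn_sub, Pi.sub_apply, lp.coeFn_smul, Pi.smul_apply]
  rcases idx_cases n i p with h | ⟨m, h, rfl⟩
  · rw [colRep_sh_apply_eq_zero x h, D.toep_single_monom_apply_eq_zero hs x h]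
    simp
  · rw [colRep_sh_apply, D.toep_single_monom_apply hs, smul_eq_mul, ← sub_mul, norm_mul]
    by_cases hm : 0 < ((P : Matrix Ω Ω ℝ) ^ m) j k
    · refine mul_le_mul_of_nonneg_right ?_ (norm_nonneg _)
      rw [← Complex.ofReal_sub, Complex.norm_real, Real.norm_eq_abs]
      have hm' : m₀ ≤ m := by
        by_contra hlt
        exact hp ⟨by simp; omega, Finset.mem_univ _⟩
      have h1 := hm₀ m hm' hm
      set ρ := ((P : Matrix Ω Ω ℝ) ^ m) j k / ((P : Matrix Ω Ω ℝ) ^ (n + m)) i k with hρ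
      have hρ0 : 0 ≤ ρ := div_nonneg hm.le h.le
      have h2 : weight P n m i j k = w * Real.sqrt ρ := by
        rw [weight, hρ, Real.sqrt_div hm.le, ← hw]
        ring
      -- Since `ρ - 1 = (√ρ - 1)(√ρ + 1)` and the second factor is at least one, convergence of the
      -- ratios gives convergence of the weights.
      have h3 : |Real.sqrt ρ - 1| ≤ |ρ - 1| := by
        have h4 : ρ - 1 = (Real.sqrt ρ - 1) * (Real.sqrt ρ + 1) := by
          nlinarith [Real.sq_sqrt hρ0]
        rw [h4, abs_mul]
        refine le_mul_of_one_le_right (abs_nonneg _) ?_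
        rw [abs_of_nonneg (by positivity)]
        linarith [Real.sqrt_nonneg ρ]
      rw [h2, ← mul_sub_one, abs_mul, abs_of_nonneg hw0]
      calc w * |Real.sqrt ρ - 1| ≤ w * (ε / (w + 1)) :=
            mul_le_mul_of_nonneg_left (h3.trans h1.le) hw0
        _ ≤ ε := by
            rw [mul_div_assoc', div_le_iff₀ (by positivity)]
            nlinarith
    · rw [coord, dif_neg hm]
      simp

theorem shift_eq_sum (n : ℕ) (A : Matrix Ω Ω ℂ) :
    (shift n A : Adjointable P) = ∑ i, ∑ j, A i j • sh P n i j := by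
  have hadd : ∀ A B : Matrix Ω Ω ℂ, (shift n (A + B) : Adjointable P) = shift n A + shift n B := by
    intro A B
    refine Subtype.ext (ContinuousLinearMap.ext fun x => funext fun k => lp.ext (funext fun p => ?_))
    change (if n ≤ p.1.1 then subprod P n (p.1.1 - n) (A + B) (fiber x (p.1.1 - n)) p.1.2 k else 0) =
      (if n ≤ p.1.1 then subprod P n (p.1.1 - n) A (fiber x (p.1.1 - n)) p.1.2 k else 0) +
      (if n ≤ p.1.1 then subprod P n (p.1.1 - n) B (fiber x (p.1.1 - n)) p.1.2 k else 0)
    split_ifs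
    · simp [subprod, Matrix.hadamard_add, add_mul, mul_add]
    · simp
  have hsmul : ∀ (c : ℂ) (A : Matrix Ω Ω ℂ), (shift n (c • A) : Adjointable P) = c • shift n A := by
    intro c A
    refine Subtype.ext (ContinuousLinearMap.ext fun x => funext fun k => lp.ext (funext fun p => ?_))
    change (if n ≤ p.1.1 then subprod P n (p.1.1 - n) (c • A) (fiber x (p.1.1 - n)) p.1.2 k else 0) =
      c • (if n ≤ p.1.1 then subprod P n (p.1.1 - n) A (fiber x (p.1.1 - n)) p.1.2 k else 0)
    split_ifs
    · simp [subprod, Matrix.hadamard_smul, mul_left_comm]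
    · simp
  let L : Matrix Ω Ω ℂ →ₗ[ℂ] Adjointable P :=
    { toFun := shift n, map_add' := hadd, map_smul' := hsmul }
  change L A = _
  conv_lhs => rw [Matrix.matrix_eq_sum_single A]
  rw [map_sum]
  refine Finset.sum_congr rfl fun i _ => ?_
  rw [map_sum]
  refine Finset.sum_congr rfl fun j _ => ?_
  have h : Matrix.single i j (A i j) = A i j • Matrix.single i j 1 := by
    rw [Matrix.smul_single, smul_eq_mul, mul_one]
  rw [h, map_smul]
  rfl

/-- The adjointable operators that are compact perturbations of Toeplitz operators. -/
def symbolAlgebra : StarSubalgebra ℂ (Adjointable P) where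
  carrier := {T | ∃ F, D.HasSymbol T F}
  mul_mem' := fun ⟨_, h⟩ ⟨_, h'⟩ => ⟨_, h.mul h'⟩
  add_mem' := fun ⟨_, h⟩ ⟨_, h'⟩ => ⟨_, h.add h'⟩
  algebraMap_mem' c := ⟨_, by
    rw [Algebra.algebraMap_eq_smul_one]
    exact D.hasSymbol_one.smul c⟩
  star_mem' := fun ⟨_, h⟩ => ⟨_, h.star⟩

/-- The entries of the symbol are bounded by the norm of the operator, so the symbols of a
convergent sequence are Cauchy. Their limit is a symbol of the limit operator because Toeplitz
operators depend continuously on the symbol and compactness passes to norm limits. -/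
theorem isClosed_symbolAlgebra [Nonempty Ω] :
    IsClosed (D.symbolAlgebra : Set (Adjointable P)) := by
  refine isClosed_of_closure_subset fun T hT => ?_
  obtain ⟨u, hu, hlim⟩ := mem_closure_iff_seq_limit.1 hT
  choose F hF using hu
  have hcauchy : ∀ i j, CauchySeq fun n => F n i j := by
    intro i j
    have h1 := hlim.cauchySeq
    rw [Metric.cauchySeq_iff] at h1 ⊢
    intro ε hε
    obtain ⟨N, hN⟩ := h1 ε hε
    refine ⟨N, fun m hm n hn => lt_of_le_of_lt ?_ (hN m hm n hn)⟩
    rw [dist_eq_norm, dist_eq_norm]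
    exact ((hF m).sub (hF n)).norm_le i j
  choose G hG using fun i j => cauchySeq_tendsto_of_complete (hcauchy i j)
  have hlc : Continuous laurent :=
    (AddMonoidHomClass.isometry_of_norm laurent norm_laurent).continuous
  refine ⟨Matrix.of G, fun k => ?_⟩
  have h1 : Tendsto (fun n => colRep P k (u n)) atTop (𝓝 (colRep P k T)) := by
    rw [tendsto_iff_norm_sub_tendsto_zero] at hlim ⊢
    refine squeeze_zero (fun _ => norm_nonneg _) (fun n => ?_) hlim
    rw [← map_sub]
    exact norm_colRep_le _ _
  have h2 : Tendsto (fun n => D.toep k (F n)) atTop (𝓝 (D.toep k (Matrix.of G))) := by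
    refine tendsto_finsetSum _ fun i _ =>
      ((continuous_const.clm_comp continuous_id).tendsto _).comp ?_
    exact tendsto_finsetSum _ fun j _ =>
      ((hlc.clm_comp continuous_const).tendsto _).comp (hG i j)
  exact isCompactOperator_of_tendsto (h1.sub h2) (Eventually.of_forall fun n => hF n k)

theorem toeplitz_le_symbolAlgebra [Nonempty Ω] : toeplitz P ≤ D.symbolAlgebra := by
  refine StarSubalgebra.topologicalClosure_minimal (StarAlgebra.adjoin_le ?_)
    D.isClosed_symbolAlgebra
  rintro _ (⟨a, rfl⟩ | ⟨n, A, hA, rfl⟩)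
  · exact ⟨_, D.hasSymbol_leftAct a⟩
  · rw [SetLike.mem_coe, shift_eq_sum]
    refine sum_mem fun i _ => sum_mem fun j _ => ?_
    by_cases hij : 0 < ((P : Matrix Ω Ω ℝ) ^ n) i j
    · obtain ⟨s, hs⟩ := D.dvd_of_pos hij
      exact ⟨_, (D.hasSymbol_sh hij hs).smul _⟩
    · rw [hA i j hij, zero_smul]
      exact zero_mem _

/-- The Toeplitz operator with symbol `F` on the Fock module. -/
def toepOp : Matrix Ω Ω C(Circle, ℂ) →ₗ[ℂ] Adjointable P :=
  ∑ k, (colIncl P k : (FockCol P k →L[ℂ] FockCol P k) →ₗ[ℂ] Adjointable P) ∘ₗ D.toep k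

theorem toepOp_apply (F : Matrix Ω Ω C(Circle, ℂ)) :
    D.toepOp F = ∑ k, colIncl P k (D.toep k F) := by
  rw [toepOp, LinearMap.sum_apply]
  rfl

theorem colRep_toepOp (F : Matrix Ω Ω C(Circle, ℂ)) (k : Ω) :
    colRep P k (D.toepOp F) = D.toep k F := by
  rw [toepOp_apply, map_sum, Finset.sum_eq_single k (fun l _ hl => colRep_colIncl_ne hl.symm _)
    (by simp), colRep_colIncl_same]

theorem hasSymbol_toepOp (F : Matrix Ω Ω C(Circle, ℂ)) : D.HasSymbol (D.toepOp F) F := fun k => by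
  rw [colRep_toepOp, sub_self]
  exact isCompactOperator_zero

variable {D} in
theorem HasSymbol.isCompactOperator_sub {T : Adjointable P} {F : Matrix Ω Ω C(Circle, ℂ)}
    (h : D.HasSymbol T F) (k : Ω) : IsCompactOperator (colRep P k (T - D.toepOp F)) := by
  rw [map_sub, colRep_toepOp]
  exact h k

variable {D} in
-- An operator and the Toeplitz operator of its symbol differ by an operator with compact columns,
-- and all of those lie in the Toeplitz algebra.
theorem HasSymbol.toepOp_mem {T : Adjointable P} {F : Matrix Ω Ω C(Circle, ℂ)}
    (h : D.HasSymbol T F) (hT : T ∈ toeplitz P) : D.toepOp F ∈ toeplitz P := by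
  have h1 := sub_mem hT (mem_toeplitz_of_isCompactOperator h.isCompactOperator_sub)
  rwa [sub_sub_cancel] at h1

theorem toepOp_single_monom_mem_of_le {i j : Ω} {n : ℕ} {s : ℤ} (hn : D.N ≤ n)
    (hs : (n : ℤ) + D.c i - D.c j = D.r * s) :
    D.toepOp (Matrix.single i j (monom s)) ∈ toeplitz P := by
  have hij : 0 < ((P : Matrix Ω Ω ℝ) ^ n) i j := D.pos_of_dvd hn ⟨s, hs⟩
  have h := (D.hasSymbol_sh hij hs).toepOp_mem (sh_mem_toeplitz n i j)
  rw [map_smul] at h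
  have hw : (Real.sqrt (((P : Matrix Ω Ω ℝ) ^ n) i j) : ℂ) ≠ 0 := by
    exact_mod_cast (Real.sqrt_pos.2 hij).ne'
  have h2 := SMulMemClass.smul_mem (Real.sqrt (((P : Matrix Ω Ω ℝ) ^ n) i j) : ℂ)⁻¹ h
  rwa [inv_smul_smul₀ hw] at h2

/-- Large powers of `z` come directly from generators. An arbitrary power is obtained as `z^s =
conj(z^a) z^{s+a}` with `a` large, since products and adjoints of symbols are realized modulo
compacts. -/
theorem toepOp_single_monom_mem (i j : Ω) (s : ℤ) :
    D.toepOp (Matrix.single i j (monom s)) ∈ toeplitz P := by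
  have hr : (1 : ℤ) ≤ D.r := by exact_mod_cast D.r_pos
  -- Large enough that both degrees, `r * a` and `r * (s + a) + c j - c i`, are at least `N`.
  set a : ℕ := D.N + D.c i + s.natAbs with ha
  have h1 : D.toepOp (Matrix.single i i (monom a)) ∈ toeplitz P := by
    refine D.toepOp_single_monom_mem_of_le (n := D.r * a) ?_ ?_
    · have := Nat.le_mul_of_pos_left a D.r_pos
      omega
    · push_cast
      ring
  have h2 : D.toepOp (Matrix.single i j (monom (s + a))) ∈ toeplitz P := by
    obtain ⟨n, hn⟩ : ∃ n : ℕ, (n : ℤ) = D.r * (s + a) + D.c j - D.c i := by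
      have h3 : s + a ≤ D.r * (s + a) := le_mul_of_one_le_left (by omega) hr
      exact ⟨_, Int.toNat_of_nonneg (a := D.r * (s + a) + D.c j - D.c i) (by omega)⟩
    have h3 : s + a ≤ D.r * (s + a) := le_mul_of_one_le_left (by omega) hr
    exact D.toepOp_single_monom_mem_of_le (n := n) (by omega) (by omega)
  have h3 := ((D.hasSymbol_toepOp (Matrix.single i i (monom a))).star.mul
    (D.hasSymbol_toepOp (Matrix.single i j (monom (s + a))))).toepOp_mem (mul_mem (star_mem h1) h2)
  rwa [Matrix.star_eq_conjTranspose, Matrix.conjTranspose_single, Matrix.single_mul_single_same,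
    star_monom, ← monom_add, show -(a : ℤ) + (s + a) = s by ring] at h3

/-- By linearity one matrix entry suffices, and for that entry the monomials span a dense subspace
of `C(𝕋)`, while the Toeplitz algebra is closed. -/
theorem toepOp_mem (F : Matrix Ω Ω C(Circle, ℂ)) : D.toepOp F ∈ toeplitz P := by
  have hlc : Continuous laurent :=
    (AddMonoidHomClass.isometry_of_norm laurent norm_laurent).continuous
  have hsingle : ∀ i j g, D.toepOp (Matrix.single i j g) ∈ toeplitz P := by
    intro i j g
    let S : Submodule ℂ C(Circle, ℂ) := (Subalgebra.toSubmodule (toeplitz P).toSubalgebra).comap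
      (D.toepOp ∘ₗ Matrix.singleLinearMap ℂ i j)
    have hS : S = ⊤ := by
      refine eq_top_of_monom_mem ?_ fun s => D.toepOp_single_monom_mem i j s
      have hcl : IsClosed (toeplitz P : Set (Adjointable P)) := inferInstance
      refine hcl.preimage (f := fun g => D.toepOp (Matrix.single i j g)) ?_
      simp_rw [toepOp_apply, toep_single]
      exact continuous_finsetSum _ fun k _ => (colIncl P k).continuous.comp
        (continuous_const.clm_comp (hlc.clm_comp continuous_const))
    have hg : g ∈ S := hS ▸ Submodule.mem_top
    exact hg
  rw [Matrix.matrix_eq_sum_single F, map_sum]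
  refine sum_mem fun i _ => ?_
  rw [map_sum]
  exact sum_mem fun j _ => hsingle i j _

/-- An element of the ideal has a symbol, which must vanish; what remains of each column is the
compact perturbation. -/
theorem isCompactOperator_of_mem_cpIdeal (D : CyclicClasses P) [Nonempty Ω] {T : toeplitz P}
    (hT : T ∈ cpIdeal P)
    (k : Ω) : IsCompactOperator (colRep P k (T : Adjointable P)) := by
  obtain ⟨F, hF⟩ := D.toeplitz_le_symbolAlgebra T.2
  have h := hF k
  rwa [D.symbol_eq_zero hT (hF k), map_zero, sub_zero] at h

theorem quotMap_eq_of_hasSymbol {T S : toeplitz P} {F : Matrix Ω Ω C(Circle, ℂ)}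
    (hT : D.HasSymbol T F) (hS : D.HasSymbol S F) : quotMap P T = quotMap P S := by
  refine Ideal.Quotient.eq.2 (mem_cpIdeal_of_isCompactOperator fun k => ?_)
  have h := (hT.sub hS) k
  rw [sub_self, map_zero, sub_zero] at h
  exact h

/-- The map that sends a symbol to the class of its Toeplitz operator. -/
def symbolHom : Matrix Ω Ω C(Circle, ℂ) →⋆ₐ[ℂ] cuntzPimsner P where
  toFun F := quotMap P ⟨D.toepOp F, D.toepOp_mem F⟩
  map_one' := by
    rw [← map_one (quotMap P)]
    exact D.quotMap_eq_of_hasSymbol (D.hasSymbol_toepOp 1) D.hasSymbol_one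
  map_mul' F G := by
    rw [← map_mul]
    exact D.quotMap_eq_of_hasSymbol (D.hasSymbol_toepOp _)
      ((D.hasSymbol_toepOp F).mul (D.hasSymbol_toepOp G))
  map_zero' := by
    rw [← map_zero (quotMap P)]
    exact congrArg _ (Subtype.ext (map_zero D.toepOp))
  map_add' F G := by
    rw [← map_add]
    exact congrArg _ (Subtype.ext (map_add D.toepOp F G))
  commutes' c := by
    rw [← AlgHomClass.commutes (quotMap P), Algebra.algebraMap_eq_smul_one,
      Algebra.algebraMap_eq_smul_one]
    exact D.quotMap_eq_of_hasSymbol (D.hasSymbol_toepOp _) (D.hasSymbol_one.smul c)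
  map_star' F := by
    rw [← map_star]
    exact D.quotMap_eq_of_hasSymbol (D.hasSymbol_toepOp _) (D.hasSymbol_toepOp F).star

/-- Injectivity is the vanishing of the symbol on the ideal, and surjectivity is the existence of a
symbol for every element of the Toeplitz algebra. -/
theorem symbolHom_bijective [Nonempty Ω] : Function.Bijective D.symbolHom := by
  constructor
  · rw [injective_iff_map_eq_zero]
    intro F hF
    have h : (⟨D.toepOp F, D.toepOp_mem F⟩ : toeplitz P) ∈ cpIdeal P :=
      Ideal.Quotient.eq_zero_iff_mem.1 hF
    obtain ⟨k⟩ := ‹Nonempty Ω›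
    exact D.symbol_eq_zero h (D.hasSymbol_toepOp F k)
  · intro y
    obtain ⟨T, rfl⟩ := Ideal.Quotient.mk_surjective y
    obtain ⟨F, hF⟩ := D.toeplitz_le_symbolAlgebra T.2
    exact ⟨F, D.quotMap_eq_of_hasSymbol (D.hasSymbol_toepOp F) hF⟩

end CyclicClasses

/-- Matrices of continuous functions as continuous matrix valued functions. -/
def matrixContinuousMapEquiv (X : Type*) [TopologicalSpace X] :
    Matrix Ω Ω C(X, ℂ) ≃⋆ₐ[ℂ] C(X, Matrix Ω Ω ℂ) where
  toFun F := ⟨fun z i j => F i j z, continuous_matrix fun i j => (F i j).continuous⟩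
  invFun f := fun i j => ⟨fun z => f z i j, f.continuous.matrix_elem i j⟩
  left_inv _ := rfl
  right_inv _ := rfl
  map_mul' F G := by
    ext z i j
    simp only [Matrix.mul_apply, ContinuousMap.mul_apply, ContinuousMap.sum_apply]
    rfl
  map_add' _ _ := rfl
  map_star' _ := rfl
  map_smul' _ _ := rfl

theorem nonempty_cuntzPimsner_equiv [Nonempty Ω] (hP : (P : Matrix Ω Ω ℝ).IsIrreducible) :
    Nonempty (cuntzPimsner P ≃⋆ₐ[ℂ] C(Circle, Matrix Ω Ω ℂ)) := by
  obtain ⟨D⟩ := nonempty_cyclicClasses hP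
  exact ⟨(StarAlgEquiv.ofBijective D.symbolHom D.symbolHom_bijective).symm.trans
    (matrixContinuousMapEquiv Circle)⟩

end extension

/-! ### Irreducible representations -/

section irreps

open ContinuousLinearMap

variable {A B : Type*} [Ring A] [StarRing A] [Algebra ℂ A] [Ring B] [StarRing B] [Algebra ℂ B]
  {H : Type*} [NormedAddCommGroup H] [InnerProductSpace ℂ H] [CompleteSpace H]
  {K : Type*} [NormedAddCommGroup K] [InnerProductSpace ℂ K] [CompleteSpace K]
  {L : Type*} [NormedAddCommGroup L] [InnerProductSpace ℂ L] [CompleteSpace L]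

theorem UnitaryEquiv.symm {ρ : A →⋆ₐ[ℂ] (H →L[ℂ] H)} {σ : A →⋆ₐ[ℂ] (K →L[ℂ] K)}
    (h : UnitaryEquiv ρ σ) : UnitaryEquiv σ ρ := by
  obtain ⟨U, hU⟩ := h
  refine ⟨U.symm, fun a v => ?_⟩
  rw [U.symm_apply_eq, hU, U.apply_symm_apply]

theorem UnitaryEquiv.trans {ρ : A →⋆ₐ[ℂ] (H →L[ℂ] H)} {σ : A →⋆ₐ[ℂ] (K →L[ℂ] K)}
    {τ : A →⋆ₐ[ℂ] (L →L[ℂ] L)} (h : UnitaryEquiv ρ σ) (h' : UnitaryEquiv σ τ) :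
    UnitaryEquiv ρ τ := by
  obtain ⟨U, hU⟩ := h
  obtain ⟨V, hV⟩ := h'
  exact ⟨U.trans V, fun a v => by
    rw [LinearIsometryEquiv.trans_apply, LinearIsometryEquiv.trans_apply, hU, hV]⟩

theorem unitaryEquiv_comp_iff {ρ : B →⋆ₐ[ℂ] (H →L[ℂ] H)} {σ : B →⋆ₐ[ℂ] (K →L[ℂ] K)}
    {f : A →⋆ₐ[ℂ] B} (hf : Function.Surjective f) :
    UnitaryEquiv (ρ.comp f) (σ.comp f) ↔ UnitaryEquiv ρ σ :=
  ⟨fun ⟨U, hU⟩ => ⟨U, fun b v => by obtain ⟨a, rfl⟩ := hf b; exact hU a v⟩,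
    fun ⟨U, hU⟩ => ⟨U, fun a v => hU (f a) v⟩⟩

theorem isIrrep_comp_iff {ρ : B →⋆ₐ[ℂ] (H →L[ℂ] H)} {f : A →⋆ₐ[ℂ] B}
    (hf : Function.Surjective f) : IsIrrep (ρ.comp f) ↔ IsIrrep ρ :=
  and_congr_right fun _ => forall_congr' fun V => forall_congr' fun _ =>
    ⟨fun h hV => h fun a => hV (f a), fun h hV => h fun b => by
      obtain ⟨a, rfl⟩ := hf b
      exact hV a⟩

/-- The orbit of a vector under a representation. -/
def orbitMap (ρ : A →⋆ₐ[ℂ] (H →L[ℂ] H)) (h : H) : A →ₗ[ℂ] H where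
  toFun a := ρ a h
  map_add' a b := by rw [map_add, add_apply]
  map_smul' c a := by rw [map_smul, smul_apply, RingHom.id_apply]

/-- The closure of the orbit is an invariant closed subspace containing `h`, as representations are
unital. So every non-zero vector is cyclic. -/
theorem IsIrrep.denseRange_orbitMap {ρ : A →⋆ₐ[ℂ] (H →L[ℂ] H)} (hρ : IsIrrep ρ) {h : H}
    (hh : h ≠ 0) : DenseRange (orbitMap ρ h) := by
  have hmem : h ∈ (LinearMap.range (orbitMap ρ h)).topologicalClosure :=
    Submodule.le_topologicalClosure _ ⟨1, by simp [orbitMap]⟩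
  rcases hρ.2 (LinearMap.range (orbitMap ρ h)).topologicalClosure
    (Submodule.isClosed_topologicalClosure _) (fun a v hv => by
      refine map_mem_closure (ρ a).continuous hv ?_
      rintro _ ⟨b, rfl⟩
      exact ⟨a * b, by simp [orbitMap]⟩) with h1 | h1
  · rw [h1, Submodule.mem_bot] at hmem
    exact absurd hmem hh
  · have h2 := Submodule.dense_iff_topologicalClosure_eq_top.2 h1
    rwa [LinearMap.coe_range] at h2

theorem exists_unit_fixed {E : Type*} [NormedAddCommGroup E] [InnerProductSpace ℂ E]
    {p : E →L[ℂ] E} (hp : p * p = p) (h0 : p ≠ 0) : ∃ h : E, ‖h‖ = 1 ∧ p h = h := by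
  obtain ⟨v, hv⟩ : ∃ v, p v ≠ 0 := by
    by_contra hcon
    push Not at hcon
    exact h0 (ContinuousLinearMap.ext hcon)
  refine ⟨(‖p v‖⁻¹ : ℂ) • p v, ?_, ?_⟩
  · rw [norm_smul, norm_inv, Complex.norm_real, norm_norm]
    exact inv_mul_cancel₀ (norm_ne_zero_iff.2 hv)
  · rw [map_smul, ← mul_apply_eq_comp, hp]

/-- For `h` fixed by `ρ p`, the squared norm of `ρ a h` is the value of the vector state of `h` at
`p a* a p`. Thus the corner alone determines the norms along the orbit. -/
theorem sq_norm_eq_of_corner {ρ : A →⋆ₐ[ℂ] (H →L[ℂ] H)} {p : A} (hp : star p = p) {h : H}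
    (hh : ‖h‖ = 1) (hph : ρ p h = h) {a : A} {c : ℂ} (hc : ρ (p * (star a * a) * p) = c • ρ p) :
    (‖ρ a h‖ : ℂ) ^ 2 = c := by
  have h1 : inner ℂ h (ρ (p * (star a * a) * p) h) = inner ℂ (ρ a h) (ρ a h) := by
    rw [map_mul, map_mul, map_mul, mul_apply_eq_comp, mul_apply_eq_comp, mul_apply_eq_comp, hph,
      ← adjoint_inner_left, ← star_eq_adjoint, ← map_star, hp, hph, map_star, star_eq_adjoint,
      adjoint_inner_right]
  rw [hc, smul_apply, hph, inner_smul_right, inner_self_eq_norm_sq_to_K,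
    inner_self_eq_norm_sq_to_K, hh] at h1
  simpa using h1.symm

/-- Irreducible representations which agree on a corner `p A p` on which they are scalar are
unitarily equivalent. -/
theorem IsIrrep.unitaryEquiv_of_corner {ρ : A →⋆ₐ[ℂ] (H →L[ℂ] H)} {σ : A →⋆ₐ[ℂ] (K →L[ℂ] K)}
    (hρ : IsIrrep ρ) (hσ : IsIrrep σ) {p : A} (hp : star p = p) (hpp : p * p = p) (hρp : ρ p ≠ 0)
    (hσp : σ p ≠ 0) (hc : ∀ a, ∃ c : ℂ, ρ (p * a * p) = c • ρ p ∧ σ (p * a * p) = c • σ p) :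
    UnitaryEquiv ρ σ := by
  obtain ⟨h, hh, hph⟩ := exists_unit_fixed (p := ρ p) (by rw [← map_mul, hpp]) hρp
  obtain ⟨k, hk, hpk⟩ := exists_unit_fixed (p := σ p) (by rw [← map_mul, hpp]) hσp
  have hnorm : ∀ a, ‖orbitMap σ k (LinearEquiv.refl ℂ A a)‖ = ‖orbitMap ρ h a‖ := by
    intro a
    obtain ⟨c, h1, h2⟩ := hc (star a * a)
    have h3 := (sq_norm_eq_of_corner hp hk hpk h2).trans
      (sq_norm_eq_of_corner hp hh hph h1).symm
    have h4 : ‖σ a k‖ ^ 2 = ‖ρ a h‖ ^ 2 := by exact_mod_cast h3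
    exact (pow_left_inj₀ (norm_nonneg _) (norm_nonneg _) two_ne_zero).1 h4
  have hh0 : h ≠ 0 := fun h0 => by simp [h0] at hh
  have hk0 : k ≠ 0 := fun h0 => by simp [h0] at hk
  have hd1 := hρ.denseRange_orbitMap hh0
  have hd2 := hσ.denseRange_orbitMap hk0
  -- Both orbits are parametrized by `A` with equal norms, so `ρ a h ↦ σ a k` is well defined and
  -- isometric between dense subspaces. It extends to a unitary.
  set U := (LinearEquiv.refl ℂ A).extendOfIsometry (orbitMap ρ h) (orbitMap σ k) hd1 hd2 hnorm
    with hU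
  have hUa : ∀ a, U (ρ a h) = σ a k := fun a =>
    (LinearEquiv.refl ℂ A).extendOfIsometry_eq (orbitMap ρ h) (orbitMap σ k) hd1 hd2 hnorm a
  refine ⟨U, fun a v => ?_⟩
  refine hd1.induction_on (p := fun v => U (ρ a v) = σ a (U v)) v ?_ fun b => ?_
  · exact isClosed_eq (U.continuous.comp (ρ a).continuous) ((σ a).continuous.comp U.continuous)
  · change U (ρ a (ρ b h)) = σ a (U (ρ b h))
    rw [hUa, ← mul_apply_eq_comp, ← mul_apply_eq_comp, ← map_mul, ← map_mul, hUa]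

end irreps

/-! ### Irreducible representations of `C(𝕋, M_d)` -/

section matrixFunctions

open ContinuousLinearMap

/-- The evaluation representation of `C(𝕋, M_d)` at a point of the circle. -/
def matRep (z : Circle) :
    C(Circle, Matrix Ω Ω ℂ) →⋆ₐ[ℂ] (EuclideanSpace ℂ Ω →L[ℂ] EuclideanSpace ℂ Ω) :=
  (StarAlgHomClass.toStarAlgHom (Matrix.toEuclideanCLM (n := Ω) (𝕜 := ℂ))).comp (matEval z)

theorem matRep_apply (z : Circle) (f : C(Circle, Matrix Ω Ω ℂ)) (v : EuclideanSpace ℂ Ω) (i : Ω) :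
    matRep z f v i = (f z).mulVec v i := rfl

/-- Scalar functions as functions with values in the scalar matrices. -/
def scalarHom : C(Circle, ℂ) →⋆ₐ[ℂ] C(Circle, Matrix Ω Ω ℂ) where
  toFun g := ⟨fun z => Matrix.diagonal fun _ => g z, by fun_prop⟩
  map_one' := by ext z i j; simp [Matrix.one_apply]
  map_mul' f g := by ext z i j; simp [Matrix.diagonal_apply]
  map_zero' := by ext z i j; simp
  map_add' f g := by ext z i j; simp [Matrix.diagonal_apply]; split_ifs <;> simp
  commutes' c := by ext z i j; simp [Matrix.one_apply, Matrix.diagonal_apply]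
  map_star' g := by
    ext z i j
    simp [Matrix.diagonal_apply, Matrix.star_apply, eq_comm]
    split_ifs <;> simp

theorem scalarHom_apply (g : C(Circle, ℂ)) (z : Circle) :
    scalarHom (Ω := Ω) g z = Matrix.diagonal fun _ => g z := rfl

theorem scalarHom_mul_comm (g : C(Circle, ℂ)) (f : C(Circle, Matrix Ω Ω ℂ)) :
    scalarHom g * f = f * scalarHom g := by
  ext z i j
  simp [scalarHom_apply, mul_comm]

theorem matRep_scalarHom (z : Circle) (g : C(Circle, ℂ)) :
    matRep (Ω := Ω) z (scalarHom g) = g z • 1 := by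
  ext v i
  rw [matRep_apply, scalarHom_apply]
  simp [Matrix.mulVec_diagonal]

/-- Constant matrix units already move any non-zero vector to every standard basis vector. -/
theorem isIrrep_matRep [Nonempty Ω] (z : Circle) : IsIrrep (matRep (Ω := Ω) z) := by
  refine ⟨inferInstance, fun V _ hinv => ?_⟩
  by_cases hV : V = ⊥
  · exact Or.inl hV
  · right
    obtain ⟨v, hv, hv0⟩ := V.exists_mem_ne_zero_of_ne_bot hV
    obtain ⟨i, hi⟩ : ∃ i, v i ≠ 0 := by
      by_contra hcon
      push Not at hcon
      exact hv0 (by ext i; exact hcon i)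
    have hb : ∀ j, EuclideanSpace.single j (1 : ℂ) ∈ V := by
      intro j
      have h1 := V.smul_mem (v i)⁻¹ (hinv (ContinuousMap.const _ (Matrix.single j i 1)) v hv)
      have h2 : (v i)⁻¹ • matRep z (ContinuousMap.const _ (Matrix.single j i 1)) v =
          EuclideanSpace.single j (1 : ℂ) := by
        ext l
        rw [PiLp.smul_apply, matRep_apply, ContinuousMap.const_apply, Matrix.single_mulVec]
        rcases eq_or_ne l j with rfl | hl
        · simp [hi]
        · simp [hl]
      rwa [h2] at h1
    refine eq_top_iff.2 fun w _ => ?_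
    have hw : w = ∑ j, w j • EuclideanSpace.single j (1 : ℂ) := by
      ext l
      simp [Finset.sum_apply, Pi.single_apply]
    rw [hw]
    exact V.sum_mem fun j _ => V.smul_mem _ (hb j)

/-- The central function `u ↦ u - z` acts by zero in one representation and by the non-zero scalar
`w - z` in the other. -/
theorem not_unitaryEquiv_matRep [Nonempty Ω] {z w : Circle} (h : z ≠ w) :
    ¬ UnitaryEquiv (matRep (Ω := Ω) z) (matRep (Ω := Ω) w) := by
  rintro ⟨U, hU⟩
  let g : C(Circle, ℂ) := monom 1 - algebraMap ℂ _ (z : ℂ)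
  have hg : ∀ u : Circle, g u = u - z := fun u => by simp [g, monom_apply]
  obtain ⟨v, hv⟩ := exists_ne (0 : EuclideanSpace ℂ Ω)
  have h1 := hU (scalarHom g) v
  have hz : g z • v = 0 := by rw [hg, sub_self, zero_smul]
  rw [matRep_scalarHom, matRep_scalarHom, smul_apply, smul_apply, one_apply_eq_self,
    one_apply_eq_self, hz, map_zero, eq_comm, smul_eq_zero, hg, sub_eq_zero] at h1
  rcases h1 with h1 | h1
  · exact h (Circle.ext h1).symm
  · exact hv (U.map_eq_zero_iff.1 h1)

variable {H : Type*} [NormedAddCommGroup H] [InnerProductSpace ℂ H] [CompleteSpace H]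

/-- The scalar functions act by evaluation at a point in an irreducible representation. -/
theorem IsIrrep.exists_scalar {ρ : C(Circle, Matrix Ω Ω ℂ) →⋆ₐ[ℂ] (H →L[ℂ] H)} (hρ : IsIrrep ρ) :
    ∃ z : Circle, ∀ g, ρ (scalarHom g) = g z • 1 := by
  obtain ⟨hnt, hirr⟩ := hρ
  let τ : C(Circle, ℂ) →⋆ₐ[ℂ] (H →L[ℂ] H) := ρ.comp scalarHom
  have hτc : Continuous τ := (AddMonoidHomClass.lipschitz_of_bound τ 1 fun g => by
    rw [one_mul]; exact NonUnitalStarAlgHom.norm_apply_le τ g).continuous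
  -- Scalar functions are central, so the kernel of `τ f` is invariant and hence trivial or
  -- everything. The kernel of `τ` is therefore a prime ideal.
  have hprime : ∀ f g, f * g = 0 → τ f = 0 ∨ τ g = 0 := by
    intro f g hfg
    have hfg' : ∀ v, τ f (τ g v) = 0 := fun v => by
      rw [← mul_apply_eq_comp, ← map_mul, hfg, map_zero, zero_apply]
    rcases hirr (LinearMap.ker (τ f : H →ₗ[ℂ] H)) (τ f).isClosed_ker (fun a v hv => by
      rw [LinearMap.mem_ker] at hv ⊢
      change ρ (scalarHom f) (ρ a v) = 0
      rw [← mul_apply_eq_comp, ← map_mul, scalarHom_mul_comm, map_mul, mul_apply_eq_comp]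
      exact (congrArg (ρ a) hv).trans (map_zero _)) with h | h
    · right
      ext1 v
      have h1 : τ g v ∈ LinearMap.ker (τ f : H →ₗ[ℂ] H) := hfg' v
      rwa [h, Submodule.mem_bot] at h1
    · left
      ext1 v
      have h1 : v ∈ LinearMap.ker (τ f : H →ₗ[ℂ] H) := h ▸ Submodule.mem_top
      exact h1
  let I : Ideal C(Circle, ℂ) := RingHom.ker τ
  have hI : IsClosed (I : Set C(Circle, ℂ)) := isClosed_singleton.preimage hτc
  have hIeq := ContinuousMap.idealOfSet_ofIdeal_isClosed hI
  have hzero : ∀ z, z ∉ ContinuousMap.setOfIdeal I → ∀ f, τ f = 0 → f z = 0 := fun z hz f hf =>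
    ContinuousMap.notMem_setOfIdeal.1 hz hf
  obtain ⟨z, hz⟩ : ∃ z, z ∉ ContinuousMap.setOfIdeal I := by
    by_contra hcon
    push Not at hcon
    have h1 : (1 : C(Circle, ℂ)) ∈ I := by
      rw [← hIeq, ContinuousMap.mem_idealOfSet]
      exact fun x hx => absurd (hcon x) hx
    have h2 : τ 1 = 0 := h1
    rw [map_one] at h2
    exact one_ne_zero h2
  -- Two distinct points in the zero set of the ideal would be separated by functions with product
  -- zero, each non-zero at one of the points; primality forbids this. The functions are the
  -- positive and negative parts of the difference of the distances to the points.
  have huniq : ∀ w, w ∉ ContinuousMap.setOfIdeal I → w = z := by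
    intro w hw
    by_contra hne
    let d : Circle → ℝ := fun u => dist u z - dist u w
    let f : C(Circle, ℂ) := ⟨fun u => ((max (-d u) 0 : ℝ) : ℂ), by fun_prop⟩
    let g : C(Circle, ℂ) := ⟨fun u => ((max (d u) 0 : ℝ) : ℂ), by fun_prop⟩
    have hfg : f * g = 0 := by
      ext u
      change ((max (-d u) 0 : ℝ) : ℂ) * ((max (d u) 0 : ℝ) : ℂ) = 0
      rcases le_total (d u) 0 with h | h
      · rw [max_eq_right h]; simp
      · rw [max_eq_right (neg_nonpos.2 h)]; simp
    have hdist : 0 < dist w z := dist_pos.2 hne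
    rcases hprime f g hfg with h | h
    · have h1 : ((max (-d z) 0 : ℝ) : ℂ) = 0 := hzero z hz f h
      rw [Complex.ofReal_eq_zero] at h1
      have h2 := le_max_left (-d z) 0
      simp only [d, dist_self, dist_comm z w] at h1 h2
      linarith
    · have h1 : ((max (d w) 0 : ℝ) : ℂ) = 0 := hzero w hw g h
      rw [Complex.ofReal_eq_zero] at h1
      have h2 := le_max_left (d w) 0
      simp only [d, dist_self] at h1 h2
      linarith
  refine ⟨z, fun g => ?_⟩
  -- A closed ideal of `C(𝕋)` consists of all functions vanishing on its zero set, which is the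
  -- single point `z`.
  have h1 : g - algebraMap ℂ _ (g z) ∈ I := by
    rw [← hIeq, ContinuousMap.mem_idealOfSet]
    intro w hw
    rw [huniq w hw]
    simp
  have h2 : τ (g - algebraMap ℂ _ (g z)) = 0 := h1
  rw [map_sub, sub_eq_zero, AlgHomClass.commutes, Algebra.algebraMap_eq_smul_one] at h2
  exact h2

/-- The diagonal matrix units sum to `1`, so one of them is not killed. Its corner consists of
scalar functions times the unit, and scalar functions act by evaluation at `z` in both
representations. -/
theorem IsIrrep.exists_unitaryEquiv_matRep [Nonempty Ω]
    {ρ : C(Circle, Matrix Ω Ω ℂ) →⋆ₐ[ℂ] (H →L[ℂ] H)} (hρ : IsIrrep ρ) :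
    ∃ z, UnitaryEquiv ρ (matRep z) := by
  obtain ⟨z, hz⟩ := hρ.exists_scalar
  refine ⟨z, ?_⟩
  let e : Ω → C(Circle, Matrix Ω Ω ℂ) := fun k => ContinuousMap.const _ (Matrix.single k k 1)
  obtain ⟨k, hk⟩ : ∃ k, ρ (e k) ≠ 0 := by
    by_contra hcon
    push Not at hcon
    have := hρ.1
    have hsum : ∑ k, e k = 1 := by
      ext u : 1
      rw [ContinuousMap.sum_apply]
      exact Matrix.sum_single_one
    have h1 : ρ 1 = 0 := by
      rw [← hsum, map_sum]
      exact Finset.sum_eq_zero fun k _ => hcon k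
    rw [map_one] at h1
    exact one_ne_zero h1
  refine hρ.unitaryEquiv_of_corner (isIrrep_matRep z) (p := e k) ?_ ?_ hk ?_ fun a => ?_
  · ext u : 1
    change star (Matrix.single k k (1 : ℂ)) = Matrix.single k k 1
    rw [Matrix.star_eq_conjTranspose, Matrix.conjTranspose_single, star_one]
  · ext u : 1
    change Matrix.single k k (1 : ℂ) * Matrix.single k k 1 = Matrix.single k k 1
    rw [Matrix.single_mul_single_same, one_mul]
  · intro h0
    have h1 := congrArg (fun T : EuclideanSpace ℂ Ω →L[ℂ] EuclideanSpace ℂ Ω =>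
      T (EuclideanSpace.single k 1) k) h0
    simp only [matRep_apply, zero_apply, e, ContinuousMap.const_apply] at h1
    simp at h1
  · let g : C(Circle, ℂ) := ⟨fun u => a u k k, a.continuous.matrix_elem k k⟩
    have h1 : e k * a * e k = scalarHom g * e k := by
      ext u i j
      change (Matrix.single k k (1 : ℂ) * a u * Matrix.single k k 1 : Matrix Ω Ω ℂ) i j =
        ((Matrix.diagonal fun _ => a u k k) * Matrix.single k k (1 : ℂ) : Matrix Ω Ω ℂ) i j
      rw [Matrix.single_mul_mul_single, Matrix.diagonal_mul]
      simp [Matrix.single_apply]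
    refine ⟨g z, ?_, ?_⟩
    · rw [h1, map_mul, hz, smul_mul_assoc, one_mul]
    · rw [h1, map_mul, matRep_scalarHom, smul_mul_assoc, one_mul]

end matrixFunctions

/-! ### Irreducible representations of the Toeplitz algebra -/

section representations

open InnerProductSpace ContinuousLinearMap

variable {P : Matrix.rowStochastic ℝ Ω}

/-- The vacuum projection of the `k`-th column as an element of the Toeplitz algebra. -/
def vacProj (P : Matrix.rowStochastic ℝ Ω) (k : Ω) : toeplitz P :=
  ⟨matUnit k (vac P k) (vac P k), matUnit_mem_toeplitz _ _⟩

theorem isCompactOperator_colRep_matUnit {k : Ω} (p q : Idx P k) (l : Ω) :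
    IsCompactOperator (colRep P l (matUnit k p q)) := by
  rw [matUnit]
  rcases eq_or_ne l k with rfl | h
  · rw [colRep_colIncl_same]
    exact isCompactOperator_rankOne _ _
  · rw [colRep_colIncl_ne h]
    exact isCompactOperator_zero

theorem vacProj_mem_cpIdeal (k : Ω) : vacProj P k ∈ cpIdeal P :=
  mem_cpIdeal_of_isCompactOperator (isCompactOperator_colRep_matUnit _ _)

theorem piRep_vacProj_same (k : Ω) :
    piRep P k (vacProj P k) = rankOne ℂ (bv (vac P k)) (bv (vac P k)) :=
  colRep_colIncl_same _ _

theorem piRep_vacProj_ne {k l : Ω} (h : l ≠ k) : piRep P l (vacProj P k) = 0 :=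
  colRep_colIncl_ne h _

theorem piRep_vacProj_bv (k : Ω) : piRep P k (vacProj P k) (bv (vac P k)) = bv (vac P k) := by
  rw [piRep_vacProj_same, rankOne_apply, inner_bv, bv_apply, if_pos rfl, one_smul]

theorem bv_ne_zero {I : Type*} [DecidableEq I] (p : I) : bv p ≠ 0 := fun h => by
  have := norm_bv p
  rw [h, norm_zero] at this
  exact zero_ne_one this

theorem piRep_vacProj_ne_zero (k : Ω) : piRep P k (vacProj P k) ≠ 0 := fun h => by
  have h1 := piRep_vacProj_bv (P := P) k
  rw [h, zero_apply] at h1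
  exact bv_ne_zero _ h1.symm

/-- The image contains all matrix units of the column. These carry any non-zero vector to every
basis vector, and the basis spans a dense subspace. -/
theorem isIrrep_piRep (k : Ω) : IsIrrep (piRep P k) := by
  refine ⟨⟨bv (vac P k), 0, bv_ne_zero _⟩, fun V hV hinv => ?_⟩
  by_cases h0 : V = ⊥
  · exact Or.inl h0
  · right
    obtain ⟨v, hv, hv0⟩ := V.exists_mem_ne_zero_of_ne_bot h0
    obtain ⟨p, hp⟩ : ∃ p, v p ≠ 0 := by
      by_contra hcon
      push Not at hcon
      exact hv0 (lp.ext (funext hcon))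
    have hb : Submodule.span ℂ (Set.range (bv (I := Idx P k))) ≤ V := by
      rw [Submodule.span_le]
      rintro _ ⟨q, rfl⟩
      have h1 := V.smul_mem (v p)⁻¹ (hinv ⟨matUnit k q p, matUnit_mem_toeplitz q p⟩ v hv)
      have h2 : piRep P k ⟨matUnit k q p, matUnit_mem_toeplitz q p⟩ = rankOne ℂ (bv q) (bv p) :=
        colRep_colIncl_same _ _
      rwa [h2, rankOne_apply, inner_bv, inv_smul_smul₀ hp] at h1
    exact eq_top_iff.2 fun w _ => hV.closure_subset_iff.2 hb (dense_span_bv w)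

/-- The vacuum projection of column `k` acts as a non-zero operator in `π_k` and as zero in `π_l`.
-/
theorem not_unitaryEquiv_piRep {k l : Ω} (h : k ≠ l) : ¬ UnitaryEquiv (piRep P k) (piRep P l) := by
  rintro ⟨U, hU⟩
  have h1 := hU (vacProj P k) (bv (vac P k))
  rw [piRep_vacProj_bv, piRep_vacProj_ne h.symm, zero_apply] at h1
  exact bv_ne_zero _ (U.map_eq_zero_iff.1 h1)

/-- Row `k` has a basis vector at every large position, so the orthonormal basis is infinite. -/
theorem not_finiteDimensional_fockCol (D : CyclicClasses P) (k : Ω) :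
    ¬ FiniteDimensional ℂ (FockCol P k) := by
  intro hfin
  have hon : Orthonormal ℂ (bv (I := Idx P k)) := by
    rw [orthonormal_iff_ite]
    intro p q
    rw [inner_bv, bv_apply]
  have hidx : Finite (Idx P k) := hon.linearIndependent.finite
  obtain ⟨T₀, hT₀⟩ := D.exists_pos_eq k
  choose p _ hp using fun t : ℕ => hT₀ (T₀ + t) (by omega) k
  have hinj : Function.Injective p := fun s t hst => by
    have h1 := hp s
    rw [hst, hp t] at h1
    omega
  exact not_injective_infinite_finite p hinj

theorem star_vacProj (k : Ω) : star (vacProj P k) = vacProj P k := by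
  refine Subtype.ext (adjointable_ext fun l => ?_)
  change colRep P l (star (matUnit k (vac P k) (vac P k))) = colRep P l (matUnit k _ _)
  rw [map_star, matUnit]
  rcases eq_or_ne l k with rfl | h
  · rw [colRep_colIncl_same, star_eq_adjoint, adjoint_rankOne]
  · rw [colRep_colIncl_ne h, star_zero]

/-- The vacuum projection has rank one on its column and vanishes on the others, so its corner is
scalar. As an identity inside the algebra, this gives the same scalar in every representation, as
needed to compare an arbitrary one with `π_k`. -/
theorem vacProj_mul_mul (k : Ω) (T : toeplitz P) : vacProj P k * T * vacProj P k =
    (inner ℂ (bv (vac P k)) (piRep P k T (bv (vac P k))) : ℂ) • vacProj P k := by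
  refine Subtype.ext ?_
  change matUnit k (vac P k) (vac P k) * (T : Adjointable P) * matUnit k (vac P k) (vac P k) =
    (inner ℂ (bv (vac P k)) (colRep P k T (bv (vac P k))) : ℂ) • matUnit k (vac P k) (vac P k)
  refine adjointable_ext fun l => ?_
  rw [map_smul, map_mul, map_mul, matUnit]
  rcases eq_or_ne l k with rfl | h
  · rw [colRep_colIncl_same]
    ext1 x
    simp only [mul_apply_eq_comp, rankOne_apply, map_smul, smul_apply, smul_smul]
    rw [mul_comm]
  · rw [colRep_colIncl_ne h, mul_zero, smul_zero]

theorem vacProj_mul_self (k : Ω) : vacProj P k * vacProj P k = vacProj P k := by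
  have h := vacProj_mul_mul (P := P) k 1
  rwa [mul_one, map_one, one_apply_eq_self, inner_bv, bv_apply, if_pos rfl, one_smul] at h

variable {H : Type*} [NormedAddCommGroup H] [InnerProductSpace ℂ H] [CompleteSpace H]

/-- A representation that vanishes on the vacuum projections vanishes on the operators with compact
columns. -/
theorem rep_eq_zero_of_vacProj {ρ : toeplitz P →⋆ₐ[ℂ] (H →L[ℂ] H)}
    (hρ : ∀ k, ρ (vacProj P k) = 0) {T : toeplitz P}
    (hT : ∀ k, IsCompactOperator (colRep P k (T : Adjointable P))) : ρ T = 0 := by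
  have hspan : ∀ X ∈ Submodule.span ℂ {X : Adjointable P | ∃ k p q, X = matUnit k p q},
      ∃ hX : X ∈ toeplitz P, ρ ⟨X, hX⟩ = 0 := by
    intro X hX
    induction hX using Submodule.span_induction with
    | mem X hX =>
      obtain ⟨k, p, q, rfl⟩ := hX
      refine ⟨matUnit_mem_toeplitz p q, ?_⟩
      -- Every matrix unit factors through the vacuum, so it is killed along with the vacuum
      -- projection.
      have h : (⟨matUnit k p q, matUnit_mem_toeplitz p q⟩ : toeplitz P) =
          ⟨matUnit k p (vac P k), matUnit_mem_toeplitz _ _⟩ * vacProj P k *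
            ⟨matUnit k (vac P k) q, matUnit_mem_toeplitz _ _⟩ := by
        refine Subtype.ext ?_
        change matUnit k p q = matUnit k p (vac P k) * colIncl P k _ * matUnit k (vac P k) q
        rw [mul_colIncl_mul, matUnit, matUnit, matUnit, colRep_colIncl_same, colRep_colIncl_same]
        congr 1
        ext1 x
        simp only [mul_apply_eq_comp, rankOne_apply, map_smul, inner_bv, bv_apply, if_pos, one_smul]
      rw [h, map_mul, map_mul, hρ, mul_zero, zero_mul]
    | zero => exact ⟨zero_mem _, map_zero ρ⟩
    | add X Y _ _ hX hY =>
      obtain ⟨hX, hX0⟩ := hX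
      obtain ⟨hY, hY0⟩ := hY
      refine ⟨add_mem hX hY, ?_⟩
      have h := map_add ρ ⟨X, hX⟩ ⟨Y, hY⟩
      rw [hX0, hY0, add_zero] at h
      exact h
    | smul c X _ hX =>
      obtain ⟨hX, hX0⟩ := hX
      refine ⟨SMulMemClass.smul_mem c hX, ?_⟩
      have h := map_smul ρ c ⟨X, hX⟩
      rw [hX0, smul_zero] at h
      exact h
  rw [← norm_le_zero_iff]
  refine le_of_forall_pos_le_add fun ε hε => ?_
  rw [zero_add]
  obtain ⟨X, hX, hTX⟩ := Metric.mem_closure_iff.1 (mem_closure_span_matUnit hT) ε hε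
  obtain ⟨hXm, hX0⟩ := hspan X hX
  have h1 : ρ T = ρ (T - ⟨X, hXm⟩) := by rw [map_sub, hX0, sub_zero]
  rw [h1]
  refine (NonUnitalStarAlgHom.norm_apply_le ρ _).trans ?_
  rw [dist_eq_norm] at hTX
  exact hTX.le

/-- If all vacuum projections were killed, so would be the whole ideal, which they generate. A
surviving one provides the scalar corner on which to compare with `π_k`. -/
theorem IsIrrep.exists_unitaryEquiv_piRep [Nonempty Ω] (D : CyclicClasses P)
    {ρ : toeplitz P →⋆ₐ[ℂ] (H →L[ℂ] H)} (hρ : IsIrrep ρ) (h : ∃ T ∈ cpIdeal P, ρ T ≠ 0) :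
    ∃ k, UnitaryEquiv ρ (piRep P k) := by
  obtain ⟨T, hT, hT0⟩ := h
  obtain ⟨k, hk⟩ : ∃ k, ρ (vacProj P k) ≠ 0 := by
    by_contra hcon
    push Not at hcon
    exact hT0 (rep_eq_zero_of_vacProj hcon (D.isCompactOperator_of_mem_cpIdeal hT))
  refine ⟨k, hρ.unitaryEquiv_of_corner (isIrrep_piRep k) (star_vacProj k) (vacProj_mul_self k) hk
    (piRep_vacProj_ne_zero k) fun a =>
      ⟨inner ℂ (bv (vac P k)) (piRep P k a (bv (vac P k))), ?_, ?_⟩⟩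
  · rw [vacProj_mul_mul, map_smul]
  · rw [vacProj_mul_mul, map_smul]

/-- The quotient map followed by an identification of the quotient. -/
def quotHom (Φ : cuntzPimsner P ≃⋆ₐ[ℂ] C(Circle, Matrix Ω Ω ℂ)) :
    toeplitz P →⋆ₐ[ℂ] C(Circle, Matrix Ω Ω ℂ) :=
  (StarAlgHomClass.toStarAlgHom Φ).comp (quotMap P)

theorem quotHom_surjective (Φ : cuntzPimsner P ≃⋆ₐ[ℂ] C(Circle, Matrix Ω Ω ℂ)) :
    Function.Surjective (quotHom Φ) :=
  Φ.surjective.comp Ideal.Quotient.mk_surjective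

theorem evRep_eq (Φ : cuntzPimsner P ≃⋆ₐ[ℂ] C(Circle, Matrix Ω Ω ℂ)) (z : Circle) :
    evRep Φ z = (matRep z).comp (quotHom Φ) := rfl

theorem quotMap_eq_zero {T : toeplitz P} (hT : T ∈ cpIdeal P) : quotMap P T = 0 :=
  Ideal.Quotient.eq_zero_iff_mem.2 hT

/-- A representation that vanishes on the ideal factors through the quotient. -/
theorem exists_eq_comp_quotHom (Φ : cuntzPimsner P ≃⋆ₐ[ℂ] C(Circle, Matrix Ω Ω ℂ))
    {ρ : toeplitz P →⋆ₐ[ℂ] (H →L[ℂ] H)} (h : ∀ T ∈ cpIdeal P, ρ T = 0) :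
    ∃ ρ' : C(Circle, Matrix Ω Ω ℂ) →⋆ₐ[ℂ] (H →L[ℂ] H), ρ = ρ'.comp (quotHom Φ) := by
  let ρ₀ : cuntzPimsner P →⋆ₐ[ℂ] (H →L[ℂ] H) :=
    { Ideal.Quotient.liftₐ (cpIdeal P) (ρ : toeplitz P →ₐ[ℂ] (H →L[ℂ] H)) h with
      map_star' := by
        rintro ⟨T⟩
        exact map_star ρ T }
  refine ⟨ρ₀.comp (StarAlgHomClass.toStarAlgHom Φ.symm), ?_⟩
  ext1 T
  change ρ T = ρ₀ (Φ.symm (Φ (quotMap P T)))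
  rw [Φ.symm_apply_apply]
  rfl

end representations

end StochasticToeplitz

end

theorem mainTheorem10 {Ω : Type*} [Fintype Ω] [DecidableEq Ω] [Nonempty Ω]
    (P : Matrix.rowStochastic ℝ Ω) (hP : (P : Matrix Ω Ω ℝ).IsIrreducible) :
    -- `T ↦ (π_k(T))_k` is faithful and maps `J(T(P))` onto `⨁_k K(F_{P,k})`
    ((∀ T : toeplitz P, (∀ k, piRep P k T = 0) → T = 0) ∧
      ∀ K : (k : Ω) → FockCol P k →L[ℂ] FockCol P k,
        (∃ T ∈ cpIdeal P, ∀ k, piRep P k T = K k) ↔ ∀ k, IsCompactOperator (K k)) ∧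
    -- the `π_k` are irreducible, infinite-dimensional, non-zero on `J(T(P))`, and inequivalent
    (∀ k, IsIrrep (piRep P k) ∧ ¬ FiniteDimensional ℂ (FockCol P k) ∧
      ∃ T ∈ cpIdeal P, piRep P k T ≠ 0) ∧
    (∀ k l, k ≠ l → ¬ UnitaryEquiv (piRep P k) (piRep P l)) ∧
    -- `O(P) ≅ C(𝕋, M_d)`, and for every such identification `Φ`:
    Nonempty (cuntzPimsner P ≃⋆ₐ[ℂ] C(Circle, Matrix Ω Ω ℂ)) ∧
    ∀ Φ : cuntzPimsner P ≃⋆ₐ[ℂ] C(Circle, Matrix Ω Ω ℂ),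
      -- the `ev_z ∘ q` are irreducible, `d`-dimensional, vanish on `J(T(P))`, and are inequivalent
      (∀ z, IsIrrep (evRep Φ z) ∧
        Module.finrank ℂ (EuclideanSpace ℂ Ω) = Fintype.card Ω ∧
        ∀ T ∈ cpIdeal P, evRep Φ z T = 0) ∧
      (∀ z w, z ≠ w → ¬ UnitaryEquiv (evRep Φ z) (evRep Φ w)) ∧
      -- every irreducible representation is equivalent to exactly one of them
      ∀ (H : Type*) [NormedAddCommGroup H] [InnerProductSpace ℂ H] [CompleteSpace H]
        (ρ : toeplitz P →⋆ₐ[ℂ] (H →L[ℂ] H)), IsIrrep ρ →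
        ((∃ T ∈ cpIdeal P, ρ T ≠ 0) → ∃! k, UnitaryEquiv ρ (piRep P k)) ∧
        ((∀ T ∈ cpIdeal P, ρ T = 0) → ∃! z, UnitaryEquiv ρ (evRep Φ z)) := by
  obtain ⟨D⟩ := nonempty_cyclicClasses hP
  refine ⟨⟨fun T hT => ?_, fun K => ⟨?_, fun hK => ?_⟩⟩,
    fun k => ⟨isIrrep_piRep k, not_finiteDimensional_fockCol D k,
      vacProj P k, vacProj_mem_cpIdeal k, piRep_vacProj_ne_zero k⟩,
    fun k l h => not_unitaryEquiv_piRep h, nonempty_cuntzPimsner_equiv hP, fun Φ => ?_⟩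
  · exact Subtype.ext (adjointable_ext fun k => (hT k).trans (map_zero (colRep P k)).symm)
  · rintro ⟨T, hT, hTK⟩ k
    rw [← hTK k]
    exact D.isCompactOperator_of_mem_cpIdeal hT k
  · have hK' : ∀ k, IsCompactOperator (colRep P k (ofCols K)) := fun k => by
      rw [colRep_ofCols]
      exact hK k
    exact ⟨⟨ofCols K, mem_toeplitz_of_isCompactOperator hK'⟩,
      mem_cpIdeal_of_isCompactOperator hK', colRep_ofCols K⟩
  have hne : ∀ z w, z ≠ w → ¬ UnitaryEquiv (evRep Φ z) (evRep Φ w) := fun z w h h' =>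
    not_unitaryEquiv_matRep h ((unitaryEquiv_comp_iff (quotHom_surjective Φ)).1 h')
  refine ⟨fun z => ⟨?_, finrank_euclideanSpace, fun T hT => ?_⟩, hne, ?_⟩
  · rw [evRep_eq, isIrrep_comp_iff (quotHom_surjective Φ)]
    exact isIrrep_matRep z
  · have h : quotHom Φ T = 0 := (congrArg Φ (quotMap_eq_zero hT)).trans (map_zero Φ)
    rw [evRep_eq, StarAlgHom.comp_apply, h, map_zero]
  intro H _ _ _ ρ hρ
  refine ⟨fun h => ?_, fun h => ?_⟩
  · obtain ⟨k, hk⟩ := hρ.exists_unitaryEquiv_piRep D h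
    refine ⟨k, hk, fun l hl => ?_⟩
    by_contra hlk
    exact not_unitaryEquiv_piRep hlk (hl.symm.trans hk)
  · obtain ⟨ρ', rfl⟩ := exists_eq_comp_quotHom Φ h
    obtain ⟨z, hz⟩ := ((isIrrep_comp_iff (quotHom_surjective Φ)).1 hρ).exists_unitaryEquiv_matRep
    have hz' := (unitaryEquiv_comp_iff (quotHom_surjective Φ)).2 hz
    refine ⟨z, hz', fun w hw => ?_⟩
    by_contra hwz
    exact hne w z hwz (UnitaryEquiv.symm hw |>.trans hz')
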